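/- Let $\mathcal R$ be the Levi-Civita field: functions $x:\mathbb Q\to\mathbb R$ with left-finite support, with formal power series product $(xy)(q)=\sum_{q_1+q_2=q}x(q_1)y(q_2)$, ordered by the sign of the coefficient at the least exponent. Let $\mathcal R_{fin}$ be its ring of finite elements and $\mathrm{sh}:\mathcal R\to\mathbb R\cup\{\pm\infty\}$ the standard part. Derivatives and continuity in $\mathcal R$ are those of the order topology. Strong convergence is convergence in the order topology; $c_m\to l$ weakly if for every real $\varepsilon>0$ one has, for all large $m$, $|(c_m-l)(q)|<\varepsilon$ for all $q\le\varepsilon^{-1}$. *Integrals.* A function is simple on a bounded interval $I$ if on $I$ it is the sum of a power series centred at a point of $I$ and weakly convergent at every point of $I$; its integral over $I$ is the difference of the endpoint limits of a simple antiderivative. A set $A\subseteq\mathcal R$ is measurable if for every $\varepsilon>0$ in $\mathcal R$ there are sequences of disjoint intervals $(I_n)$, $(J_n)$ with $\bigcup I_n\subseteq A\subseteq\bigcup J_n$, strongly convergent total lengths, and $\sum l(J_n)-\sum l(I_n)\le\varepsilon$; its measure $\mathfrak m(A)$ is the supremum of the inner sums. A function $f$ is measurable on $A$ if for every $\varepsilon>0$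 there are disjoint intervals $I_n\subseteq A$ on each of which $f$ is simple, with $\mathfrak m(A)-\sum l(I_n)<\varepsilon$; $\int_A f$ is the limit of $\sum_n\int_{I_n}f$ along such sequences as $\sum l(I_n)\to \mathfrak m(A)$. Write $f\in L^1(A)$ if $f$ and $|f|$ are measurable on $A$ and $\int_A|f|$ exists in $\mathcal R$. A bounded $f$ is $M$-integrable on $A$ if $$\sup\Big\{\mathrm{sh}\int_A g: g\in L^1(A),\ g\le f\Big\}=\inf\Big\{\mathrm{sh}\int_A g: g\in L^1(A),\ g\ge f\Big\},$$ and the common value is $\int_A^M f$. An unbounded non-negative $f$ is $M$-integrable if the supremum is $<+\infty$, which is then $\int^M_A f$; for a general unbounded $f$ one requires this of $f^+$ and $f^-$ and sets $\int_A^Mf=\int_A^Mf^+-\int_A^Mf^-$. Finally $\int^M_{\mathcal R_{fin}}f=\lim_{t\to\infty}\int^M_{[-t,t]_{\mathcal R}}f$ ($t$ real), and $f$ is $M$-integrable on $\mathcal R_{fin}$ if this limit exists and is finite. *Dirac-like functions and extensions.* Let $r\in\mathbb R$. An $M$-integrable $\delta_r:\mathcal R_{fin}\to\mathcal R$ is Dirac-like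 at $r$ if $\delta_r\ge0$, $\delta_r$ vanishes outside $[r-h,r+h]_{\mathcal R}$ for some infinitesimal $h>0$, and $\int^M_{\mathcal R_{fin}}\delta_r=1$. For $f\in C^n(\mathbb R)$, $n\in\mathbb N\cup\{\infty\}$, and $0\le j\le n$, the order $j$ extension of $f$ is $$\mathrm{ext}_jf(s+\varepsilon)=\sum_{i=0}^{j}f^{(i)}(s)\frac{\varepsilon^i}{i!}\qquad(s\in\mathbb R,\ \varepsilon\text{ infinitesimal}),$$ where for $j=\infty$ the sum is a weak limit. **Proposition.** Let $r\in\mathbb R$, $k\in\mathbb N$, and let $\delta_r$ be Dirac-like at $r$. Suppose that $\delta_r$ is $k$ times continuously differentiable on $\mathcal R_{fin}$ and that $\delta_r$ and $\delta_r^{(k)}$ belong to $L^1([a,b]_{\mathcal R})$ for all finite $a<b$. Then for every $f\in C^n(\mathbb R)$ with $n\in\mathbb N\cup\{\infty\}$, $n\ge k$, and for every $j$ with $k\le j\le n$ ($j=\infty$ allowed if $n=\infty$), the function $\delta_r^{(k)}\cdot\mathrm{ext}_jf$ is $M$-integrable on $\mathcal R_{fin}$ and $$\int^M_{\mathcal R_{fin}}\big(\delta_r^{(k)}\cdot\mathrm{ext}_jf\big)=(-1)^kf^{(k)}(r).$$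 -/

import Mathlib

open Filter Topology

noncomputable section

/-! ## The Levi-Civita field -/

/-- The formal series `∑ x_q d^q` (`q ∈ ℚ`, `x_q ∈ ℝ`) with left-finite support, as a subring of the
Hahn series, with the order given by the sign of the coefficient at the least exponent. -/
def leviCivitaSubring : Subring (Lex (HahnSeries ℚ ℝ)) where
  carrier := {x | ∀ q : ℚ, {p : ℚ | (ofLex x).coeff p ≠ 0 ∧ p ≤ q}.Finite}
  zero_mem' := fun q => by simp
  one_mem' := fun q => by
    refine (Set.finite_singleton (0 : ℚ)).subset ?_
    rintro p ⟨hp, -⟩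
    by_contra h
    exact hp (by
      change (1 : HahnSeries ℚ ℝ).coeff p = 0
      rw [HahnSeries.coeff_one, if_neg (by simpa using h)])
  add_mem' := fun {x y} hx hy q => by
    refine ((hx q).union (hy q)).subset ?_
    rintro p ⟨hp, hpq⟩
    by_cases h : (ofLex x).coeff p = 0
    · refine Or.inr ⟨fun h' => hp ?_, hpq⟩
      rw [ofLex_add, HahnSeries.coeff_add, h, h', add_zero]
    · exact Or.inl ⟨h, hpq⟩
  neg_mem' := fun {x} hx q => by
    refine (hx q).subset ?_
    rintro p ⟨hp, hpq⟩
    refine ⟨fun h => hp ?_, hpq⟩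
    rw [ofLex_neg, HahnSeries.coeff_neg, h, neg_zero]
  mul_mem' := fun {x y} hx hy q => by
    refine (((hx (q - (ofLex y).order)).prod (hy (q - (ofLex x).order))).image
      (fun z : ℚ × ℚ => z.1 + z.2)).subset ?_
    rintro p ⟨hp, hpq⟩
    obtain ⟨a, ha, b, hb, hab⟩ :=
      HahnSeries.support_mul_subset (x := ofLex x) (y := ofLex y) hp
    have ha' := HahnSeries.order_le_of_coeff_ne_zero (x := ofLex x) ha
    have hb' := HahnSeries.order_le_of_coeff_ne_zero (x := ofLex y) hb
    have hab' : a + b = p := hab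
    exact ⟨(a, b), ⟨⟨ha, by linarith⟩, ⟨hb, by linarith⟩⟩, hab'⟩

/-- The Levi-Civita field, with its ring operations and its linear order. -/
abbrev LC : Type := leviCivitaSubring

namespace LC

/-- The coefficient `x(q)`. -/
def coeff (x : LC) (q : ℚ) : ℝ := (ofLex (x : Lex (HahnSeries ℚ ℝ))).coeff q

/-- The embedding of the real numbers. -/
def ofReal (y : ℝ) : LC :=
  ⟨toLex (HahnSeries.C y), fun q => by
    refine (Set.finite_singleton (0 : ℚ)).subset ?_
    rintro p ⟨hp, -⟩
    by_contra h
    refine hp ?_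
    change (HahnSeries.C y : HahnSeries ℚ ℝ).coeff p = 0
    rw [HahnSeries.C_apply, HahnSeries.coeff_single_of_ne h]⟩

/-- `x` is infinitesimal (zero included). -/
def IsInfinitesimal (x : LC) : Prop := ∀ y : ℝ, 0 < y → |x| ≤ ofReal y

/-- `x` is finite. -/
def IsFinite (x : LC) : Prop := ∃ y : ℝ, |x| < ofReal y

/-- The standard part `inf {y ∈ ℝ : x ≤ y}`; it is `⊤` (resp. `⊥`) at positive (resp. negative)
infinite elements. -/
def st (x : LC) : EReal := sInf {e | ∃ y : ℝ, x ≤ ofReal y ∧ e = (y : EReal)}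

/-! ## Convergence -/

/-- Strong convergence (convergence in the order topology) of a sequence. -/
def StrongLim (s : ℕ → LC) (l : LC) : Prop :=
  ∀ ε : LC, 0 < ε → ∃ N, ∀ m, N ≤ m → |s m - l| < ε

/-- Strong convergence of a series. -/
def StrongSum (u : ℕ → LC) (l : LC) : Prop :=
  StrongLim (fun N => ∑ n ∈ Finset.range N, u n) l

/-- Weak convergence of a sequence. -/
def WeakLim (s : ℕ → LC) (l : LC) : Prop :=
  ∀ ε : ℝ, 0 < ε → ∃ N, ∀ m, N ≤ m → ∀ q : ℚ, (q : ℝ) ≤ ε⁻¹ → |(s m - l).coeff q| < ε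

open Classical in
/-- The weak limit of a sequence (`0` if there is none). -/
def wlim (s : ℕ → LC) : LC := if h : ∃ l, WeakLim s l then h.choose else 0

/-- Limit of a function at a point, along a set, in the order topology. -/
def LimAt (F : LC → LC) (S : Set LC) (p l : LC) : Prop :=
  ∀ ε : LC, 0 < ε → ∃ η : LC, 0 < η ∧ ∀ x ∈ S, 0 < |x - p| → |x - p| < η → |F x - l| < ε

/-! ## Derivatives -/

/-- `f` has derivative `l` at `x`: `|(f y - f x) / (y - x) - l| ≤ ε` for `y ≠ x` near `x`. -/
def HasDeriv (f : LC → LC) (l x : LC) : Prop :=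
  ∀ ε : LC, 0 < ε → ∃ η : LC, 0 < η ∧
    ∀ y : LC, |y - x| < η → |f y - f x - l * (y - x)| ≤ ε * |y - x|

open Classical in
/-- The derivative (`0` at the points where there is none). -/
def deriv (f : LC → LC) (x : LC) : LC := if h : ∃ l, HasDeriv f l x then h.choose else 0

/-- The `k`-th derivative. -/
def iterDeriv (k : ℕ) (f : LC → LC) : LC → LC := deriv^[k] f

/-- `f` is continuous at `x` for the order topology. -/
def ContAt (f : LC → LC) (x : LC) : Prop :=
  ∀ ε : LC, 0 < ε → ∃ η : LC, 0 < η ∧ ∀ y : LC, |y - x| < η → |f y - f x| < ε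

/-- `f` is `k` times differentiable at the points of `S` (a set which is open in the uses below),
and its derivatives of order at most `k` are continuous there. -/
def IsCk (k : ℕ) (f : LC → LC) (S : Set LC) : Prop :=
  (∀ m < k, ∀ x ∈ S, ∃ l, HasDeriv (iterDeriv m f) l x) ∧
    ∀ m ≤ k, ∀ x ∈ S, ContAt (iterDeriv m f) x

/-! ## Extension of real functions -/

/-- The order `j` extension of a real function: at `r + e` with `r` real and `e` infinitesimal it is
`∑_{i ≤ j} f⁽ⁱ⁾(r) eⁱ / i!`, the sum being a weak limit for `j = ∞`. It is used at finite points
only. -/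
def ext (j : ℕ∞) (f : ℝ → ℝ) (x : LC) : LC :=
  let r : ℝ := (st x).toReal
  wlim fun N => ∑ i ∈ (Finset.range N).filter (fun i : ℕ => (i : ℕ∞) ≤ j),
    ofReal (iteratedDeriv i f r / (i.factorial : ℝ)) * (x - ofReal r) ^ i

/-! ## Intervals and the uniform measure -/

/-- Bounded intervals `I(a,b)`, `a < b`: each endpoint may belong to the interval or not. -/
structure Interval where
  left : LC
  right : LC
  lt : left < right
  carrier : Set LC
  Ioo_subset : Set.Ioo left right ⊆ carrier
  subset_Icc : carrier ⊆ Set.Icc left right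

/-- The length of an interval. -/
def Interval.length (I : Interval) : LC := I.right - I.left

/-- The intervals of a sequence are mutually disjoint. -/
def IsDisjointSeq (I : ℕ → Interval) : Prop :=
  ∀ m n, m ≠ n → Disjoint (I m).carrier (I n).carrier

/-- `A` is measurable: it can be approximated from inside and from outside by sequences of disjoint
intervals with strongly convergent total lengths. -/
def IsMeasurable (A : Set LC) : Prop :=
  ∀ ε : LC, 0 < ε → ∃ (I J : ℕ → Interval) (s t : LC),
    IsDisjointSeq I ∧ IsDisjointSeq J ∧
    (⋃ n, (I n).carrier) ⊆ A ∧ A ⊆ (⋃ n, (J n).carrier) ∧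
    StrongSum (fun n => (I n).length) s ∧ StrongSum (fun n => (J n).length) t ∧ t - s ≤ ε

/-- `A` is measurable and its measure is `μ`, the supremum of the total lengths of the sequences of
disjoint intervals inside `A`. -/
def HasMeasure (A : Set LC) (μ : LC) : Prop :=
  IsMeasurable A ∧
    IsLUB {s | ∃ I : ℕ → Interval, IsDisjointSeq I ∧ (⋃ n, (I n).carrier) ⊆ A ∧
      StrongSum (fun n => (I n).length) s} μ

/-! ## Measurable functions and their integral with values in the Levi-Civita field -/

/-- `f` is simple on the interval `I`: there it is the sum of a power series, centred at a point of
`I`, that converges weakly at every point of `I`. -/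
def IsSimpleOn (f : LC → LC) (I : Interval) : Prop :=
  ∃ x₀ ∈ I.carrier, ∃ c : ℕ → LC, ∀ x ∈ I.carrier,
    WeakLim (fun N => ∑ n ∈ Finset.range N, c n * (x - x₀) ^ n) (f x)

/-- The integral over `I` of the simple function `f` is `v`: it is the difference of the limits at
the endpoints of a simple antiderivative of `f`. -/
def HasSimpleIntegral (f : LC → LC) (I : Interval) (v : LC) : Prop :=
  IsSimpleOn f I ∧ ∃ F : LC → LC, IsSimpleOn F I ∧
    (∀ x ∈ Set.Ioo I.left I.right, HasDeriv F (f x) x) ∧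
    ∃ L R : LC, LimAt F I.carrier I.left L ∧ LimAt F I.carrier I.right R ∧ v = R - L

/-- The sequences of mutually disjoint intervals inside `A` on which `f` is simple. -/
def Admissible (f : LC → LC) (A : Set LC) (I : ℕ → Interval) : Prop :=
  IsDisjointSeq I ∧ (⋃ n, (I n).carrier) ⊆ A ∧ ∀ n, IsSimpleOn f (I n)

/-- `f` is a measurable function on the measurable set `A`. -/
def IsMeasurableOn (f : LC → LC) (A : Set LC) : Prop :=
  ∃ μ, HasMeasure A μ ∧ ∀ ε : LC, 0 < ε → ∃ (I : ℕ → Interval) (s : LC),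
    Admissible f A I ∧ StrongSum (fun n => (I n).length) s ∧ μ - s < ε

/-- The measurable function `f` has integral `v ∈ LC` over `A`: `v` is the limit of
`∑ₙ ∫_{Iₙ} f` along the admissible sequences, as `∑ₙ l(Iₙ)` tends to the measure of `A`. -/
def HasIntegral (f : LC → LC) (A : Set LC) (v : LC) : Prop :=
  IsMeasurableOn f A ∧ ∃ μ, HasMeasure A μ ∧
    ∀ ε : LC, 0 < ε → ∃ η : LC, 0 < η ∧ ∀ (I : ℕ → Interval) (s : LC),
      Admissible f A I → StrongSum (fun n => (I n).length) s → μ - s < η →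
        ∃ (u : ℕ → LC) (w : LC), (∀ n, HasSimpleIntegral f (I n) (u n)) ∧
          StrongSum u w ∧ |w - v| < ε

/-- `f ∈ L¹(A)`: `f` is measurable on `A` and `|f|` has an integral in the Levi-Civita field. -/
def IsL1 (f : LC → LC) (A : Set LC) : Prop :=
  IsMeasurableOn f A ∧ ∃ v, HasIntegral (fun x => |f x|) A v

/-! ## The real-valued integral -/

/-- `f` is bounded on `A`. -/
def IsBoundedOn (f : LC → LC) (A : Set LC) : Prop := ∃ M : LC, ∀ x ∈ A, |f x| ≤ M

/-- The supremum of the standard parts of the integrals of the `L¹` functions below `f`. -/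
def lowerM (f : LC → LC) (A : Set LC) : EReal :=
  sSup {e | ∃ (g : LC → LC) (v : LC),
    IsL1 g A ∧ HasIntegral g A v ∧ (∀ x ∈ A, g x ≤ f x) ∧ e = st v}

/-- The infimum of the standard parts of the integrals of the `L¹` functions above `f`. -/
def upperM (f : LC → LC) (A : Set LC) : EReal :=
  sInf {e | ∃ (g : LC → LC) (v : LC),
    IsL1 g A ∧ HasIntegral g A v ∧ (∀ x ∈ A, f x ≤ g x) ∧ e = st v}

/-- The bounded function `f` is M-integrable over `A`, with M-integral `v`. -/
def HasMIntBdd (f : LC → LC) (A : Set LC) (v : EReal) : Prop :=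
  IsBoundedOn f A ∧ lowerM f A = v ∧ upperM f A = v

/-- The non-negative function `f` is M-integrable over `A`, with M-integral `v`. -/
def HasMIntNonneg (f : LC → LC) (A : Set LC) (v : EReal) : Prop :=
  HasMIntBdd f A v ∨ (¬ IsBoundedOn f A ∧ lowerM f A < ⊤ ∧ lowerM f A = v)

/-- `f` is M-integrable over the measurable set `A`, with M-integral `v`. An unbounded `f` is
treated through its positive and negative parts. -/
def HasMInt (f : LC → LC) (A : Set LC) (v : EReal) : Prop :=
  (∃ μ, HasMeasure A μ) ∧
    (HasMIntBdd f A v ∨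
      (¬ IsBoundedOn f A ∧ ∃ vp vm : EReal,
        HasMIntNonneg (fun x => max (f x) 0) A vp ∧
        HasMIntNonneg (fun x => max (-f x) 0) A vm ∧ v = vp - vm))

/-- `f` is M-integrable over the set of all finite elements, with M-integral the real number `v`:
the M-integrals over `[-t, t]` exist for large real `t` and tend to `v` as `t → ∞`. -/
def HasMIntFin (f : LC → LC) (v : ℝ) : Prop :=
  ∃ u : ℝ → EReal,
    (∀ᶠ t : ℝ in atTop, HasMInt f (Set.Icc (ofReal (-t)) (ofReal t)) (u t)) ∧
    Tendsto u atTop (𝓝 (v : EReal))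

/-- The M-integrable function `δ` on the finite elements is Dirac-like at the real number `r`. -/
def IsDiracLike (δ : LC → LC) (r : ℝ) : Prop :=
  (∀ x, IsFinite x → 0 ≤ δ x) ∧
    (∃ h : LC, 0 < h ∧ IsInfinitesimal h ∧
      ∀ x, IsFinite x → δ x ≠ 0 → x ∈ Set.Icc (ofReal r - h) (ofReal r + h)) ∧
    HasMIntFin δ 1

/-- `f` is in `L¹([a,b])` for all finite `a < b`. -/
def IsL1Fin (f : LC → LC) : Prop :=
  ∀ a b : LC, IsFinite a → IsFinite b → a < b → IsL1 f (Set.Icc a b)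

end LC

end

noncomputable section

namespace LC

/-! ## Coefficients -/

/-! All points of the ball of infinitesimal radius `R = 2h` about `r` have standard part `r`. So on
this ball the extension of `f` is a single power series `T` with real coefficients `f⁽ⁱ⁾(r)/i!`, cut
off beyond `j`. Outside the strip of radius `h` the function `δ` and its derivatives vanish, and
hence on `[-t, t]` the integrand is `δ⁽ᵏ⁾ T`. Repeated integration by parts, without boundary terms,
turns its integral into `(-1)ᵏ ∫ δ T⁽ᵏ⁾` (`Bump.integral_eq`). On the ball `T⁽ᵏ⁾` differs from
`f⁽ᵏ⁾(r)` by at most a fixed infinitesimal. As `δ ≥ 0`, the integral differs from `f⁽ᵏ⁾(r) ∫ δ` by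
an infinitesimal multiple of `∫ δ` (`Bump.exists_abs_sub_le`). Taking standard parts and letting `t
→ ∞` gives the value. The M-integral of a bounded `L¹` function that has an integral is the standard
part of that integral, since the function competes with itself from both sides (`lowerM_eq`,
`upperM_eq`).

The work lies in justifying calculus on a field whose order topology is totally disconnected:
continuity does not give boundedness, and a vanishing derivative does not give constancy. Three
tools replace compactness.

A power series that converges weakly on an interval has, after rescaling, coefficients that decrease
faster than every power of the index, exponent by exponent (`nice_of_weakLim`). Such series (`Nice`)
converge on the whole closed disc and are stable under sums, products, recentring, differentiation
and integration. Convergence rests on the polynomial growth of the coefficients of powers, obtained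
from weighted norms (`exists_poly_bound`). Restriction to real points reduces monotonicity to real
calculus (`Nice.ev_le`), and this makes integrals of simple functions well defined and monotone.

Measurable functions are analytic only up to small total length. A property that is additive, local,
and true on every subinterval up to small total length is true globally (`cousin`, by nested gaps
and Cauchy completeness). This bounds the derivatives of `δ` and shows that the boundary function
`partsFn` is Lipschitz, so that its increments over the gaps of a family are negligible
(`FamInt.le`).

Finally, the absolute value of `δ⁽ᵏ⁾ T` has to be measurable. A power series with real coefficients
keeps a constant sign on each side of its centre at infinitesimal scale (`constSign_rser`), and so
the measurability of `|δ⁽ᵏ⁾|` is enough. -/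

@[ext] lemma ext_coeff {x y : LC} (h : ∀ q, x.coeff q = y.coeff q) : x = y := by
  apply Subtype.ext
  apply ofLex.injective
  exact HahnSeries.ext (funext h)

lemma finite_support (x : LC) (q : ℚ) : {p : ℚ | x.coeff p ≠ 0 ∧ p ≤ q}.Finite := x.2 q

@[simp] lemma coeff_zero (q : ℚ) : coeff 0 q = 0 := rfl

@[simp] lemma coeff_add (x y : LC) (q : ℚ) : (x + y).coeff q = x.coeff q + y.coeff q := rfl

@[simp] lemma coeff_neg (x : LC) (q : ℚ) : (-x).coeff q = -x.coeff q := rfl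

@[simp] lemma coeff_sub (x y : LC) (q : ℚ) : (x - y).coeff q = x.coeff q - y.coeff q := rfl

/-- The additive map `x ↦ x(q)`. -/
def coeffHom (q : ℚ) : LC →+ ℝ where
  toFun x := x.coeff q
  map_zero' := rfl
  map_add' _ _ := rfl

lemma coeff_sum {ι : Type*} (s : Finset ι) (f : ι → LC) (q : ℚ) :
    (∑ i ∈ s, f i).coeff q = ∑ i ∈ s, (f i).coeff q :=
  map_sum (coeffHom q) f s

/-- A family of coefficients with left-finite support, as an element of the Levi-Civita field. -/
def mk (f : ℚ → ℝ) (hf : ∀ q, {p : ℚ | f p ≠ 0 ∧ p ≤ q}.Finite) : LC :=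
  ⟨toLex ⟨f, by
    rw [Set.isPWO_iff_isWF, Set.isWF_iff_no_descending_seq]
    intro g hg hmem
    have h1 : Set.range g ⊆ {p : ℚ | f p ≠ 0 ∧ p ≤ g 0} := by
      rintro _ ⟨n, rfl⟩
      exact ⟨hmem n, hg.antitone (Nat.zero_le n)⟩
    exact Set.infinite_range_of_injective hg.injective ((hf _).subset h1)⟩, hf⟩

@[simp] lemma coeff_mk (f : ℚ → ℝ) (hf) (q : ℚ) : (mk f hf).coeff q = f q := rfl

/-- The index set may be any finite set containing the relevant exponents, so that one set can serve
many products at once. -/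
lemma coeff_mul (x y : LC) (q : ℚ) (T : Finset ℚ)
    (hT : ∀ p, x.coeff p ≠ 0 → y.coeff (q - p) ≠ 0 → p ∈ T) :
    (x * y).coeff q = ∑ p ∈ T, x.coeff p * y.coeff (q - p) := by
  change (ofLex (x : Lex (HahnSeries ℚ ℝ)) * ofLex (y : Lex (HahnSeries ℚ ℝ))).coeff q = _
  rw [HahnSeries.coeff_mul]
  refine Finset.sum_of_injOn (fun ij => ij.1) ?_ ?_ ?_ ?_
  · rintro ⟨a, b⟩ h ⟨c, d⟩ h' hac
    simp only [Finset.mem_coe, Finset.mem_antidiagonal] at h h'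
    have e1 : a + b = q := h.2.2
    have e2 : c + d = q := h'.2.2
    have e3 : a = c := hac
    subst e3
    have : b = d := by linarith
    rw [this]
  · rintro ⟨a, b⟩ h
    simp only [Finset.mem_coe, Finset.mem_antidiagonal] at h
    have e1 : a + b = q := h.2.2
    refine hT a h.1 ?_
    rw [← e1, add_sub_cancel_left]
    exact h.2.1
  · intro p hp hp'
    by_contra hne
    apply hp'
    refine ⟨(p, q - p), ?_, rfl⟩
    simp only [Finset.mem_coe, Finset.mem_antidiagonal]
    refine ⟨fun h => hne ?_, fun h => hne ?_, by simp⟩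
    · change x.coeff p = 0 at h
      rw [h, zero_mul]
    · change y.coeff (q - p) = 0 at h
      rw [h, mul_zero]
  · rintro ⟨a, b⟩ h
    simp only [Finset.mem_antidiagonal] at h
    have e1 : a + b = q := h.2.2
    have : q - a = b := by linarith
    simp only [this]
    rfl

/-- The monomial `c d^q`. -/
def mono (c : ℝ) (q : ℚ) : LC :=
  mk (fun p => if p = q then c else 0) fun r => (Set.finite_singleton q).subset (by
    rintro p ⟨hp, -⟩
    by_contra h
    exact hp (if_neg h))

lemma coeff_mono (c : ℝ) (q p : ℚ) : (mono c q).coeff p = if p = q then c else 0 := rfl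

@[simp] lemma coeff_mono_same (c : ℝ) (q : ℚ) : (mono c q).coeff q = c := by simp [coeff_mono]

lemma ofReal_eq_mono (c : ℝ) : ofReal c = mono c 0 := by
  ext q
  change (HahnSeries.C c : HahnSeries ℚ ℝ).coeff q = _
  rw [coeff_mono, HahnSeries.C_apply, HahnSeries.coeff_single]
  split_ifs <;> rfl

lemma coeff_ofReal (c : ℝ) (q : ℚ) : (ofReal c).coeff q = if q = 0 then c else 0 := by
  rw [ofReal_eq_mono, coeff_mono]

@[simp] lemma coeff_ofReal_zero (c : ℝ) : (ofReal c).coeff 0 = c := by simp [coeff_ofReal]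

@[simp] lemma ofReal_one : ofReal 1 = 1 := by
  apply Subtype.ext
  apply ofLex.injective
  exact HahnSeries.C_one

lemma coeff_one (q : ℚ) : (1 : LC).coeff q = if q = 0 then 1 else 0 := by
  rw [← ofReal_one, coeff_ofReal]

@[simp] lemma coeff_one_zero : (1 : LC).coeff 0 = 1 := by simp [coeff_one]

lemma coeff_mono_mul (c : ℝ) (q : ℚ) (x : LC) (p : ℚ) :
    (mono c q * x).coeff p = c * x.coeff (p - q) := by
  rw [coeff_mul _ _ _ {q}]
  · simp
  · intro r hr _
    by_contra h
    rw [Finset.mem_singleton] at h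
    exact hr (by rw [coeff_mono, if_neg h])

lemma coeff_ofReal_mul (c : ℝ) (x : LC) (p : ℚ) : (ofReal c * x).coeff p = c * x.coeff p := by
  rw [ofReal_eq_mono, coeff_mono_mul, sub_zero]

lemma mono_mul_mono (c c' : ℝ) (q q' : ℚ) : mono c q * mono c' q' = mono (c * c') (q + q') := by
  ext p
  rw [coeff_mono_mul, coeff_mono, coeff_mono]
  by_cases h : p = q + q'
  · rw [if_pos h, if_pos (by linarith)]
  · rw [if_neg h, if_neg (fun h' => h (by linarith)), mul_zero]

/-- `ofReal` as a ring homomorphism. -/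
def ofRealHom : ℝ →+* LC where
  toFun := ofReal
  map_one' := ofReal_one
  map_mul' a b := by simp [ofReal_eq_mono, mono_mul_mono]
  map_zero' := by ext q; simp [coeff_ofReal]
  map_add' a b := by
    ext q
    simp only [coeff_ofReal, coeff_add]
    split_ifs <;> simp

@[simp] lemma ofReal_zero : ofReal 0 = 0 := map_zero ofRealHom
@[simp] lemma ofReal_add (a b : ℝ) : ofReal (a + b) = ofReal a + ofReal b := map_add ofRealHom a b
@[simp] lemma ofReal_sub (a b : ℝ) : ofReal (a - b) = ofReal a - ofReal b := map_sub ofRealHom a b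
@[simp] lemma ofReal_neg (a : ℝ) : ofReal (-a) = -ofReal a := map_neg ofRealHom a
@[simp] lemma ofReal_mul (a b : ℝ) : ofReal (a * b) = ofReal a * ofReal b := map_mul ofRealHom a b
@[simp] lemma ofReal_pow (a : ℝ) (n : ℕ) : ofReal (a ^ n) = ofReal a ^ n := map_pow ofRealHom a n
@[simp] lemma ofReal_natCast (n : ℕ) : ofReal (n : ℝ) = n := map_natCast ofRealHom n

lemma coeff_natCast_mul (n : ℕ) (x : LC) (p : ℚ) : ((n : LC) * x).coeff p = n * x.coeff p := by
  rw [← ofReal_natCast, coeff_ofReal_mul]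

/-! ## Order of vanishing -/

/-- The coefficients of `x` at the exponents below `l` vanish. -/
def OrdGE (x : LC) (l : ℚ) : Prop := ∀ p < l, x.coeff p = 0

lemma OrdGE.mono {x : LC} {l m : ℚ} (h : OrdGE x l) (hm : m ≤ l) : OrdGE x m :=
  fun p hp => h p (hp.trans_le hm)

lemma OrdGE.zero (l : ℚ) : OrdGE 0 l := fun _ _ => rfl

lemma OrdGE.add {x y : LC} {l : ℚ} (hx : OrdGE x l) (hy : OrdGE y l) : OrdGE (x + y) l :=
  fun p hp => by rw [coeff_add, hx p hp, hy p hp, add_zero]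

lemma OrdGE.neg {x : LC} {l : ℚ} (hx : OrdGE x l) : OrdGE (-x) l :=
  fun p hp => by rw [coeff_neg, hx p hp, neg_zero]

lemma OrdGE.sub {x y : LC} {l : ℚ} (hx : OrdGE x l) (hy : OrdGE y l) : OrdGE (x - y) l :=
  fun p hp => by rw [coeff_sub, hx p hp, hy p hp, sub_zero]

lemma OrdGE.mul {x y : LC} {l m : ℚ} (hx : OrdGE x l) (hy : OrdGE y m) :
    OrdGE (x * y) (l + m) := by
  intro p hp
  rw [coeff_mul x y p ∅, Finset.sum_empty]
  intro a ha hb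
  exfalso
  have h1 : l ≤ a := le_of_not_gt fun h => ha (hx a h)
  have h2 : m ≤ p - a := le_of_not_gt fun h => hb (hy _ h)
  linarith

lemma OrdGE.one : OrdGE 1 0 := fun p hp => by rw [coeff_one, if_neg hp.ne]

lemma OrdGE.ofReal (c : ℝ) : OrdGE (ofReal c) 0 := fun p hp => by rw [coeff_ofReal, if_neg hp.ne]

lemma OrdGE.natCast (n : ℕ) : OrdGE (n : LC) 0 := by
  rw [← ofReal_natCast]; exact OrdGE.ofReal _

lemma OrdGE.pow {x : LC} {l : ℚ} (hx : OrdGE x l) (n : ℕ) : OrdGE (x ^ n) (n * l) := by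
  induction n with
  | zero => simpa using OrdGE.one
  | succ n ih =>
    rw [pow_succ]
    exact (ih.mul hx).mono (by push_cast; linarith)

lemma OrdGE.mul_zero {x y : LC} (hx : OrdGE x 0) (hy : OrdGE y 0) : OrdGE (x * y) 0 := by
  simpa using hx.mul hy

lemma OrdGE.pow_zero {x : LC} (hx : OrdGE x 0) (n : ℕ) : OrdGE (x ^ n) 0 := by
  simpa using hx.pow n

lemma OrdGE.mono_self (c : ℝ) (q : ℚ) : OrdGE (LC.mono c q) q :=
  fun p hp => by rw [coeff_mono, if_neg hp.ne]

lemma exists_least {S : Set ℚ} (hne : S.Nonempty) (hS : ∀ q, {p | p ∈ S ∧ p ≤ q}.Finite) :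
    ∃ i ∈ S, ∀ j ∈ S, i ≤ j := by
  obtain ⟨q, hq⟩ := hne
  obtain ⟨i, hi, hmin⟩ := Set.exists_min_image _ id (hS q) ⟨q, hq, le_rfl⟩
  refine ⟨i, hi.1, fun j hj => ?_⟩
  rcases le_total j q with h | h
  · exact hmin j ⟨hj, h⟩
  · exact hi.2.trans h

lemma exists_ordGE (x : LC) : ∃ l, OrdGE x l := by
  by_cases h : ∃ p, x.coeff p ≠ 0
  · obtain ⟨i, -, hi⟩ := exists_least (S := {p | x.coeff p ≠ 0}) h x.finite_support
    exact ⟨i, fun p hp => by_contra fun h => (hi p h).not_gt hp⟩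
  · push Not at h
    exact ⟨0, fun p _ => h p⟩

lemma exists_leading {x : LC} (hx : x ≠ 0) : ∃ i, OrdGE x i ∧ x.coeff i ≠ 0 := by
  have h : ∃ p, x.coeff p ≠ 0 := by
    by_contra h
    push Not at h
    exact hx (ext_coeff fun q => by rw [h q, coeff_zero])
  obtain ⟨i, h0, hi⟩ := exists_least (S := {p | x.coeff p ≠ 0}) h x.finite_support
  exact ⟨i, fun p hp => by_contra fun h => (hi p h).not_gt hp, h0⟩

/-! ## The order -/

lemma pos_iff {x : LC} : 0 < x ↔ ∃ i, OrdGE x i ∧ 0 < x.coeff i := by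
  change (0 : Lex (HahnSeries ℚ ℝ)) < (x : Lex (HahnSeries ℚ ℝ)) ↔ _
  rw [HahnSeries.lt_iff]
  refine exists_congr fun i => and_congr (forall_congr' fun j => forall_congr' fun _ => ?_) Iff.rfl
  exact eq_comm

lemma pos_of_leading {x : LC} {i : ℚ} (h : OrdGE x i) (hi : 0 < x.coeff i) : 0 < x :=
  pos_iff.2 ⟨i, h, hi⟩

/-- An exponent below which everything vanishes carries either the leading coefficient or zero. This
is how inequalities in the field are passed on to real coefficients. -/
lemma coeff_nonneg_of_nonneg {x : LC} (hx : 0 ≤ x) {i : ℚ} (h : OrdGE x i) : 0 ≤ x.coeff i := by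
  rcases hx.eq_or_lt with rfl | hx
  · simp
  obtain ⟨j, hj, hj'⟩ := pos_iff.1 hx
  rcases lt_trichotomy i j with hij | rfl | hij
  · rw [hj i hij]
  · exact hj'.le
  · rw [h j hij] at hj'
    exact absurd hj' (lt_irrefl _)

lemma ofReal_pos {c : ℝ} (hc : 0 < c) : 0 < ofReal c :=
  pos_of_leading (OrdGE.ofReal c) (by simpa)

lemma ofReal_lt_ofReal {a b : ℝ} : ofReal a < ofReal b ↔ a < b := by
  have h : StrictMono ofReal := fun a b hab => by
    rw [← sub_pos, ← ofReal_sub]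
    exact ofReal_pos (sub_pos.2 hab)
  exact h.lt_iff_lt

lemma ofReal_le_ofReal {a b : ℝ} : ofReal a ≤ ofReal b ↔ a ≤ b := by
  rw [← not_lt, ← not_lt, ofReal_lt_ofReal]

lemma ofReal_nonneg {c : ℝ} (hc : 0 ≤ c) : 0 ≤ ofReal c := by
  rw [← ofReal_zero]; exact ofReal_le_ofReal.2 hc

lemma mono_pos {c : ℝ} (hc : 0 < c) (q : ℚ) : 0 < mono c q :=
  pos_of_leading (OrdGE.mono_self c q) (by simpa)

lemma ofReal_abs (c : ℝ) : |ofReal c| = ofReal |c| := by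
  rcases le_total 0 c with h | h
  · rw [abs_of_nonneg h, abs_of_nonneg (ofReal_nonneg h)]
  · have : ofReal c ≤ 0 := by rw [← ofReal_zero]; exact ofReal_le_ofReal.2 h
    rw [abs_of_nonpos h, abs_of_nonpos this, ofReal_neg]

lemma OrdGE.abs {x : LC} {l : ℚ} (h : OrdGE x l) : OrdGE |x| l := by
  rcases abs_choice x with h' | h' <;> rw [h']
  exacts [h, h.neg]

/-- Comparison of the order of vanishing with monomials. -/
lemma OrdGE.of_le {x y : LC} {l : ℚ} (hy : OrdGE y l) (hx : |x| ≤ y) : OrdGE x l := by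
  intro p hp
  by_contra hne
  have hx0 : x ≠ 0 := fun h => hne (by rw [h, coeff_zero])
  obtain ⟨i, hi, hi'⟩ := exists_leading hx0
  have hil : i < l := lt_of_le_of_lt (le_of_not_gt fun h => hne (hi p h)) hp
  have h1 : 0 < |x|.coeff i := by
    refine lt_of_le_of_ne (coeff_nonneg_of_nonneg (abs_nonneg x) hi.abs) ?_
    rcases abs_choice x with h' | h' <;> rw [h']
    · exact hi'.symm
    · rw [coeff_neg]; exact (neg_ne_zero.2 hi').symm
  have h2 : 0 ≤ (y - |x|).coeff i :=
    coeff_nonneg_of_nonneg (sub_nonneg.2 hx) ((hy.mono hil.le).sub hi.abs)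
  rw [coeff_sub, hy i hil] at h2
  linarith

lemma OrdGE.abs_lt {x : LC} {l m : ℚ} (h : OrdGE x l) (hm : m < l) : |x| < LC.mono 1 m := by
  rw [← sub_pos]
  refine pos_of_leading (i := m) ((OrdGE.mono_self 1 m).sub (h.mono hm.le).abs) ?_
  rw [coeff_sub, h.abs m hm]
  simp

/-- Orders of vanishing describe the order topology: any exponent beyond the leading one of `ε` will
do. -/
lemma exists_mono_lt {ε : LC} (hε : 0 < ε) : ∃ l : ℚ, ∀ x, OrdGE x l → |x| < ε := by
  obtain ⟨i, hi, hi'⟩ := pos_iff.1 hε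
  refine ⟨i + 1, fun x hx => ?_⟩
  rw [← sub_pos]
  refine pos_of_leading (hi.sub (hx.mono (by linarith)).abs) ?_
  rw [coeff_sub, hx.abs i (by linarith)]
  simpa using hi'

lemma isFinite_iff {x : LC} : IsFinite x ↔ OrdGE x 0 := by
  constructor
  · rintro ⟨y, hy⟩
    exact (OrdGE.ofReal y).of_le hy.le
  · intro h
    refine ⟨|x|.coeff 0 + 1, ?_⟩
    rw [← sub_pos]
    refine pos_of_leading (i := 0) ((OrdGE.ofReal _).sub h.abs) ?_
    simp

lemma isInfinitesimal_iff {x : LC} : IsInfinitesimal x ↔ OrdGE x 0 ∧ x.coeff 0 = 0 := by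
  constructor
  · intro h
    have h0 : OrdGE x 0 := (OrdGE.ofReal 1).of_le (h 1 one_pos)
    refine ⟨h0, ?_⟩
    by_contra hne
    have h1 : 0 < |x|.coeff 0 := by
      refine lt_of_le_of_ne (coeff_nonneg_of_nonneg (abs_nonneg x) h0.abs) ?_
      rcases abs_choice x with h' | h' <;> rw [h']
      · exact Ne.symm hne
      · rw [coeff_neg]; exact (neg_ne_zero.2 hne).symm
    have h2 := coeff_nonneg_of_nonneg (sub_nonneg.2 (h _ (half_pos h1))) (i := 0)
      ((OrdGE.ofReal _).sub h0.abs)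
    rw [coeff_sub, coeff_ofReal_zero] at h2
    linarith
  · rintro ⟨h, h0⟩ y hy
    apply le_of_lt
    rw [← sub_pos]
    refine pos_of_leading (i := 0) ((OrdGE.ofReal _).sub h.abs) ?_
    have : |x|.coeff 0 = 0 := by
      rcases abs_choice x with h' | h' <;> rw [h'] <;> simp [h0]
    rw [coeff_sub, this]
    simpa using hy

/-- Left-finiteness supplies a least exponent, necessarily positive. The powers of an infinitesimal
therefore tend strongly to zero. -/
lemma OrdGE.of_infinitesimal {x : LC} (h : OrdGE x 0) (h0 : x.coeff 0 = 0) :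
    ∃ κ > 0, OrdGE x κ := by
  by_cases hx : x = 0
  · exact ⟨1, one_pos, hx ▸ OrdGE.zero 1⟩
  obtain ⟨i, hi, hi'⟩ := exists_leading hx
  refine ⟨i, ?_, hi⟩
  rcases lt_trichotomy i 0 with h1 | h1 | h1
  · exact absurd (h i h1) hi'
  · exact absurd (h1 ▸ h0) hi'
  · exact h1

lemma ordGE_eq_zero {x : LC} (h : ∀ l, OrdGE x l) : x = 0 :=
  ext_coeff fun q => h (q + 1) q (by linarith)

/-- Cauchy completeness. -/
lemma complete {s : ℕ → LC} (hs : ∀ l : ℚ, ∃ N, ∀ m ≥ N, OrdGE (s (m + 1) - s m) l) :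
    ∃ x, ∀ l : ℚ, ∃ N, ∀ m ≥ N, OrdGE (x - s m) l := by
  choose N hN using hs
  have key : ∀ l, ∀ m ≥ N l, ∀ p < l, (s m).coeff p = (s (N l)).coeff p := by
    intro l m hm p hp
    induction m, hm using Nat.le_induction with
    | base => rfl
    | succ m hm ih =>
      have := hN l m hm p hp
      rw [coeff_sub] at this
      linarith
  have key2 : ∀ l l', ∀ p, p < l → p < l' → (s (N l)).coeff p = (s (N l')).coeff p := by
    intro l l' p hp hp'
    rw [← key l (max (N l) (N l')) (le_max_left _ _) p hp,
      ← key l' (max (N l) (N l')) (le_max_right _ _) p hp']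
  refine ⟨mk (fun q => (s (N (q + 1))).coeff q) fun q => ?_, fun l => ⟨N l, fun m hm p hp => ?_⟩⟩
  · refine ((s (N (q + 1))).finite_support q).subset ?_
    rintro p ⟨hp, hpq⟩
    refine ⟨?_, hpq⟩
    rwa [key2 (q + 1) (p + 1) p (by linarith) (by linarith)]
  · rw [coeff_sub, coeff_mk, key l m hm p hp, key2 (p + 1) l p (by linarith) hp, sub_self]

/-- Division by the leading monomial turns `x` into `1 - u` with `u` infinitesimal. The orders of
the powers of `u` grow linearly, so the geometric series converges by `complete`. -/
lemma exists_inv (x : LC) (hx : x ≠ 0) : ∃ y, x * y = 1 := by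
  obtain ⟨i, hi, hi'⟩ := exists_leading hx
  set u : LC := 1 - mono (x.coeff i)⁻¹ (-i) * x with hu
  have hu0 : OrdGE u 0 := OrdGE.one.sub (((OrdGE.mono_self _ _).mul hi).mono (by simp))
  have hu1 : u.coeff 0 = 0 := by
    rw [hu, coeff_sub, coeff_mono_mul]
    simp [inv_mul_cancel₀ hi']
  obtain ⟨κ, hκ, huκ⟩ := hu0.of_infinitesimal hu1
  have hlim : ∀ l : ℚ, ∃ N : ℕ, ∀ m ≥ N, OrdGE (u ^ m) l := by
    intro l
    obtain ⟨N, hN⟩ := exists_nat_gt (l / κ)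
    refine ⟨N, fun m hm => (huκ.pow m).mono ?_⟩
    rw [div_lt_iff₀ hκ] at hN
    have : (N : ℚ) ≤ m := by exact_mod_cast hm
    nlinarith
  obtain ⟨y, hy⟩ := complete (s := fun N => ∑ n ∈ Finset.range N, u ^ n) (fun l => by
    obtain ⟨N, hN⟩ := hlim l
    refine ⟨N, fun m hm => ?_⟩
    rw [Finset.sum_range_succ, add_sub_cancel_left]
    exact hN m hm)
  have h1 : (1 - u) * y = 1 := by
    rw [← sub_eq_zero]
    refine ordGE_eq_zero fun l => ?_
    obtain ⟨N, hN⟩ := hy l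
    obtain ⟨N', hN'⟩ := hlim l
    set m := max N N'
    have e : (1 - u) * y - 1 = (1 - u) * (y - ∑ n ∈ Finset.range m, u ^ n) - u ^ m := by
      have := mul_neg_geom_sum u m
      rw [mul_sub, this]
      ring
    rw [e]
    refine OrdGE.sub ?_ (hN' _ (le_max_right _ _))
    have := (OrdGE.one.sub hu0).mul (hN m (le_max_left _ _))
    simpa using this
  refine ⟨mono (x.coeff i)⁻¹ (-i) * y, ?_⟩
  rw [← h1, hu]
  ring

open Classical in
scoped instance : Field LC where
  inv x := if h : x = 0 then 0 else (exists_inv x h).choose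
  mul_inv_cancel x hx := by
    change x * (if h : x = 0 then 0 else (exists_inv x h).choose) = 1
    rw [dif_neg hx]
    exact (exists_inv x hx).choose_spec
  inv_zero := dif_pos rfl
  nnqsmul := _
  nnqsmul_def := fun _ _ => rfl
  qsmul := _
  qsmul_def := fun _ _ => rfl

/-! ## Left-finite sets of exponents -/

/-- Left-finite sets of rational numbers. -/
def LeftFin (S : Set ℚ) : Prop := ∀ q, {p | p ∈ S ∧ p ≤ q}.Finite

lemma LeftFin.subset {S T : Set ℚ} (hT : LeftFin T) (h : S ⊆ T) : LeftFin S :=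
  fun q => (hT q).subset fun _ hp => ⟨h hp.1, hp.2⟩

lemma LeftFin.union {S T : Set ℚ} (hS : LeftFin S) (hT : LeftFin T) : LeftFin (S ∪ T) :=
  fun q => ((hS q).union (hT q)).subset fun _ hp => hp.1.imp (fun h => ⟨h, hp.2⟩) fun h => ⟨h, hp.2⟩

lemma LeftFin.exists_lb {S : Set ℚ} (hS : LeftFin S) : ∃ l, ∀ p ∈ S, l ≤ p := by
  rcases S.eq_empty_or_nonempty with rfl | hne
  · exact ⟨0, by simp⟩
  · obtain ⟨i, -, hi⟩ := exists_least hne hS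
    exact ⟨i, hi⟩

lemma LeftFin.exists_pos_gap {S : Set ℚ} (hS : LeftFin S) : ∃ κ > 0, ∀ p ∈ S, 0 < p → κ ≤ p := by
  rcases (S ∩ Set.Ioi 0).eq_empty_or_nonempty with h | h
  · refine ⟨1, one_pos, fun p hp h0 => ?_⟩
    exact absurd (show p ∈ S ∩ Set.Ioi 0 from ⟨hp, h0⟩) (by simp [h])
  · obtain ⟨i, hi, hi'⟩ := exists_least h (hS.subset Set.inter_subset_left)
    exact ⟨i, hi.2, fun p hp h0 => hi' p ⟨hp, h0⟩⟩

lemma leftFin_support (x : LC) : LeftFin {p | x.coeff p ≠ 0} := x.finite_support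

lemma LeftFin.sumset {S T : Set ℚ} (hS : LeftFin S) (hT : LeftFin T) :
    LeftFin {p | ∃ a ∈ S, ∃ b ∈ T, a + b = p} := by
  obtain ⟨l, hl⟩ := hS.exists_lb
  obtain ⟨m, hm⟩ := hT.exists_lb
  intro q
  refine (((hS (q - m)).prod (hT (q - l))).image (fun z : ℚ × ℚ => z.1 + z.2)).subset ?_
  rintro _ ⟨⟨a, ha, b, hb, rfl⟩, hq⟩
  have := hl a ha
  have := hm b hb
  exact ⟨(a, b), ⟨⟨ha, by linarith⟩, ⟨hb, by linarith⟩⟩, rfl⟩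

lemma support_mul {x y : LC} {p : ℚ} (hp : (x * y).coeff p ≠ 0) :
    ∃ a, x.coeff a ≠ 0 ∧ ∃ b, y.coeff b ≠ 0 ∧ a + b = p := by
  by_contra h
  push Not at h
  apply hp
  rw [coeff_mul x y p ∅, Finset.sum_empty]
  intro a ha hb
  exact absurd (by ring) (h a ha _ hb)

/-- The finite set depends on the supports and on `q` only. For all members of a family the
coefficient of a product is then the same finite bilinear expression, which can be summed term by
term. -/
lemma LeftFin.exists_mul_finset {S T : Set ℚ} (hS : LeftFin S) (hT : LeftFin T) (q : ℚ) :
    ∃ F : Finset ℚ, ∀ x y : LC, (∀ p, x.coeff p ≠ 0 → p ∈ S) → (∀ p, y.coeff p ≠ 0 → p ∈ T) →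
      (x * y).coeff q = ∑ p ∈ F, x.coeff p * y.coeff (q - p) := by
  obtain ⟨m, hm⟩ := hT.exists_lb
  refine ⟨(hS (q - m)).toFinset, fun x y hx hy => coeff_mul x y q _ fun p hp hp' => ?_⟩
  rw [Set.Finite.mem_toFinset]
  exact ⟨hx p hp, by linarith [hm _ (hy _ hp')]⟩

/-- A nonzero element of the monoid splits off a positive generator, which is at least the gap `κ`.
Elements below `(n + 1) κ` are thus zero or a generator plus an element below `n κ`, and induction
on `n` gives finiteness below any `Q`. -/
lemma LeftFin.closure {S : Set ℚ} (hS : LeftFin S) (h0 : ∀ p ∈ S, 0 ≤ p) :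
    LeftFin (AddSubmonoid.closure S : Set ℚ) := by
  obtain ⟨κ, hκ, hgap⟩ := hS.exists_pos_gap
  have hnn : ∀ p ∈ AddSubmonoid.closure S, 0 ≤ p := fun p hp =>
    AddSubmonoid.closure_induction (fun x hx => h0 x hx) le_rfl
      (fun x y _ _ hx hy => add_nonneg hx hy) hp
  intro Q
  have key : ∀ n : ℕ, {p | p ∈ AddSubmonoid.closure S ∧ p ≤ Q ∧ p < n * κ}.Finite := by
    intro n
    induction n with
    | zero =>
      refine Set.finite_empty.subset ?_
      rintro p ⟨hp, -, hp'⟩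
      exact absurd (hnn p hp) (by simpa using hp')
    | succ n ih =>
      refine ((((hS Q).prod ih).image fun z : ℚ × ℚ => z.1 + z.2).union
        (Set.finite_singleton 0)).subset ?_
      rintro p ⟨hp, hpQ, hpn⟩
      have : p = 0 ∨ ∃ s ∈ S, 0 < s ∧ ∃ t ∈ AddSubmonoid.closure S, s + t = p := by
        refine AddSubmonoid.closure_induction (fun x hx => ?_) (Or.inl rfl)
          (fun x y _ hy' hx hy => ?_) hp
        · rcases (h0 x hx).eq_or_lt with h | h
          · exact Or.inl h.symm
          · exact Or.inr ⟨x, hx, h, 0, zero_mem _, add_zero x⟩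
        · rcases hx with rfl | ⟨s, hs, hs0, t, ht, rfl⟩
          · rwa [zero_add]
          · exact Or.inr ⟨s, hs, hs0, t + y, add_mem ht hy', by ring⟩
      rcases this with rfl | ⟨s, hs, hs0, t, ht, rfl⟩
      · exact Or.inr rfl
      · left
        have h1 := hgap s hs hs0
        have h2 := hnn t ht
        push_cast at hpn
        exact ⟨(s, t), ⟨⟨hs, by linarith⟩, ht, by linarith, by linarith⟩, rfl⟩
  obtain ⟨n, hn⟩ := exists_nat_gt (Q / κ)
  rw [div_lt_iff₀ hκ] at hn
  exact (key n).subset fun p hp => ⟨hp.1, hp.2, by linarith [hp.2]⟩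

/-- The support of `x` lies in the monoid `S`. -/
def SuppIn (S : AddSubmonoid ℚ) (x : LC) : Prop := ∀ p, x.coeff p ≠ 0 → p ∈ S

lemma SuppIn.add {S : AddSubmonoid ℚ} {x y : LC} (hx : SuppIn S x) (hy : SuppIn S y) :
    SuppIn S (x + y) := by
  intro p hp
  by_cases h : x.coeff p = 0
  · exact hy p (by rwa [coeff_add, h, zero_add] at hp)
  · exact hx p h

lemma SuppIn.mul {S : AddSubmonoid ℚ} {x y : LC} (hx : SuppIn S x) (hy : SuppIn S y) :
    SuppIn S (x * y) := by
  intro p hp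
  obtain ⟨a, ha, b, hb, rfl⟩ := support_mul hp
  exact add_mem (hx a ha) (hy b hb)

lemma SuppIn.ofReal (S : AddSubmonoid ℚ) (c : ℝ) : SuppIn S (ofReal c) := by
  intro p hp
  rw [coeff_ofReal] at hp
  rw [(ite_ne_right_iff.1 hp).1]
  exact zero_mem S

lemma SuppIn.natCast (S : AddSubmonoid ℚ) (n : ℕ) : SuppIn S (n : LC) := by
  rw [← ofReal_natCast]; exact SuppIn.ofReal S _

lemma SuppIn.one (S : AddSubmonoid ℚ) : SuppIn S 1 := by
  rw [← ofReal_one]; exact SuppIn.ofReal S _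

lemma SuppIn.zero (S : AddSubmonoid ℚ) : SuppIn S 0 := fun _ h => absurd rfl h

lemma SuppIn.pow {S : AddSubmonoid ℚ} {x : LC} (hx : SuppIn S x) (n : ℕ) : SuppIn S (x ^ n) := by
  induction n with
  | zero => rw [pow_zero]; exact SuppIn.one S
  | succ n ih => rw [pow_succ]; exact ih.mul hx

/-- Two finite elements have their supports in a common left-finite monoid of nonnegative
exponents. -/
lemma exists_suppIn {x y : LC} (hx : OrdGE x 0) (hy : OrdGE y 0) :
    ∃ S : AddSubmonoid ℚ, LeftFin (S : Set ℚ) ∧ (∀ p ∈ S, 0 ≤ p) ∧ SuppIn S x ∧ SuppIn S y := by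
  set T : Set ℚ := {p | x.coeff p ≠ 0} ∪ {p | y.coeff p ≠ 0} with hT
  have hT0 : ∀ p ∈ T, 0 ≤ p := by
    rintro p (hp | hp)
    · exact le_of_not_gt fun h => hp (hx p h)
    · exact le_of_not_gt fun h => hp (hy p h)
  refine ⟨AddSubmonoid.closure T, ((leftFin_support x).union (leftFin_support y)).closure hT0,
    fun p hp => ?_, fun p hp => AddSubmonoid.subset_closure (Or.inl hp),
    fun p hp => AddSubmonoid.subset_closure (Or.inr hp)⟩
  exact AddSubmonoid.closure_induction (fun x hx => hT0 x hx) le_rfl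
      (fun x y _ _ hx hy => add_nonneg hx hy) hp

/-! ## Coefficientwise sums of families -/

/-- The family has left-finite total support. -/
def Reg {ι : Type*} (t : ι → LC) : Prop := LeftFin {p | ∃ i, (t i).coeff p ≠ 0}

/-- The family `t` has total support left-finite and coefficientwise sum `l`. -/
structure HasWSum {ι : Type*} (t : ι → LC) (l : LC) : Prop where
  reg : Reg t
  sum : ∀ q, HasSum (fun i => (t i).coeff q) (l.coeff q)

section WSum

variable {ι κ : Type*}

lemma HasWSum.support {t : ι → LC} {l : LC} (h : HasWSum t l) (p : ℚ) (hp : l.coeff p ≠ 0) :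
    ∃ i, (t i).coeff p ≠ 0 := by
  by_contra hc
  push Not at hc
  have := h.sum p
  simp only [hc] at this
  exact hp (this.unique hasSum_zero)

lemma HasWSum.unique {t : ι → LC} {l l' : LC} (h : HasWSum t l) (h' : HasWSum t l') : l = l' :=
  ext_coeff fun q => (h.sum q).unique (h'.sum q)

lemma exists_hasWSum {t : ι → LC} (hr : Reg t) (hs : ∀ q, Summable fun i => (t i).coeff q) :
    ∃ l, HasWSum t l := by
  refine ⟨mk (fun q => ∑' i, (t i).coeff q) (hr.subset ?_), hr, fun q => (hs q).hasSum⟩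
  intro p hp
  by_contra hc
  simp only [Set.mem_ofPred_eq, not_exists, not_not] at hc
  exact hp (by simp only [hc, tsum_zero])

lemma HasWSum.ordGE {t : ι → LC} {l : LC} (h : HasWSum t l) {m : ℚ} (ht : ∀ i, OrdGE (t i) m) :
    OrdGE l m := by
  intro p hp
  by_contra hc
  obtain ⟨i, hi⟩ := h.support p hc
  exact hi (ht i p hp)

lemma HasWSum.congr {t t' : ι → LC} {l : LC} (h : HasWSum t l) (ht : ∀ i, t i = t' i) :
    HasWSum t' l := by
  rwa [show t' = t from funext fun i => (ht i).symm]

lemma HasWSum.add {t t' : ι → LC} {l l' : LC} (h : HasWSum t l) (h' : HasWSum t' l') :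
    HasWSum (fun i => t i + t' i) (l + l') := by
  refine ⟨(h.reg.union h'.reg).subset ?_, fun q => (h.sum q).add (h'.sum q)⟩
  rintro p ⟨i, hi⟩
  by_cases h0 : (t i).coeff p = 0
  · exact Or.inr ⟨i, by rwa [coeff_add, h0, zero_add] at hi⟩
  · exact Or.inl ⟨i, h0⟩

lemma HasWSum.mul_left {t : ι → LC} {l : LC} (h : HasWSum t l) (x : LC) :
    HasWSum (fun i => x * t i) (x * l) := by
  refine ⟨((leftFin_support x).sumset h.reg).subset ?_, fun q => ?_⟩
  · rintro p ⟨i, hi⟩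
    obtain ⟨a, ha, b, hb, hab⟩ := support_mul hi
    exact ⟨a, ha, b, ⟨i, hb⟩, hab⟩
  · obtain ⟨F, hF⟩ := (leftFin_support x).exists_mul_finset h.reg q
    have e1 : ∀ i, (x * t i).coeff q = ∑ p ∈ F, x.coeff p * (t i).coeff (q - p) := fun i =>
      hF x (t i) (fun p hp => hp) fun p hp => ⟨i, hp⟩
    rw [hF x l (fun p hp => hp) h.support]
    simp only [e1]
    exact hasSum_sum fun p _ => (h.sum (q - p)).mul_left _

lemma HasWSum.neg {t : ι → LC} {l : LC} (h : HasWSum t l) : HasWSum (fun i => -t i) (-l) := by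
  simpa using h.mul_left (-1)

lemma HasWSum.sub {t t' : ι → LC} {l l' : LC} (h : HasWSum t l) (h' : HasWSum t' l') :
    HasWSum (fun i => t i - t' i) (l - l') := by
  simpa [sub_eq_add_neg] using h.add h'.neg

lemma HasWSum.mul {s : ι → LC} {t : κ → LC} {l m : LC} (hs : HasWSum s l) (ht : HasWSum t m) :
    HasWSum (fun z : ι × κ => s z.1 * t z.2) (l * m) := by
  refine ⟨(hs.reg.sumset ht.reg).subset ?_, fun q => ?_⟩
  · rintro p ⟨i, hi⟩
    obtain ⟨a, ha, b, hb, hab⟩ := support_mul hi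
    exact ⟨a, ⟨_, ha⟩, b, ⟨_, hb⟩, hab⟩
  · obtain ⟨F, hF⟩ := hs.reg.exists_mul_finset ht.reg q
    have e1 : ∀ z : ι × κ, (s z.1 * t z.2).coeff q =
        ∑ p ∈ F, (s z.1).coeff p * (t z.2).coeff (q - p) := fun z =>
      hF _ _ (fun p hp => ⟨_, hp⟩) fun p hp => ⟨_, hp⟩
    rw [hF l m hs.support ht.support]
    simp only [e1]
    refine hasSum_sum fun p _ => ?_
    have h1 := hs.sum p
    have h2 := ht.sum (q - p)
    have h3 : Summable fun z : ι × κ => (s z.1).coeff p * (t z.2).coeff (q - p) :=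
      summable_mul_of_summable_norm h1.summable.norm h2.summable.norm
    exact HasSum.mul (f := fun i => (s i).coeff p) (g := fun j => (t j).coeff (q - p)) h1 h2 h3

lemma HasWSum.prod_fiberwise {t : ι × κ → LC} {s : ι → LC} {l : LC} (h : HasWSum t l)
    (hs : ∀ i, HasWSum (fun j => t (i, j)) (s i)) : HasWSum s l := by
  refine ⟨h.reg.subset ?_, fun q => (h.sum q).prod_fiberwise fun i => (hs i).sum q⟩
  rintro p ⟨i, hi⟩
  obtain ⟨j, hj⟩ := (hs i).support p hi
  exact ⟨(i, j), hj⟩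

lemma HasWSum.comp_equiv {t : ι → LC} {l : LC} (h : HasWSum t l) (e : κ ≃ ι) :
    HasWSum (fun k => t (e k)) l := by
  refine ⟨h.reg.subset ?_, fun q => (e.hasSum_iff (f := fun i => (t i).coeff q)).2 (h.sum q)⟩
  rintro p ⟨i, hi⟩
  exact ⟨e i, hi⟩

lemma HasWSum.antidiagonal {t : ℕ × ℕ → LC} {l : LC} (h : HasWSum t l) :
    HasWSum (fun n => ∑ z ∈ Finset.HasAntidiagonal.antidiagonal n, t z) l := by
  refine ⟨h.reg.subset ?_, fun q => ?_⟩
  · rintro p ⟨n, hn⟩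
    rw [coeff_sum] at hn
    obtain ⟨z, -, hz⟩ := Finset.exists_ne_zero_of_sum_ne_zero hn
    exact ⟨z, hz⟩
  · simp only [coeff_sum]
    have h1 := (Finset.HasAntidiagonal.sigmaAntidiagonalEquivProd.hasSum_iff
      (f := fun z : ℕ × ℕ => (t z).coeff q)).2 (h.sum q)
    refine h1.sigma fun n => ?_
    have := hasSum_fintype
      (fun z : Finset.HasAntidiagonal.antidiagonal n => (t z.1).coeff q)
    rw [Finset.sum_coe_sort (Finset.HasAntidiagonal.antidiagonal n) (fun z => (t z).coeff q)]
      at this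
    exact this

lemma hasWSum_of_finset {t : ι → LC} (F : Finset ι) (h : ∀ i ∉ F, t i = 0) :
    HasWSum t (∑ i ∈ F, t i) := by
  refine ⟨fun q => ?_, fun q => ?_⟩
  · refine (Set.Finite.biUnion F.finite_toSet fun i _ => (t i).finite_support q).subset ?_
    rintro p ⟨⟨i, hi⟩, hpq⟩
    refine Set.mem_biUnion (x := i) ?_ ⟨hi, hpq⟩
    by_contra hc
    exact hi (by rw [h i hc, coeff_zero])
  · rw [coeff_sum]
    exact hasSum_sum_of_ne_finset_zero fun i hi => by rw [h i hi, coeff_zero]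

/-- Only the finitely many exponents of the total support below a bound beyond `ε⁻¹` matter. At all
others the terms and the sum vanish. -/
lemma HasWSum.weakLim {t : ℕ → LC} {l : LC} (h : HasWSum t l) :
    WeakLim (fun N => ∑ n ∈ Finset.range N, t n) l := by
  intro ε hε
  obtain ⟨Q, hQ⟩ := exists_rat_gt ε⁻¹
  have h1 : ∀ q ∈ {p : ℚ | p ∈ {p | ∃ i, (t i).coeff p ≠ 0} ∧ p ≤ Q}, ∀ᶠ N in atTop,
      |(∑ n ∈ Finset.range N, t n - l).coeff q| < ε := by
    intro q _
    have := (h.sum q).tendsto_sum_nat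
    rw [Metric.tendsto_atTop] at this
    obtain ⟨N, hN⟩ := this ε hε
    filter_upwards [eventually_ge_atTop N] with m hm
    have := hN m hm
    rwa [Real.dist_eq, ← coeff_sum, ← coeff_sub] at this
  obtain ⟨N, hN⟩ := eventually_atTop.1 ((eventually_all_finite (h.reg Q)).2 h1)
  refine ⟨N, fun m hm q hq => ?_⟩
  by_cases hc : ∃ i, (t i).coeff q ≠ 0
  · exact hN m hm q ⟨hc, by exact_mod_cast hq.trans hQ.le⟩
  · have e1 : l.coeff q = 0 := by
      by_contra h0
      exact hc (h.support q h0)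
    push Not at hc
    rw [coeff_sub, coeff_sum, e1, Finset.sum_eq_zero fun i _ => hc i]
    simpa using hε

end WSum

lemma WeakLim.tendsto {s : ℕ → LC} {l : LC} (h : WeakLim s l) (q : ℚ) :
    Tendsto (fun m => (s m).coeff q) atTop (𝓝 (l.coeff q)) := by
  rw [Metric.tendsto_atTop]
  intro ε hε
  -- Weak convergence with parameter `η` controls the exponent `q` only if `q ≤ η⁻¹`, whence the
  -- second argument of the minimum.
  set η := min ε (|(q : ℝ)| + 1)⁻¹ with hη
  have hpos : 0 < |(q : ℝ)| + 1 := by positivity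
  have hη0 : 0 < η := lt_min hε (inv_pos.2 hpos)
  obtain ⟨N, hN⟩ := h η hη0
  refine ⟨N, fun m hm => ?_⟩
  rw [Real.dist_eq, ← coeff_sub]
  refine (hN m hm q ?_).trans_le (min_le_left _ _)
  calc (q : ℝ) ≤ |(q : ℝ)| + 1 := by linarith [le_abs_self (q : ℝ)]
    _ = ((|(q : ℝ)| + 1)⁻¹)⁻¹ := (inv_inv _).symm
    _ ≤ η⁻¹ := inv_anti₀ hη0 (min_le_right _ _)

lemma WeakLim.unique {s : ℕ → LC} {l l' : LC} (h : WeakLim s l) (h' : WeakLim s l') : l = l' :=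
  ext_coeff fun q => tendsto_nhds_unique (h.tendsto q) (h'.tendsto q)

lemma WeakLim.wlim_eq {s : ℕ → LC} {l : LC} (h : WeakLim s l) : wlim s = l := by
  have hex : ∃ l, WeakLim s l := ⟨l, h⟩
  rw [wlim, dif_pos hex]
  exact hex.choose_spec.unique h

/-! ## Weighted norms of truncations -/

/-- The weighted sum `∑_{p ≤ Q} |x(p)| θ^p`. -/
def wnorm (Q : ℚ) (θ : ℝ) (x : LC) : ℝ :=
  ∑ p ∈ (x.finite_support Q).toFinset, |x.coeff p| * θ ^ (p : ℝ)

section wnorm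

variable {Q : ℚ} {θ : ℝ}

lemma wnorm_nonneg (hθ : 0 < θ) (x : LC) : 0 ≤ wnorm Q θ x :=
  Finset.sum_nonneg fun p _ => by positivity

lemma sum_le_wnorm (hθ : 0 < θ) (x : LC) (T : Finset ℚ) (hT : ∀ p ∈ T, p ≤ Q) :
    ∑ p ∈ T, |x.coeff p| * θ ^ (p : ℝ) ≤ wnorm Q θ x := by
  classical
  rw [wnorm, ← Finset.sum_filter_ne_zero]
  refine Finset.sum_le_sum_of_subset_of_nonneg ?_ fun p _ _ => by positivity
  intro p hp
  rw [Finset.mem_filter] at hp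
  rw [Set.Finite.mem_toFinset]
  exact ⟨fun h => hp.2 (by rw [h, abs_zero, zero_mul]), hT p hp.1⟩

lemma coeff_le_wnorm (hθ : 0 < θ) (x : LC) {q : ℚ} (hq : q ≤ Q) :
    |x.coeff q| * θ ^ (q : ℝ) ≤ wnorm Q θ x := by
  simpa using sum_le_wnorm hθ x {q} (by simpa using hq)

lemma wnorm_add_le (hθ : 0 < θ) (x y : LC) : wnorm Q θ (x + y) ≤ wnorm Q θ x + wnorm Q θ y := by
  set T := ((x + y).finite_support Q).toFinset with hT
  have hTQ : ∀ p ∈ T, p ≤ Q := fun p hp => by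
    rw [hT, Set.Finite.mem_toFinset] at hp; exact hp.2
  calc wnorm Q θ (x + y) ≤ ∑ p ∈ T, (|x.coeff p| * θ ^ (p : ℝ) + |y.coeff p| * θ ^ (p : ℝ)) := by
        refine Finset.sum_le_sum fun p _ => ?_
        rw [← add_mul]
        exact mul_le_mul_of_nonneg_right (abs_add_le _ _) (by positivity)
    _ ≤ _ := by
        rw [Finset.sum_add_distrib]
        exact add_le_add (sum_le_wnorm hθ x T hTQ) (sum_le_wnorm hθ y T hTQ)

/-- Finite elements have no negative exponents, so the part of the product at exponents up to `Q`
only sees the parts of the factors at exponents up to `Q`. Truncation is then compatible with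
products. -/
lemma wnorm_mul_le (hθ : 0 < θ) {x y : LC} (hx : OrdGE x 0) (hy : OrdGE y 0) :
    wnorm Q θ (x * y) ≤ wnorm Q θ x * wnorm Q θ y := by
  set T := ((x * y).finite_support Q).toFinset with hT
  have hTQ : ∀ p ∈ T, p ≤ Q := fun p hp => by
    rw [hT, Set.Finite.mem_toFinset] at hp; exact hp.2
  set A := (x.finite_support Q).toFinset with hA
  have hA0 : ∀ a ∈ A, 0 ≤ a := fun a ha => by
    rw [hA, Set.Finite.mem_toFinset] at ha
    exact le_of_not_gt fun h => ha.1 (hx a h)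
  have e1 : ∀ p ∈ T, (x * y).coeff p = ∑ a ∈ A, x.coeff a * y.coeff (p - a) := by
    intro p hp
    refine coeff_mul x y p A fun a ha hb => ?_
    rw [hA, Set.Finite.mem_toFinset]
    have : 0 ≤ p - a := le_of_not_gt fun h => hb (hy _ h)
    exact ⟨ha, by linarith [hTQ p hp]⟩
  calc wnorm Q θ (x * y)
      ≤ ∑ p ∈ T, ∑ a ∈ A, (|x.coeff a| * θ ^ (a : ℝ)) *
          (|y.coeff (p - a)| * θ ^ ((p - a : ℚ) : ℝ)) := by
        refine Finset.sum_le_sum fun p hp => ?_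
        rw [e1 p hp]
        calc _ ≤ (∑ a ∈ A, |x.coeff a * y.coeff (p - a)|) * θ ^ (p : ℝ) :=
              mul_le_mul_of_nonneg_right (Finset.abs_sum_le_sum_abs _ _) (by positivity)
          _ = _ := by
              rw [Finset.sum_mul]
              refine Finset.sum_congr rfl fun a _ => ?_
              have : θ ^ (p : ℝ) = θ ^ (a : ℝ) * θ ^ ((p - a : ℚ) : ℝ) := by
                rw [← Real.rpow_add hθ]; push_cast; ring_nf
              rw [this, abs_mul]; ring
    _ = ∑ a ∈ A, (|x.coeff a| * θ ^ (a : ℝ)) *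
          ∑ p ∈ T, |y.coeff (p - a)| * θ ^ ((p - a : ℚ) : ℝ) := by
        rw [Finset.sum_comm]
        simp only [Finset.mul_sum]
    _ ≤ ∑ a ∈ A, (|x.coeff a| * θ ^ (a : ℝ)) * wnorm Q θ y := by
        refine Finset.sum_le_sum fun a ha => mul_le_mul_of_nonneg_left ?_ (by positivity)
        have hinj : Set.InjOn (fun p : ℚ => p - a) T := fun p _ p' _ h => by
          simpa using h
        rw [← Finset.sum_image (f := fun p : ℚ => |y.coeff p| * θ ^ (p : ℝ)) hinj]
        refine sum_le_wnorm hθ y _ fun p hp => ?_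
        obtain ⟨p', hp', rfl⟩ := Finset.mem_image.1 hp
        linarith [hTQ p' hp', hA0 a ha]
    _ = _ := by rw [← Finset.sum_mul]; rfl

lemma wnorm_ofReal_le (hθ : 0 < θ) (c : ℝ) : wnorm Q θ (ofReal c) ≤ |c| := by
  have h : ((ofReal c).finite_support Q).toFinset ⊆ {0} := by
    intro p hp
    rw [Set.Finite.mem_toFinset] at hp
    by_contra h
    rw [Finset.mem_singleton] at h
    exact hp.1 (by rw [coeff_ofReal, if_neg h])
  refine (Finset.sum_le_sum_of_subset_of_nonneg h fun p _ _ => by positivity).trans ?_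
  simp

lemma wnorm_natCast_le (hθ : 0 < θ) (n : ℕ) : wnorm Q θ (n : LC) ≤ n := by
  rw [← ofReal_natCast]
  exact (wnorm_ofReal_le hθ _).trans (by simp)

lemma wnorm_one_le (hθ : 0 < θ) : wnorm Q θ 1 ≤ 1 := by
  simpa using wnorm_natCast_le (Q := Q) hθ 1

lemma wnorm_pow_le (hθ : 0 < θ) {x : LC} (hx : OrdGE x 0) (n : ℕ) :
    wnorm Q θ (x ^ n) ≤ wnorm Q θ x ^ n := by
  induction n with
  | zero => simpa using wnorm_one_le hθ
  | succ n ih =>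
    rw [pow_succ, pow_succ]
    exact (wnorm_mul_le hθ (hx.pow_zero n) hx).trans
      (mul_le_mul_of_nonneg_right ih (wnorm_nonneg hθ x))

/-- For small `θ` the weighted norm of a finite element is close to its standard part. -/
lemma exists_wnorm_le {x : LC} (hx : OrdGE x 0) {s : ℝ} (hs : |x.coeff 0| ≤ s) (Q : ℚ) :
    ∃ κ₀ > (0 : ℝ), ∃ C ≥ (0 : ℝ), ∀ κ : ℝ, κ ≤ κ₀ → ∀ θ : ℝ, 0 < θ → θ ≤ 1 →
      wnorm Q θ x ≤ s + C * θ ^ κ := by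
  obtain ⟨κ₀, hκ₀, hgap⟩ := (leftFin_support x).exists_pos_gap
  set T := (x.finite_support Q).toFinset with hT
  refine ⟨κ₀, by exact_mod_cast hκ₀, ∑ p ∈ T, |x.coeff p|,
    Finset.sum_nonneg fun p _ => abs_nonneg _, fun κ hκ θ hθ hθ1 => ?_⟩
  have h1 : ∀ p ∈ T, |x.coeff p| * θ ^ (p : ℝ) ≤
      (if p = 0 then |x.coeff 0| else 0) + |x.coeff p| * θ ^ κ := by
    intro p hp
    rw [hT, Set.Finite.mem_toFinset] at hp
    split_ifs with h
    · subst h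
      have : 0 ≤ |x.coeff 0| * θ ^ κ := by positivity
      simpa using this
    · have h0 : 0 < p := lt_of_le_of_ne (le_of_not_gt fun h => hp.1 (hx p h)) (Ne.symm h)
      rw [zero_add]
      refine mul_le_mul_of_nonneg_left ?_ (abs_nonneg _)
      refine Real.rpow_le_rpow_of_exponent_ge hθ hθ1 (hκ.trans ?_)
      exact_mod_cast hgap p hp.1 h0
  refine (Finset.sum_le_sum h1).trans ?_
  rw [Finset.sum_add_distrib, ← Finset.sum_mul]
  refine add_le_add ?_ le_rfl
  rw [Finset.sum_ite_eq']
  split_ifs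
  · exact hs
  · exact (abs_nonneg _).trans hs

/-- A bound of weighted norms that is exponential in `m` with a base tending to `1` gives polynomial
growth of the coefficients. -/
lemma exists_poly_bound {κ' : Type*} (E : ℕ → κ' → LC) (q : ℚ) {κ C D : ℝ} (hκ : 0 < κ)
    (hC : 0 ≤ C) (hD : 0 ≤ D) (B : ℕ)
    (h : ∀ θ : ℝ, 0 < θ → θ ≤ 1 → ∀ m, ∀ F : Finset κ',
      ∑ j ∈ F, wnorm q θ (E m j) ≤ D * (m + 1) ^ B * (1 + C * θ ^ κ) ^ m) :
    ∃ (C' : ℝ) (B' : ℕ), ∀ m, ∀ F : Finset κ',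
      ∑ j ∈ F, |(E m j).coeff q| ≤ C' * (m + 1) ^ B' := by
  refine ⟨D * Real.exp C, B + ⌈(q : ℝ) / κ⌉₊, fun m F => ?_⟩
  have hm : (1 : ℝ) ≤ m + 1 := by linarith [Nat.cast_nonneg (α := ℝ) m]
  have hm0 : (0 : ℝ) < m + 1 := by linarith
  -- With this choice `C θ^κ = C / (m + 1)`, so the `m`-th power stays below `exp C`, while undoing
  -- the weight `θ^q` costs only the polynomial factor `(m + 1)^(q / κ)`.
  set θ : ℝ := (m + 1 : ℝ) ^ (-(1 / κ)) with hθ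
  have hθ0 : 0 < θ := Real.rpow_pos_of_pos hm0 _
  have hθ1 : θ ≤ 1 := Real.rpow_le_one_of_one_le_of_nonpos hm (by
    rw [neg_nonpos]; positivity)
  have e1 : θ ^ κ = (m + 1 : ℝ)⁻¹ := by
    rw [hθ, ← Real.rpow_mul hm0.le, neg_mul, one_div, inv_mul_cancel₀ hκ.ne', Real.rpow_neg_one]
  have e2 : θ ^ (-(q : ℝ)) = (m + 1 : ℝ) ^ ((q : ℝ) / κ) := by
    rw [hθ, ← Real.rpow_mul hm0.le]
    congr 1
    field_simp
  have e3 : (1 + C * θ ^ κ) ^ m ≤ Real.exp C := by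
    calc (1 + C * θ ^ κ) ^ m ≤ (Real.exp (C * θ ^ κ)) ^ m := by
          refine pow_le_pow_left₀ (by positivity) ?_ m
          linarith [Real.add_one_le_exp (C * θ ^ κ)]
      _ = Real.exp (m * (C * θ ^ κ)) := by rw [Real.exp_nat_mul]
      _ ≤ Real.exp C := by
          rw [Real.exp_le_exp, e1]
          have : (m : ℝ) * (m + 1 : ℝ)⁻¹ ≤ 1 := by
            rw [← div_eq_mul_inv, div_le_one hm0]; linarith
          nlinarith
  calc ∑ j ∈ F, |(E m j).coeff q|
      ≤ ∑ j ∈ F, θ ^ (-(q : ℝ)) * wnorm q θ (E m j) := by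
        refine Finset.sum_le_sum fun j _ => ?_
        have h1 := coeff_le_wnorm hθ0 (E m j) (le_refl q)
        have h2 : θ ^ (-(q : ℝ)) * θ ^ (q : ℝ) = 1 := by
          rw [← Real.rpow_add hθ0]; simp
        calc |(E m j).coeff q| = θ ^ (-(q : ℝ)) * (|(E m j).coeff q| * θ ^ (q : ℝ)) := by
              rw [mul_comm |_|, ← mul_assoc, h2, one_mul]
          _ ≤ _ := mul_le_mul_of_nonneg_left h1 (by positivity)
    _ = θ ^ (-(q : ℝ)) * ∑ j ∈ F, wnorm q θ (E m j) := by rw [Finset.mul_sum]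
    _ ≤ (m + 1 : ℝ) ^ ⌈(q : ℝ) / κ⌉₊ * (D * (m + 1) ^ B * Real.exp C) := by
        refine mul_le_mul ?_ ?_ (Finset.sum_nonneg fun j _ => wnorm_nonneg hθ0 _) (by positivity)
        · rw [e2, ← Real.rpow_natCast]
          exact Real.rpow_le_rpow_of_exponent_le hm (Nat.le_ceil _)
        · exact (h θ hθ0 hθ1 m F).trans (mul_le_mul_of_nonneg_left e3 (by positivity))
    _ = D * Real.exp C * (m + 1) ^ (B + ⌈(q : ℝ) / κ⌉₊) := by rw [pow_add]; ring

end wnorm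

/-! ## Rapidly decreasing sequences of coefficients -/

/-- Left-finite total support, and rapid decrease of the real sequences of coefficients. -/
structure Nice (a : ℕ → LC) : Prop where
  reg : Reg a
  rapid : ∀ (q : ℚ) (B : ℕ), ∃ C : ℝ, ∀ m : ℕ, |(a m).coeff q| * ((m : ℝ) + 1) ^ B ≤ C

lemma summable_inv_succ_sq : Summable fun m : ℕ => (((m : ℝ) + 1) ^ 2)⁻¹ := by
  have := (summable_nat_add_iff 1).2 (Real.summable_nat_pow_inv.2 (one_lt_two : 1 < 2))
  simpa using this

lemma Nice.summable {a : ℕ → LC} (ha : Nice a) (q : ℚ) (B : ℕ) :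
    Summable fun m : ℕ => |(a m).coeff q| * ((m : ℝ) + 1) ^ B := by
  obtain ⟨C, hC⟩ := ha.rapid q (B + 2)
  refine Summable.of_nonneg_of_le (fun m => by positivity) (fun m => ?_)
    (summable_inv_succ_sq.mul_left C)
  have : (0 : ℝ) < ((m : ℝ) + 1) ^ 2 := by positivity
  rw [← div_eq_mul_inv, le_div_iff₀ this]
  calc _ = |(a m).coeff q| * ((m : ℝ) + 1) ^ (B + 2) := by rw [pow_add]; ring
    _ ≤ C := hC m

/-- Rapid decrease of the coefficients of `a m` absorbs the polynomial growth of the absolute row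
sums of `E m`, and the common left-finite monoid keeps the total support left-finite. -/
lemma Nice.exists_hasWSum {κ : Type*} {a : ℕ → LC} (ha : Nice a) (E : ℕ → κ → LC)
    {S : AddSubmonoid ℚ} (hS : LeftFin (S : Set ℚ)) (hE : ∀ m j, SuppIn S (E m j))
    (hb : ∀ q, ∃ (C : ℝ) (B : ℕ), ∀ m, ∀ F : Finset κ,
      ∑ j ∈ F, |(E m j).coeff q| ≤ C * (m + 1) ^ B) :
    ∃ l, HasWSum (fun z : ℕ × κ => a z.1 * E z.1 z.2) l := by
  classical
  refine LC.exists_hasWSum ((ha.reg.sumset hS).subset ?_) fun q => ?_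
  · rintro p ⟨z, hz⟩
    obtain ⟨x, hx, y, hy, hxy⟩ := support_mul hz
    exact ⟨x, ⟨_, hx⟩, y, hE _ _ _ hy, hxy⟩
  · obtain ⟨F, hF⟩ := ha.reg.exists_mul_finset hS q
    have e1 : ∀ z : ℕ × κ, (a z.1 * E z.1 z.2).coeff q =
        ∑ p ∈ F, (a z.1).coeff p * (E z.1 z.2).coeff (q - p) := fun z =>
      hF _ _ (fun p hp => ⟨_, hp⟩) fun p hp => hE _ _ _ hp
    simp only [e1]
    refine summable_sum fun p _ => ?_
    obtain ⟨C, B, hCB⟩ := hb (q - p)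
    refine Summable.of_norm ?_
    refine summable_of_sum_le (fun z => norm_nonneg _)
      (c := ∑' m, |(a m).coeff p| * ((m : ℝ) + 1) ^ B * C) fun u => ?_
    have hC0 : 0 ≤ C := by simpa using hCB 0 ∅
    calc ∑ z ∈ u, ‖(a z.1).coeff p * (E z.1 z.2).coeff (q - p)‖
        ≤ ∑ z ∈ u.image Prod.fst ×ˢ u.image Prod.snd,
            ‖(a z.1).coeff p * (E z.1 z.2).coeff (q - p)‖ :=
          Finset.sum_le_sum_of_subset_of_nonneg Finset.subset_product
            fun _ _ _ => norm_nonneg _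
      _ = ∑ m ∈ u.image Prod.fst, |(a m).coeff p| *
            ∑ j ∈ u.image Prod.snd, |(E m j).coeff (q - p)| := by
          rw [Finset.sum_product]
          simp only [Real.norm_eq_abs, abs_mul, Finset.mul_sum]
      _ ≤ ∑ m ∈ u.image Prod.fst, |(a m).coeff p| * ((m : ℝ) + 1) ^ B * C := by
          refine Finset.sum_le_sum fun m _ => ?_
          rw [mul_assoc, mul_comm _ C]
          exact mul_le_mul_of_nonneg_left (hCB m _) (abs_nonneg _)
      _ ≤ _ := Summable.sum_le_tsum _ (fun m _ => by positivity)
          ((ha.summable p B).mul_right C)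

lemma Nice.exists_hasWSum_single {a : ℕ → LC} (ha : Nice a) (E : ℕ → LC)
    {S : AddSubmonoid ℚ} (hS : LeftFin (S : Set ℚ)) (hE : ∀ m, SuppIn S (E m))
    (hb : ∀ q, ∃ (C : ℝ) (B : ℕ), ∀ m, |(E m).coeff q| ≤ C * (m + 1) ^ B) :
    ∃ l, HasWSum (fun m => a m * E m) l := by
  obtain ⟨l, hl⟩ := ha.exists_hasWSum (fun m (_ : Unit) => E m) hS (fun m _ => hE m) fun q => by
    obtain ⟨C, B, h⟩ := hb q
    refine ⟨C, B, fun m F => ?_⟩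
    have h0 : 0 ≤ |(E m).coeff q| := abs_nonneg _
    calc ∑ j ∈ F, |(E m).coeff q| ≤ ∑ j ∈ (Finset.univ : Finset Unit), |(E m).coeff q| :=
          Finset.sum_le_sum_of_subset_of_nonneg (Finset.subset_univ F) fun _ _ _ => h0
      _ ≤ _ := by simpa using h m
  exact ⟨l, hl.comp_equiv (Equiv.prodPUnit ℕ).symm⟩

lemma Nice.add {a b : ℕ → LC} (ha : Nice a) (hb : Nice b) : Nice fun n => a n + b n := by
  refine ⟨(ha.reg.union hb.reg).subset ?_, fun q B => ?_⟩
  · rintro p ⟨i, hi⟩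
    by_cases h0 : (a i).coeff p = 0
    · exact Or.inr ⟨i, by rwa [coeff_add, h0, zero_add] at hi⟩
    · exact Or.inl ⟨i, h0⟩
  · obtain ⟨C, hC⟩ := ha.rapid q B
    obtain ⟨D, hD⟩ := hb.rapid q B
    refine ⟨C + D, fun m => ?_⟩
    refine le_trans ?_ (add_le_add (hC m) (hD m))
    rw [← add_mul, coeff_add]
    exact mul_le_mul_of_nonneg_right (abs_add_le _ _) (by positivity)

lemma nice_of_finite {a : ℕ → LC} (N : ℕ) (h : ∀ n, N ≤ n → a n = 0) : Nice a := by
  refine ⟨(hasWSum_of_finset (Finset.range N) fun i hi => h i (by simpa using hi)).reg,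
    fun q B => ?_⟩
  refine ⟨∑ m ∈ Finset.range N, |(a m).coeff q| * ((m : ℝ) + 1) ^ B, fun m => ?_⟩
  by_cases hm : m < N
  · exact Finset.single_le_sum (f := fun m : ℕ => |(a m).coeff q| * ((m : ℝ) + 1) ^ B)
      (fun i _ => by positivity) (Finset.mem_range.2 hm)
  · rw [h m (not_lt.1 hm), coeff_zero, abs_zero, zero_mul]
    exact Finset.sum_nonneg fun i _ => by positivity

/-- Formal derivative. -/
def dseq (a : ℕ → LC) (n : ℕ) : LC := ((n + 1 : ℕ) : LC) * a (n + 1)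

lemma Nice.dseq {a : ℕ → LC} (ha : Nice a) : Nice (dseq a) := by
  refine ⟨ha.reg.subset ?_, fun q B => ?_⟩
  · rintro p ⟨i, hi⟩
    refine ⟨i + 1, fun h => hi ?_⟩
    rw [LC.dseq, coeff_natCast_mul, h, MulZeroClass.mul_zero]
  · obtain ⟨C, hC⟩ := ha.rapid q (B + 1)
    refine ⟨C, fun m => le_trans ?_ (hC (m + 1))⟩
    rw [LC.dseq, coeff_natCast_mul, abs_mul, Nat.abs_cast]
    push_cast
    have h1 : ((m : ℝ) + 1) ^ (B + 1) ≤ ((m : ℝ) + 1 + 1) ^ (B + 1) :=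
      pow_le_pow_left₀ (by positivity) (by linarith) _
    calc _ = |(a (m + 1)).coeff q| * ((m : ℝ) + 1) ^ (B + 1) := by rw [pow_succ]; ring
      _ ≤ _ := mul_le_mul_of_nonneg_left h1 (abs_nonneg _)

/-! ## The sum of a power series on the unit disc -/

/-- Elements of absolute value at most `1`, up to an infinitesimal. -/
def Disc (y : LC) : Prop := OrdGE y 0 ∧ |y.coeff 0| ≤ 1

lemma disc_of_abs_le {y : LC} (h : |y| ≤ 1) : Disc y := by
  have h0 : OrdGE y 0 := OrdGE.one.of_le h
  rw [abs_le] at h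
  have h1 := coeff_nonneg_of_nonneg (sub_nonneg.2 h.2) (OrdGE.one.sub h0)
  have h2 := coeff_nonneg_of_nonneg (x := y + 1) (by linarith) (h0.add OrdGE.one)
  rw [coeff_sub, coeff_one_zero] at h1
  rw [coeff_add, coeff_one_zero] at h2
  exact ⟨h0, abs_le.2 ⟨by linarith, by linarith⟩⟩

lemma disc_ofReal {s : ℝ} (h : |s| ≤ 1) : Disc (ofReal s) :=
  ⟨OrdGE.ofReal s, by rwa [coeff_ofReal_zero]⟩

lemma Disc.exists_wnorm_le {y : LC} (hy : Disc y) (q : ℚ) : ∃ κ₀ > (0 : ℝ), ∃ C ≥ (0 : ℝ),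
    ∀ κ : ℝ, κ ≤ κ₀ → ∀ θ : ℝ, 0 < θ → θ ≤ 1 → wnorm q θ y ≤ 1 + C * θ ^ κ :=
  LC.exists_wnorm_le hy.1 hy.2 q

/-- The weighted norm of `y ^ m` is at most `(1 + C θ^κ)^m`, so at each exponent the coefficients of
`y ^ m` grow polynomially. For this reason the disc may include points infinitesimally beyond
absolute value `1`. -/
lemma Nice.exists_hasWSum_pow {a : ℕ → LC} (ha : Nice a) {y : LC} (hy : Disc y) :
    ∃ l, HasWSum (fun m => a m * y ^ m) l := by
  obtain ⟨S, hS, -, hyS, -⟩ := exists_suppIn hy.1 hy.1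
  refine ha.exists_hasWSum_single _ hS (fun m => hyS.pow m) fun q => ?_
  obtain ⟨κ, hκ, C, hC, h⟩ := hy.exists_wnorm_le q
  obtain ⟨C', B', h'⟩ := exists_poly_bound (fun m (_ : Unit) => y ^ m) q (κ := κ) (C := C)
    (D := 1) hκ hC zero_le_one 0 fun θ hθ hθ1 m F => by
      have h0 := wnorm_nonneg (Q := q) hθ (y ^ m)
      calc ∑ j ∈ F, wnorm q θ (y ^ m) ≤ ∑ j ∈ (Finset.univ : Finset Unit), wnorm q θ (y ^ m) :=
            Finset.sum_le_sum_of_subset_of_nonneg (Finset.subset_univ F) fun _ _ _ => h0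
        _ = wnorm q θ (y ^ m) := by simp
        _ ≤ (1 + C * θ ^ κ) ^ m := (wnorm_pow_le hθ hy.1 m).trans
            (pow_le_pow_left₀ (wnorm_nonneg hθ y) (h κ le_rfl θ hθ hθ1) m)
        _ = _ := by simp
  exact ⟨C', B', fun m => by simpa using h' m {()}⟩

open Classical in
/-- The sum of the power series with coefficients `a` at `y`. -/
def ev (a : ℕ → LC) (y : LC) : LC :=
  if h : ∃ l, HasWSum (fun m => a m * y ^ m) l then h.choose else 0

lemma HasWSum.ev_eq {a : ℕ → LC} {y l : LC} (h : HasWSum (fun m => a m * y ^ m) l) :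
    ev a y = l := by
  have hex : ∃ l, HasWSum (fun m => a m * y ^ m) l := ⟨l, h⟩
  rw [ev, dif_pos hex]
  exact hex.choose_spec.unique h

lemma Nice.hasWSum {a : ℕ → LC} (ha : Nice a) {y : LC} (hy : Disc y) :
    HasWSum (fun m => a m * y ^ m) (ev a y) := by
  obtain ⟨l, hl⟩ := ha.exists_hasWSum_pow hy
  rwa [hl.ev_eq]

lemma ev_add {a b : ℕ → LC} (ha : Nice a) (hb : Nice b) {y : LC} (hy : Disc y) :
    ev (fun n => a n + b n) y = ev a y + ev b y :=
  (((ha.hasWSum hy).add (hb.hasWSum hy)).congr fun n => by ring).ev_eq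

lemma ev_mul_left {a : ℕ → LC} (ha : Nice a) (x : LC) {y : LC} (hy : Disc y) :
    ev (fun n => x * a n) y = x * ev a y :=
  (((ha.hasWSum hy).mul_left x).congr fun n => by ring).ev_eq

/-! ## Products -/

/-- Cauchy product. -/
def cauchyProd (a b : ℕ → LC) (n : ℕ) : LC :=
  ∑ z ∈ Finset.HasAntidiagonal.antidiagonal n, a z.1 * b z.2

lemma Nice.hasWSum_self {a : ℕ → LC} (ha : Nice a) : ∃ l, HasWSum a l := by
  obtain ⟨l, hl⟩ := ha.exists_hasWSum_pow (disc_of_abs_le (y := 1) (by simp))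
  exact ⟨l, hl.congr fun n => by simp⟩

lemma Nice.pow_mul {a : ℕ → LC} (ha : Nice a) (B : ℕ) :
    Nice fun n => (((n + 1) ^ B : ℕ) : LC) * a n := by
  refine ⟨ha.reg.subset ?_, fun q B' => ?_⟩
  · rintro p ⟨i, hi⟩
    refine ⟨i, fun h => hi ?_⟩
    rw [coeff_natCast_mul, h, MulZeroClass.mul_zero]
  · obtain ⟨C, hC⟩ := ha.rapid q (B + B')
    refine ⟨C, fun m => le_trans (le_of_eq ?_) (hC m)⟩
    rw [coeff_natCast_mul, abs_mul, Nat.abs_cast, pow_add]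
    push_cast
    ring

/-- For `i + j = n` one has `(n + 1)^B ≤ (i + 1)^B (j + 1)^B`. The weight can therefore be
distributed over the two factors, whose weighted versions are again rapidly decreasing and have a
summable product family. -/
lemma Nice.cauchyProd {a b : ℕ → LC} (ha : Nice a) (hb : Nice b) : Nice (cauchyProd a b) := by
  obtain ⟨l, hl⟩ := ha.hasWSum_self
  obtain ⟨m, hm⟩ := hb.hasWSum_self
  refine ⟨(hl.mul hm).antidiagonal.reg, fun q B => ?_⟩
  obtain ⟨l', hl'⟩ := (ha.pow_mul B).hasWSum_self
  obtain ⟨m', hm'⟩ := (hb.pow_mul B).hasWSum_self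
  have hs := ((hl'.mul hm').sum q).summable.norm
  refine ⟨_, fun n => le_trans ?_ (hs.sum_le_tsum (Finset.HasAntidiagonal.antidiagonal n)
    fun _ _ => norm_nonneg _)⟩
  rw [LC.cauchyProd, coeff_sum]
  refine (mul_le_mul_of_nonneg_right (Finset.abs_sum_le_sum_abs _ _) (by positivity)).trans ?_
  rw [Finset.sum_mul]
  refine Finset.sum_le_sum fun z hz => ?_
  rw [Finset.HasAntidiagonal.mem_antidiagonal] at hz
  have e : (((z.1 + 1) ^ B : ℕ) : LC) * a z.1 * ((((z.2 + 1) ^ B : ℕ) : LC) * b z.2) =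
      (((z.1 + 1) ^ B * (z.2 + 1) ^ B : ℕ) : LC) * (a z.1 * b z.2) := by push_cast; ring
  rw [e, coeff_natCast_mul, Real.norm_eq_abs, abs_mul, Nat.abs_cast, mul_comm]
  refine mul_le_mul_of_nonneg_right ?_ (abs_nonneg _)
  rw [← mul_pow]
  push_cast
  refine pow_le_pow_left₀ (by positivity) ?_ B
  have h1 : (n : ℝ) = z.1 + z.2 := by rw [← hz]; push_cast; rfl
  rw [h1]
  nlinarith [Nat.cast_nonneg (α := ℝ) z.1, Nat.cast_nonneg (α := ℝ) z.2,
    mul_nonneg (Nat.cast_nonneg (α := ℝ) z.1) (Nat.cast_nonneg (α := ℝ) z.2)]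

lemma ev_cauchyProd {a b : ℕ → LC} (ha : Nice a) (hb : Nice b) {y : LC} (hy : Disc y) :
    ev (cauchyProd a b) y = ev a y * ev b y := by
  refine HasWSum.ev_eq ?_
  refine ((ha.hasWSum hy).mul (hb.hasWSum hy)).antidiagonal.congr fun n => ?_
  rw [cauchyProd, Finset.sum_mul]
  refine Finset.sum_congr rfl fun z hz => ?_
  rw [Finset.HasAntidiagonal.mem_antidiagonal] at hz
  rw [← hz, pow_add]
  ring

/-! ## Recentring -/

/-- The terms of the binomial expansion of `(y + w) ^ m`. -/
def binTerm (y w : LC) (m n : ℕ) : LC := (m.choose n : LC) * (y ^ (m - n) * w ^ n)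

lemma binTerm_eq_zero {y w : LC} {m n : ℕ} (h : m < n) : binTerm y w m n = 0 := by
  rw [binTerm, Nat.choose_eq_zero_of_lt h, Nat.cast_zero, zero_mul]

lemma sum_binTerm (y w : LC) (m : ℕ) :
    ∑ n ∈ Finset.range (m + 1), binTerm y w m n = (y + w) ^ m := by
  rw [add_comm y w, add_pow]
  refine Finset.sum_congr rfl fun n _ => ?_
  rw [binTerm]; ring

/-- The weighted norms of a whole row add up, by the binomial theorem, to at most `(‖y‖ + ‖w‖)^m`,
and for small weights `‖y‖ + ‖w‖` exceeds `1` by at most a multiple of a power of `θ`. -/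
lemma binTerm_poly_bound {y w : LC} (hy : OrdGE y 0) (hw : OrdGE w 0)
    (h1 : |y.coeff 0| + |w.coeff 0| ≤ 1) (q : ℚ) :
    ∃ (C : ℝ) (B : ℕ), ∀ m, ∀ F : Finset ℕ,
      ∑ n ∈ F, |(binTerm y w m n).coeff q| ≤ C * (m + 1) ^ B := by
  obtain ⟨κ₁, hκ₁, C₁, hC₁, hb₁⟩ := LC.exists_wnorm_le hy le_rfl q
  obtain ⟨κ₂, hκ₂, C₂, hC₂, hb₂⟩ := LC.exists_wnorm_le hw le_rfl q
  refine exists_poly_bound (binTerm y w) q (κ := min κ₁ κ₂) (C := C₁ + C₂) (D := 1)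
    (lt_min hκ₁ hκ₂) (by positivity) zero_le_one 0 fun θ hθ hθ1 m F => ?_
  have hwn := fun x => wnorm_nonneg (Q := q) hθ x
  calc ∑ n ∈ F, wnorm q θ (binTerm y w m n)
      ≤ ∑ n ∈ Finset.range (m + 1), wnorm q θ (binTerm y w m n) := by
        classical
        rw [← Finset.sum_filter_ne_zero]
        refine Finset.sum_le_sum_of_subset_of_nonneg ?_ fun _ _ _ => hwn _
        intro n hn
        rw [Finset.mem_filter] at hn
        rw [Finset.mem_range]
        by_contra hc
        refine hn.2 ?_
        rw [binTerm_eq_zero (by omega)]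
        simp [wnorm]
    _ ≤ ∑ n ∈ Finset.range (m + 1),
          wnorm q θ w ^ n * wnorm q θ y ^ (m - n) * (m.choose n : ℝ) := by
        refine Finset.sum_le_sum fun n _ => ?_
        rw [binTerm]
        have e1 := wnorm_mul_le (Q := q) hθ (OrdGE.natCast (m.choose n))
          ((hy.pow_zero (m - n)).mul_zero (hw.pow_zero n))
        have e2 := wnorm_mul_le (Q := q) hθ (hy.pow_zero (m - n)) (hw.pow_zero n)
        have e3 := wnorm_pow_le (Q := q) hθ hy (m - n)
        have e4 := wnorm_pow_le (Q := q) hθ hw n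
        have e5 := wnorm_natCast_le (Q := q) hθ (m.choose n)
        calc _ ≤ _ := e1
          _ ≤ (m.choose n : ℝ) * (wnorm q θ y ^ (m - n) * wnorm q θ w ^ n) := by
              refine mul_le_mul e5 (e2.trans ?_) (hwn _) (by positivity)
              exact mul_le_mul e3 e4 (hwn _) (pow_nonneg (hwn _) _)
          _ = _ := by ring
    _ = (wnorm q θ w + wnorm q θ y) ^ m := (add_pow _ _ _).symm
    _ ≤ (1 + (C₁ + C₂) * θ ^ min κ₁ κ₂) ^ m := by
        refine pow_le_pow_left₀ (add_nonneg (hwn _) (hwn _)) ?_ m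
        have e1 := hb₁ _ (min_le_left κ₁ κ₂) θ hθ hθ1
        have e2 := hb₂ _ (min_le_right κ₁ κ₂) θ hθ hθ1
        linarith
    _ = _ := by simp

/-- The weight `(n + 1)^B` costs at most `(m + 1)^B`, because only the terms with `n ≤ m` are
nonzero. It is there to prove rapid decrease of the recentred coefficients. -/
lemma Nice.exists_hasWSum_binTerm {a : ℕ → LC} (ha : Nice a) {y w : LC} (hy : OrdGE y 0)
    (hw : OrdGE w 0) (h1 : |y.coeff 0| + |w.coeff 0| ≤ 1) (B : ℕ) :
    ∃ l, HasWSum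
      (fun z : ℕ × ℕ => a z.1 * ((((z.2 + 1) ^ B : ℕ) : LC) * binTerm y w z.1 z.2)) l := by
  obtain ⟨S, hS, -, hyS, hwS⟩ := exists_suppIn hy hw
  refine ha.exists_hasWSum (fun m n => (((n + 1) ^ B : ℕ) : LC) * binTerm y w m n) hS
    (fun m n => (SuppIn.natCast S _).mul ((SuppIn.natCast S _).mul ((hyS.pow _).mul (hwS.pow _))))
    fun q => ?_
  obtain ⟨C, B', hCB⟩ := binTerm_poly_bound hy hw h1 q
  refine ⟨C, B + B', fun m F => ?_⟩
  calc _ ≤ ∑ n ∈ F, ((m : ℝ) + 1) ^ B * |(binTerm y w m n).coeff q| := by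
        refine Finset.sum_le_sum fun n _ => ?_
        by_cases hn : m < n
        · rw [binTerm_eq_zero hn]; simp
        · rw [coeff_natCast_mul, abs_mul, Nat.abs_cast]
          refine mul_le_mul_of_nonneg_right ?_ (abs_nonneg _)
          push_cast
          refine pow_le_pow_left₀ (by positivity) ?_ _
          have : (n : ℝ) ≤ m := by exact_mod_cast not_lt.1 hn
          linarith
    _ = ((m : ℝ) + 1) ^ B * ∑ n ∈ F, |(binTerm y w m n).coeff q| := by rw [Finset.mul_sum]
    _ ≤ ((m : ℝ) + 1) ^ B * (C * (m + 1) ^ B') :=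
        mul_le_mul_of_nonneg_left (hCB m F) (by positivity)
    _ = _ := by rw [pow_add]; ring

/-- Expansion of a power series about another point of the disc. -/
lemma Nice.recentre {a : ℕ → LC} (ha : Nice a) {y₀ w : LC} (hy₀ : OrdGE y₀ 0) (hw : OrdGE w 0)
    (h1 : |y₀.coeff 0| + |w.coeff 0| ≤ 1) :
    ∃ b, Nice b ∧ ∀ y, Disc y → ev b y = ev a (y₀ + w * y) := by
  have hcol : ∀ n, ∃ l, HasWSum (fun m => a m * binTerm y₀ w m n) l := by
    intro n
    obtain ⟨S, hS, -, hyS, hwS⟩ := exists_suppIn hy₀ hw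
    refine ha.exists_hasWSum_single (fun m => binTerm y₀ w m n) hS
      (fun m => (SuppIn.natCast S _).mul ((hyS.pow _).mul (hwS.pow _))) fun q => ?_
    obtain ⟨C, B, hCB⟩ := binTerm_poly_bound hy₀ hw h1 q
    exact ⟨C, B, fun m => by simpa using hCB m {n}⟩
  choose b hb using hcol
  -- The weighted double family is summable, so its column sums, which are the weighted new
  -- coefficients, are summable for every `B`. This is the rapid decrease of `b`.
  have hfib : ∀ B : ℕ, ∃ l, HasWSum (fun n => (((n + 1) ^ B : ℕ) : LC) * b n) l := by
    intro B
    obtain ⟨l, hl⟩ := ha.exists_hasWSum_binTerm hy₀ hw h1 B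
    refine ⟨l, (hl.comp_equiv (Equiv.prodComm ℕ ℕ)).prod_fiberwise fun n => ?_⟩
    exact ((hb n).mul_left _).congr fun m => by
      simp only [Equiv.prodComm_apply, Prod.swap_prod_mk]; ring
  refine ⟨b, ⟨?_, fun q B => ?_⟩, fun y hy => ?_⟩
  · obtain ⟨l, hl⟩ := hfib 0
    exact (hl.congr fun n => by simp).reg
  · obtain ⟨l, hl⟩ := hfib B
    have hs := (hl.sum q).summable.norm
    refine ⟨_, fun n => le_trans (le_of_eq ?_) (hs.le_tsum n fun _ _ => norm_nonneg _)⟩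
    rw [coeff_natCast_mul, Real.norm_eq_abs, abs_mul, Nat.abs_cast]
    push_cast
    ring
  · have hwy : OrdGE (w * y) 0 := hw.mul_zero hy.1
    have hc : (w * y).coeff 0 = w.coeff 0 * y.coeff 0 := by
      rw [coeff_mul w y 0 {0}]
      · simp
      · intro p hp hp'
        have h1 : 0 ≤ p := le_of_not_gt fun h => hp (hw p h)
        have h2 : 0 ≤ 0 - p := le_of_not_gt fun h => hp' (hy.1 _ h)
        rw [Finset.mem_singleton]
        linarith
    have h2 : |y₀.coeff 0| + |(w * y).coeff 0| ≤ 1 := by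
      rw [hc, abs_mul]
      have := mul_le_mul_of_nonneg_left hy.2 (abs_nonneg (w.coeff 0))
      linarith
    obtain ⟨l, hl⟩ := ha.exists_hasWSum_binTerm hy₀ hwy h2 0
    -- One double family is summed in two ways: by rows it gives the value of `a` at the shifted
    -- point, by columns the value of `b` at `y`.
    have e1 : ev a (y₀ + w * y) = l := by
      refine HasWSum.ev_eq (hl.prod_fiberwise fun m => ?_)
      have := hasWSum_of_finset
        (t := fun n => a m * ((((n + 1) ^ 0 : ℕ) : LC) * binTerm y₀ (w * y) m n))
        (Finset.range (m + 1)) (fun n hn => by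
          rw [binTerm_eq_zero (by simpa using hn), MulZeroClass.mul_zero, MulZeroClass.mul_zero])
      convert this using 1
      rw [← sum_binTerm, Finset.mul_sum]
      simp
    rw [e1]
    refine HasWSum.ev_eq ((hl.comp_equiv (Equiv.prodComm ℕ ℕ)).prod_fiberwise fun n => ?_)
    rw [mul_comm (b n)]
    exact ((hb n).mul_left (y ^ n)).congr fun m => by
      simp only [Equiv.prodComm_apply, Prod.swap_prod_mk, binTerm, mul_pow]
      push_cast
      ring

/-! ## Differentiation -/

/-- The quotients `(z ^ m - y ^ m - m y ^ (m - 1) (z - y)) / (z - y) ^ 2`. -/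
def quadQuot (y z : LC) : ℕ → LC
  | 0 => 0
  | m + 1 => z * quadQuot y z m + (m : LC) * y ^ (m - 1)

lemma quadQuot_spec (y z : LC) (m : ℕ) :
    z ^ m - y ^ m - (m : LC) * y ^ (m - 1) * (z - y) = (z - y) ^ 2 * quadQuot y z m := by
  induction m with
  | zero => simp [quadQuot]
  | succ m ih =>
    rw [quadQuot]
    rcases m with _ | m
    · simp [quadQuot]
    · simp only [Nat.add_sub_cancel] at ih ⊢
      have e : z ^ (m + 1) = y ^ (m + 1) + ((m + 1 : ℕ) : LC) * y ^ m * (z - y) +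
        (z - y) ^ 2 * quadQuot y z (m + 1) := by linear_combination ih
      rw [pow_succ z, e]
      push_cast
      ring

lemma quadQuot_suppIn {S : AddSubmonoid ℚ} {y z : LC} (hy : SuppIn S y) (hz : SuppIn S z)
    (m : ℕ) : SuppIn S (quadQuot y z m) := by
  induction m with
  | zero => exact SuppIn.zero S
  | succ m ih => exact (hz.mul ih).add ((SuppIn.natCast S m).mul (hy.pow _))

lemma quadQuot_ordGE {y z : LC} (hy : OrdGE y 0) (hz : OrdGE z 0) (m : ℕ) :
    OrdGE (quadQuot y z m) 0 := by
  induction m with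
  | zero => exact OrdGE.zero 0
  | succ m ih => exact (hz.mul_zero ih).add ((OrdGE.natCast m).mul_zero (hy.pow_zero _))

/-- Counted with multiplicity, the quotient consists of at most `m²` monomials in `y` and `z`, of
degree below `m`. The condition `1 ≤ ν` allows all of them to be bounded by `ν ^ m`. -/
lemma wnorm_quadQuot_le {Q : ℚ} {θ : ℝ} (hθ : 0 < θ) {y z : LC} (hy : OrdGE y 0) (hz : OrdGE z 0)
    {ν : ℝ} (hν : 1 ≤ ν) (hyν : wnorm Q θ y ≤ ν) (hzν : wnorm Q θ z ≤ ν) (m : ℕ) :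
    wnorm Q θ (quadQuot y z m) ≤ (m + 1 : ℝ) ^ 2 * ν ^ m := by
  have hwn := fun x => wnorm_nonneg (Q := Q) hθ x
  induction m with
  | zero => simp [quadQuot, wnorm]
  | succ m ih =>
    rw [quadQuot]
    have e1 := wnorm_add_le (Q := Q) hθ (z * quadQuot y z m) ((m : LC) * y ^ (m - 1))
    have e2 := wnorm_mul_le (Q := Q) hθ hz (quadQuot_ordGE hy hz m)
    have e3 := wnorm_mul_le (Q := Q) hθ (OrdGE.natCast m) (hy.pow_zero (m - 1))
    have e4 := wnorm_natCast_le (Q := Q) hθ m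
    have e5 : wnorm Q θ (y ^ (m - 1)) ≤ ν ^ (m + 1) :=
      (wnorm_pow_le hθ hy _).trans ((pow_le_pow_left₀ (hwn _) hyν _).trans
        (pow_le_pow_right₀ hν (by omega)))
    have e6 : wnorm Q θ z * wnorm Q θ (quadQuot y z m) ≤ ν * ((m + 1 : ℝ) ^ 2 * ν ^ m) :=
      mul_le_mul hzν ih (hwn _) (by linarith)
    have e7 : wnorm Q θ (m : LC) * wnorm Q θ (y ^ (m - 1)) ≤ m * ν ^ (m + 1) :=
      mul_le_mul e4 e5 (hwn _) (by positivity)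
    have e8 : 0 ≤ ν ^ (m + 1) := by positivity
    push_cast
    have e9 : ν * ((m + 1 : ℝ) ^ 2 * ν ^ m) + m * ν ^ (m + 1) =
      ((m + 1 : ℝ) ^ 2 + m) * ν ^ (m + 1) := by ring
    have e10 : ((m + 1 : ℝ) ^ 2 + m) * ν ^ (m + 1) ≤ (m + 1 + 1 : ℝ) ^ 2 * ν ^ (m + 1) :=
      mul_le_mul_of_nonneg_right (by nlinarith [Nat.cast_nonneg (α := ℝ) m]) e8
    linarith

lemma HasWSum.of_succ {t : ℕ → LC} {l : LC} (h0 : t 0 = 0) (h : HasWSum (fun n => t (n + 1)) l) :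
    HasWSum t l := by
  refine ⟨h.reg.subset ?_, fun q => ?_⟩
  · rintro p ⟨i, hi⟩
    rcases i with _ | i
    · rw [h0] at hi
      exact absurd rfl hi
    · exact ⟨i, hi⟩
  · rw [← hasSum_nat_add_iff' 1]
    simpa [h0] using h.sum q

lemma Nice.exists_ordGE {a : ℕ → LC} (ha : Nice a) : ∃ l, ∀ n, OrdGE (a n) l := by
  obtain ⟨l, hl⟩ := ha.reg.exists_lb
  exact ⟨l, fun n p hp => by_contra fun h => (hl p ⟨n, h⟩).not_gt hp⟩

lemma Nice.ev_bounded {a : ℕ → LC} (ha : Nice a) : ∃ K : LC, 0 < K ∧ ∀ y, Disc y → |ev a y| ≤ K := by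
  obtain ⟨l, hl⟩ := ha.exists_ordGE
  refine ⟨LC.mono 1 (l - 1), mono_pos one_pos _, fun y hy => ?_⟩
  refine (OrdGE.abs_lt ((ha.hasWSum hy).ordGE (m := l) fun n => ?_) (by linarith)).le
  simpa using (hl n).mul (hy.1.pow_zero n)

/-- Dividing the Taylor remainder by `(z - y)²` term by term leaves a convergent series, whose order
is at least the common lower bound of the orders of the coefficients. The constant is therefore
independent of the two points. -/
lemma Nice.ev_quad {a : ℕ → LC} (ha : Nice a) : ∃ K : LC, 0 < K ∧ ∀ y z, Disc y → Disc z →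
    |ev a z - ev a y - ev (LC.dseq a) y * (z - y)| ≤ K * |z - y| ^ 2 := by
  obtain ⟨l, hl⟩ := ha.exists_ordGE
  refine ⟨LC.mono 1 (l - 1), mono_pos one_pos _, fun y z hy hz => ?_⟩
  obtain ⟨S, hS, -, hyS, hzS⟩ := exists_suppIn hy.1 hz.1
  obtain ⟨G, hG⟩ := ha.exists_hasWSum_single (quadQuot y z) hS (quadQuot_suppIn hyS hzS) fun q => by
    obtain ⟨κ₁, hκ₁, C₁, hC₁, hb₁⟩ := hy.exists_wnorm_le q
    obtain ⟨κ₂, hκ₂, C₂, hC₂, hb₂⟩ := hz.exists_wnorm_le q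
    obtain ⟨C', B', h'⟩ := exists_poly_bound (fun m (_ : Unit) => quadQuot y z m) q
      (κ := min κ₁ κ₂) (C := C₁ + C₂) (D := 1) (lt_min hκ₁ hκ₂) (by positivity) zero_le_one 2
      fun θ hθ hθ1 m F => by
        have h0 := wnorm_nonneg (Q := q) hθ (quadQuot y z m)
        have e1 := hb₁ _ (min_le_left κ₁ κ₂) θ hθ hθ1
        have e2 := hb₂ _ (min_le_right κ₁ κ₂) θ hθ hθ1
        have e3 : 0 ≤ θ ^ min κ₁ κ₂ := by positivity
        calc _ ≤ ∑ j ∈ (Finset.univ : Finset Unit), wnorm q θ (quadQuot y z m) :=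
              Finset.sum_le_sum_of_subset_of_nonneg (Finset.subset_univ F) fun _ _ _ => h0
          _ = wnorm q θ (quadQuot y z m) := by simp
          _ ≤ (m + 1 : ℝ) ^ 2 * (1 + (C₁ + C₂) * θ ^ min κ₁ κ₂) ^ m :=
              wnorm_quadQuot_le hθ hy.1 hz.1 (by nlinarith) (by nlinarith) (by nlinarith) m
          _ = _ := by ring
    exact ⟨C', B', fun m => by simpa using h' m {()}⟩
  have hd : HasWSum (fun m => a m * ((m : LC) * y ^ (m - 1))) (ev (LC.dseq a) y) := by
    refine HasWSum.of_succ (by simp) ?_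
    refine (ha.dseq.hasWSum hy).congr fun n => ?_
    rw [LC.dseq, Nat.add_sub_cancel]
    ring
  have e : ev a z - ev a y - (z - y) * ev (LC.dseq a) y = (z - y) ^ 2 * G := by
    refine (((ha.hasWSum hz).sub (ha.hasWSum hy)).sub (hd.mul_left (z - y))).unique
      ((hG.mul_left ((z - y) ^ 2)).congr fun m => ?_)
    linear_combination (-a m) * quadQuot_spec y z m
  rw [mul_comm (ev _ _) (z - y), e, abs_mul, abs_pow, mul_comm]
  refine mul_le_mul_of_nonneg_right ?_ (by positivity)
  refine (OrdGE.abs_lt (hG.ordGE (m := l) fun n => ?_) (by linarith)).le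
  simpa using (hl n).mul (quadQuot_ordGE hy.1 hz.1 n)

/-! ## Positivity -/

/-- At real points each exponent contributes an ordinary real power series, so real analysis applies
one exponent at a time. -/
lemma Nice.hasSum_real {a : ℕ → LC} (ha : Nice a) {s : ℝ} (hs : |s| ≤ 1) (q : ℚ) :
    HasSum (fun n => (a n).coeff q * s ^ n) ((ev a (ofReal s)).coeff q) := by
  have := (ha.hasWSum (disc_ofReal hs)).sum q
  convert this using 2 with n
  rw [← ofReal_pow, mul_comm (a n), coeff_ofReal_mul, mul_comm]

lemma Nice.continuousOn_real {a : ℕ → LC} (ha : Nice a) (q : ℚ) :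
    ContinuousOn (fun s : ℝ => (ev a (ofReal s)).coeff q) (Set.Icc (-1) 1) := by
  have h : ContinuousOn (fun s : ℝ => ∑' n, (a n).coeff q * s ^ n) (Set.Icc (-1) 1) := by
    refine continuousOn_tsum (u := fun n => |(a n).coeff q| * ((n : ℝ) + 1) ^ 0)
      (fun n => by fun_prop) (ha.summable q 0) fun n s hs => ?_
    rw [Real.norm_eq_abs, abs_mul, abs_pow, pow_zero]
    exact mul_le_mul_of_nonneg_left (pow_le_one₀ (abs_nonneg _) (abs_le.2 hs)) (abs_nonneg _)
  exact h.congr fun s hs => (ha.hasSum_real (abs_le.2 hs) q).tsum_eq.symm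

lemma Nice.hasDerivAt_real {a : ℕ → LC} (ha : Nice a) (q : ℚ) {s : ℝ} (hs : s ∈ Set.Ioo (-1 : ℝ) 1) :
    HasDerivAt (fun s : ℝ => (ev a (ofReal s)).coeff q) ((ev (LC.dseq a) (ofReal s)).coeff q) s := by
  have habs : ∀ t ∈ Set.Ioo (-1 : ℝ) 1, |t| ≤ 1 := fun t ht => (abs_lt.2 ht).le
  have h := hasDerivAt_tsum_of_isPreconnected
    (u := fun n => |(a n).coeff q| * ((n : ℝ) + 1) ^ 1) (t := Set.Ioo (-1 : ℝ) 1)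
    (g := fun n s => (a n).coeff q * s ^ n)
    (g' := fun n s => (a n).coeff q * ((n : ℝ) * s ^ (n - 1))) (y₀ := s) (y := s)
    (ha.summable q 1) isOpen_Ioo isPreconnected_Ioo
    (fun n t _ => (hasDerivAt_pow n t).const_mul _) (fun n t ht => by
      rw [Real.norm_eq_abs, abs_mul, abs_mul, Nat.abs_cast, abs_pow, pow_one]
      refine mul_le_mul_of_nonneg_left ?_ (abs_nonneg _)
      have : |t| ^ (n - 1) ≤ 1 := pow_le_one₀ (abs_nonneg _) (habs t ht)
      nlinarith [Nat.cast_nonneg (α := ℝ) n]) hs (ha.hasSum_real (habs s hs) q).summable hs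
  have e1 : ∑' n, (a n).coeff q * ((n : ℝ) * s ^ (n - 1)) = (ev (LC.dseq a) (ofReal s)).coeff q := by
    have h1 := ha.dseq.hasSum_real (habs s hs) q
    refine HasSum.tsum_eq ?_
    rw [← hasSum_nat_add_iff' 1]
    simp only [Finset.range_one, Finset.sum_singleton, Nat.cast_zero, zero_mul,
      MulZeroClass.mul_zero, sub_zero]
    have h2 : ∀ n, (LC.dseq a n).coeff q * s ^ n =
        (a (n + 1)).coeff q * (((n + 1 : ℕ) : ℝ) * s ^ (n + 1 - 1)) := fun n => by
      rw [LC.dseq, coeff_natCast_mul, Nat.add_sub_cancel]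
      ring
    simpa only [h2] using h1
  rw [e1] at h
  refine h.congr_of_eventuallyEq ?_
  filter_upwards [isOpen_Ioo.mem_nhds hs] with t ht
  exact (ha.hasSum_real (habs t ht) q).tsum_eq.symm

/-- A power series with nonnegative derivative is nondecreasing. -/
lemma Nice.ev_le {a : ℕ → LC} (ha : Nice a)
    (h : ∀ s ∈ Set.Ioo (-1 : ℝ) 1, 0 ≤ ev (LC.dseq a) (ofReal s)) :
    ev a (ofReal (-1)) ≤ ev a (ofReal 1) := by
  set f : ℚ → ℝ → ℝ := fun q s => (ev a (ofReal s)).coeff q with hf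
  -- `S` collects the exponents at which the coefficient is not constant along the real points.
  -- Below its least element `i` the derivative has no coefficients, so its coefficient at `i` is
  -- nonnegative and the real function at `i` is nondecreasing. Being nonconstant, it decides the
  -- sign of the difference.
  set S : Set ℚ := {q | ∃ s ∈ Set.Icc (-1 : ℝ) 1, f q s ≠ f q (-1)} with hS
  have hsupp : ∀ q, (¬ ∃ n, (a n).coeff q ≠ 0) → ∀ s ∈ Set.Icc (-1 : ℝ) 1, f q s = 0 := by
    intro q hq s hs
    by_contra hc
    obtain ⟨n, hn⟩ := (ha.hasWSum (disc_ofReal (abs_le.2 hs))).support q hc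
    refine hq ⟨n, fun h0 => hn ?_⟩
    rw [← ofReal_pow, mul_comm, coeff_ofReal_mul, h0, MulZeroClass.mul_zero]
  have hSfin : LeftFin S := by
    refine ha.reg.subset ?_
    rintro q ⟨s, hs, hne⟩
    by_contra hc
    exact hne (by rw [hsupp q hc s hs, hsupp q hc (-1) (by simp)])
  rcases S.eq_empty_or_nonempty with hemp | hne
  · refine le_of_eq (ext_coeff fun q => ?_)
    by_contra hc
    have : q ∈ S := ⟨1, by simp, fun h => hc h.symm⟩
    rw [hemp] at this
    exact this
  · obtain ⟨i, ⟨s, hs, hsne⟩, hmin⟩ := exists_least hne hSfin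
    have hconst : ∀ q < i, ∀ s ∈ Set.Icc (-1 : ℝ) 1, f q s = f q (-1) := by
      intro q hq s hs
      by_contra hc
      exact (hmin q ⟨s, hs, hc⟩).not_gt hq
    have hd : ∀ s ∈ Set.Ioo (-1 : ℝ) 1, OrdGE (ev (LC.dseq a) (ofReal s)) i := by
      intro s hs q hq
      have h1 := ha.hasDerivAt_real q hs
      have h2 : HasDerivAt (fun s : ℝ => (ev a (ofReal s)).coeff q) 0 s := by
        refine (hasDerivAt_const s (f q (-1))).congr_of_eventuallyEq ?_
        filter_upwards [isOpen_Ioo.mem_nhds hs] with t ht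
        exact hconst q hq t (Set.Ioo_subset_Icc_self ht)
      exact h1.unique h2
    have hmono : MonotoneOn (f i) (Set.Icc (-1) 1) := by
      refine monotoneOn_of_deriv_nonneg (convex_Icc _ _) (ha.continuousOn_real i) ?_ ?_
      · rw [interior_Icc]
        exact fun s hs => (ha.hasDerivAt_real i hs).differentiableAt.differentiableWithinAt
      · rw [interior_Icc]
        intro s hs
        rw [(ha.hasDerivAt_real i hs).deriv]
        exact coeff_nonneg_of_nonneg (h s hs) (hd s hs)
    have hlt : f i (-1) < f i 1 := by
      have h1 : f i (-1) ≤ f i s := hmono (by simp) hs hs.1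
      have h2 : f i s ≤ f i 1 := hmono hs (by simp) hs.2
      exact (lt_of_le_of_ne h1 (Ne.symm hsne)).trans_le h2
    rw [← sub_nonneg]
    refine (pos_of_leading (i := i) (fun q hq => ?_) ?_).le
    · rw [coeff_sub]
      exact sub_eq_zero.2 (hconst q hq 1 (by simp))
    · rw [coeff_sub]
      exact sub_pos.2 hlt

/-! ## Coefficients of weakly convergent power series -/

/-- Boundedness of the terms at `3/4` gives a radius of convergence of at least `3/4`. The
infinitely many zeros accumulate in `[1/4, 1/2]`, inside the disc, and the identity theorem applies.
-/
lemma real_powerSeries_eq_zero {u : ℕ → ℝ} {Z : Set ℝ} (hZ : Z ⊆ Set.Icc (1 / 4) (1 / 2))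
    (hinf : Z.Infinite) (hu : Tendsto (fun n => u n * (3 / 4 : ℝ) ^ n) atTop (𝓝 0))
    (hz : ∀ s ∈ Z, Tendsto (fun N => ∑ n ∈ Finset.range N, u n * s ^ n) atTop (𝓝 0)) (n : ℕ) :
    u n = 0 := by
  set p := FormalMultilinearSeries.ofScalars ℝ u with hp
  have hr : ((3 / 4 : NNReal) : ENNReal) ≤ p.radius := by
    refine p.le_radius_of_tendsto (l := 0) ?_
    have := hu.norm
    simp only [norm_zero] at this
    refine this.congr fun n => ?_
    rw [hp, FormalMultilinearSeries.ofScalars_norm, norm_mul, norm_pow]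
    norm_num
  have hr0 : 0 < p.radius := lt_of_lt_of_le (by norm_num) hr
  have hfp : HasFPowerSeriesOnBall p.sum p 0 p.radius := p.hasFPowerSeriesOnBall hr0
  have hfp' : HasFPowerSeriesOnBall p.sum p 0 ((3 / 4 : NNReal) : ENNReal) :=
    hfp.mono (by norm_num) hr
  have hball : Metric.eball (0 : ℝ) ((3 / 4 : NNReal) : ENNReal) = Metric.ball 0 (3 / 4) := by
    rw [Metric.eball_coe]; norm_num
  have han : AnalyticOnNhd ℝ p.sum (Metric.ball 0 (3 / 4)) := hball ▸ hfp'.analyticOnNhd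
  have hval : ∀ s ∈ Z, p.sum s = 0 := by
    intro s hs
    have hs' : s ∈ Metric.eball (0 : ℝ) ((3 / 4 : NNReal) : ENNReal) := by
      rw [hball, Metric.mem_ball, dist_zero_right, Real.norm_eq_abs, abs_lt]
      have := hZ hs
      constructor <;> linarith [this.1, this.2]
    have h1 := (hfp'.hasSum hs').tendsto_sum_nat
    rw [zero_add] at h1
    refine tendsto_nhds_unique h1 ((hz s hs).congr fun N => ?_)
    refine Finset.sum_congr rfl fun n _ => ?_
    rw [hp, FormalMultilinearSeries.ofScalars_apply_eq, smul_eq_mul]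
  obtain ⟨z₀, hz₀, hacc⟩ := hinf.exists_accPt_of_subset_isCompact isCompact_Icc hZ
  have hz₀' : z₀ ∈ Metric.ball (0 : ℝ) (3 / 4) := by
    rw [Metric.mem_ball, dist_zero_right, Real.norm_eq_abs, abs_lt]
    constructor <;> linarith [hz₀.1, hz₀.2]
  have hEq : Set.EqOn p.sum 0 (Metric.ball 0 (3 / 4)) :=
    han.eqOn_zero_of_preconnected_of_frequently_eq_zero (convex_ball _ _).isPreconnected hz₀'
      ((accPt_iff_frequently_nhdsNE.1 hacc).mono hval)
  have h0 : HasFPowerSeriesAt (0 : ℝ → ℝ) p 0 := by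
    refine hfp.hasFPowerSeriesAt.congr ?_
    filter_upwards [Metric.ball_mem_nhds (0 : ℝ) (by norm_num : (0 : ℝ) < 3 / 4)] with s hs
    exact hEq hs
  have h1 : p.coeff n = (0 : FormalMultilinearSeries ℝ ℝ ℝ).coeff n := by rw [h0.eq_zero]
  rw [hp, FormalMultilinearSeries.coeff_ofScalars] at h1
  exact h1

lemma mono_pow (c : ℝ) (q : ℚ) (n : ℕ) : mono c q ^ n = mono (c ^ n) (n * q) := by
  induction n with
  | zero => rw [pow_zero, pow_zero, Nat.cast_zero, zero_mul, ← ofReal_eq_mono, ofReal_one]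
  | succ n ih =>
    rw [pow_succ, ih, mono_mul_mono, pow_succ]
    congr 1
    push_cast
    ring

/-- The terms of a weakly convergent series tend to zero coefficientwise. -/
lemma WeakLim.term_tendsto {t : ℕ → LC} {l : LC}
    (h : WeakLim (fun N => ∑ n ∈ Finset.range N, t n) l) (q : ℚ) :
    Tendsto (fun n => (t n).coeff q) atTop (𝓝 0) := by
  have h1 := h.tendsto q
  have h2 := (h1.comp (tendsto_add_atTop_nat 1)).sub h1
  rw [sub_self] at h2
  refine h2.congr fun n => ?_
  simp only [Function.comp, Finset.sum_range_succ, coeff_add, add_sub_cancel_left]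

lemma coeff_mul_ofReal (x : LC) (c : ℝ) (q : ℚ) : (x * ofReal c).coeff q = x.coeff q * c := by
  rw [mul_comm, coeff_ofReal_mul, mul_comm]

/-- A cardinality argument: each real point yields a finite support below `Q`, and there are only
countably many finite sets of rationals. Infinitely many real points thus share one support `F`, and
an exponent outside `F` gives a real power series that vanishes at all of them. -/
lemma reg_of_weakLim {a : ℕ → LC}
    (h : ∀ y, 0 < y → y < 1 → ∃ l, WeakLim (fun N => ∑ n ∈ Finset.range N, a n * y ^ n) l) :
    Reg a := by
  intro Q
  have hreal : ∀ s : ℝ, 0 < s → s < 1 →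
      ∃ l, WeakLim (fun N => ∑ n ∈ Finset.range N, a n * ofReal s ^ n) l := fun s h0 h1 =>
    h _ (ofReal_pos h0) (by rw [← ofReal_one]; exact ofReal_lt_ofReal.2 h1)
  have hI : ∀ s ∈ Set.Icc (1 / 4 : ℝ) (1 / 2), 0 < s ∧ s < 1 := fun s hs =>
    ⟨by linarith [hs.1], by linarith [hs.2]⟩
  choose! l hl using hreal
  set T : ℝ → Finset ℚ := fun s => ((l s).finite_support Q).toFinset with hT
  obtain ⟨F, hF⟩ : ∃ F : Finset ℚ, {s ∈ Set.Icc (1 / 4 : ℝ) (1 / 2) | T s = F}.Infinite := by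
    by_contra hc
    push Not at hc
    have : (Set.Icc (1 / 4 : ℝ) (1 / 2)).Countable := by
      refine (Set.countable_iUnion fun F : Finset ℚ =>
        ((hc F)).countable).mono fun s hs => ?_
      exact Set.mem_iUnion.2 ⟨T s, hs, rfl⟩
    have h2 := Cardinal.mk_Icc_real (by norm_num : (1 / 4 : ℝ) < 1 / 2)
    rw [← Cardinal.le_aleph0_iff_set_countable, h2] at this
    exact absurd this (not_le.2 Cardinal.aleph0_lt_continuum)
  refine F.finite_toSet.subset ?_
  rintro q ⟨⟨n, hn⟩, hq⟩
  by_contra hqF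
  refine hn (real_powerSeries_eq_zero (u := fun n => (a n).coeff q) (fun s hs => hs.1) hF ?_ ?_ n)
  · refine ((hl (3 / 4) (by norm_num) (by norm_num)).term_tendsto q).congr fun n => ?_
    rw [← ofReal_pow, coeff_mul_ofReal]
  · intro s hs
    have h1 := (hl s (hI s hs.1).1 (hI s hs.1).2).tendsto q
    have h2 : (l s).coeff q = 0 := by
      by_contra hne
      apply hqF
      rw [← hs.2, hT]
      simpa using ⟨hne, hq⟩
    rw [h2] at h1
    refine h1.congr fun N => ?_
    rw [coeff_sum]
    exact Finset.sum_congr rfl fun n _ => by rw [← ofReal_pow, coeff_mul_ofReal]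

/-- Convergence infinitesimally close to `1` forces the decay. In the expansion of `a n * (1 -
d^κ)^n` the coefficient at `q + i κ` contains `choose n i` times the coefficient of `a n` at `q`;
the terms with smaller index tend to zero by induction. -/
lemma choose_mul_tendsto {a : ℕ → LC}
    (h : ∀ y, 0 < y → y < 1 → ∃ l, WeakLim (fun N => ∑ n ∈ Finset.range N, a n * y ^ n) l)
    (i : ℕ) : ∀ q, Tendsto (fun n => (n.choose i : ℝ) * (a n).coeff q) atTop (𝓝 0) := by
  obtain ⟨lb, hlb⟩ := (reg_of_weakLim h).exists_lb
  induction i using Nat.strong_induction_on with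
  | _ i ih =>
    intro q
    -- A `κ` this large pushes the exponents `q + (i - j) κ` with `j > i` below the common lower
    -- bound `lb`, where all coefficients vanish. At the same time it is positive, so that `1 - d^κ`
    -- lies between `0` and `1`.
    set κ : ℚ := max 1 (q - lb + 1) with hκ
    have hκ1 : 1 ≤ κ := le_max_left _ _
    have hκ2 : q - κ < lb := by linarith [le_max_right 1 (q - lb + 1)]
    have hord : OrdGE (mono (-1) κ) 1 := (OrdGE.mono_self _ _).mono hκ1
    have hy0 : 0 < 1 + mono (-1) κ := by
      have : |mono (-1) κ| < 1 := by
        simpa [← ofReal_eq_mono] using hord.abs_lt zero_lt_one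
      linarith [(abs_lt.1 this).1]
    have hy1 : 1 + mono (-1) κ < 1 := by
      have : mono (-1) κ = -mono 1 κ := by
        ext p; simp only [coeff_mono, coeff_neg]; split_ifs <;> simp
      rw [this]
      linarith [mono_pos one_pos κ]
    obtain ⟨l, hl⟩ := h _ hy0 hy1
    have ht := hl.term_tendsto (q + i * κ)
    have e1 : ∀ n : ℕ, (a n * (1 + mono (-1) κ) ^ n).coeff (q + i * κ) =
        ∑ j ∈ Finset.range (i + 1),
          (-1) ^ j * ((n.choose j : ℝ) * (a n).coeff (q + ((i : ℚ) - j) * κ)) := by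
      intro n
      have e2 : (a n * (1 + mono (-1) κ) ^ n).coeff (q + i * κ) =
          ∑ j ∈ Finset.range (n + 1),
            (-1) ^ j * ((n.choose j : ℝ) * (a n).coeff (q + ((i : ℚ) - j) * κ)) := by
        rw [add_comm 1, add_pow, Finset.mul_sum, coeff_sum]
        refine Finset.sum_congr rfl fun j _ => ?_
        rw [one_pow, mul_one, mono_pow,
          show a n * (mono ((-1) ^ j) (j * κ) * ((n.choose j : ℕ) : LC)) =
            (n.choose j : LC) * (mono ((-1) ^ j) (j * κ) * a n) by ring,
          coeff_natCast_mul, coeff_mono_mul]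
        rw [show q + i * κ - j * κ = q + ((i : ℚ) - j) * κ by ring]
        ring
      rw [e2]
      have hbig : ∀ j, i < j → (a n).coeff (q + ((i : ℚ) - j) * κ) = 0 := by
        intro j hj
        by_contra hne
        have h1 := hlb _ ⟨n, hne⟩
        have h2 : (i : ℚ) + 1 ≤ j := by exact_mod_cast hj
        nlinarith
      have hsmall : ∀ j, n < j → (n.choose j : ℝ) = 0 := fun j hj => by
        rw [Nat.choose_eq_zero_of_lt hj, Nat.cast_zero]
      trans ∑ j ∈ Finset.range (max n i + 1),
          (-1) ^ j * ((n.choose j : ℝ) * (a n).coeff (q + ((i : ℚ) - j) * κ))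
      · refine Finset.sum_subset (fun j hj => ?_) fun j _ hj => ?_
        · simp only [Finset.mem_range] at hj ⊢; omega
        · rw [hsmall j (by simp only [Finset.mem_range] at hj; omega)]; simp
      · symm
        refine Finset.sum_subset (fun j hj => ?_) fun j _ hj => ?_
        · simp only [Finset.mem_range] at hj ⊢; omega
        · rw [hbig j (by simp only [Finset.mem_range] at hj; omega)]; simp
    simp only [e1, Finset.sum_range_succ] at ht
    have hlow : Tendsto (fun n : ℕ => ∑ j ∈ Finset.range i,
        (-1) ^ j * ((n.choose j : ℝ) * (a n).coeff (q + ((i : ℚ) - j) * κ))) atTop (𝓝 0) := by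
      have : Tendsto (fun n : ℕ => ∑ j ∈ Finset.range i,
        (-1) ^ j * ((n.choose j : ℝ) * (a n).coeff (q + ((i : ℚ) - j) * κ))) atTop
          (𝓝 (∑ j ∈ Finset.range i, (-1) ^ j * 0)) :=
        tendsto_finsetSum _ fun j hj => (ih j (Finset.mem_range.1 hj) _).const_mul _
      simpa using this
    have h3 := (ht.sub hlow).const_mul ((-1 : ℝ) ^ i)
    simp only [add_sub_cancel_left, sub_self, MulZeroClass.mul_zero, zero_mul, add_zero] at h3
    refine h3.congr fun n => ?_
    rw [← mul_assoc, ← mul_pow]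
    simp

/-- Binomial coefficients `choose m B` grow like `m^B`, so `choose_mul_tendsto` for all `B` amounts
to rapid decrease. The comparison used here holds from `m = 2 B` on, and the remaining indices are
absorbed in the constant. -/
lemma nice_of_weakLim {a : ℕ → LC}
    (h : ∀ y, 0 < y → y < 1 → ∃ l, WeakLim (fun N => ∑ n ∈ Finset.range N, a n * y ^ n) l) :
    Nice a := by
  refine ⟨reg_of_weakLim h, fun q B => ?_⟩
  have h1 := ((choose_mul_tendsto h B q).abs).const_mul ((2 : ℝ) ^ B * B.factorial)
  rw [abs_zero, MulZeroClass.mul_zero] at h1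
  obtain ⟨N, hN⟩ := eventually_atTop.1 (h1.eventually (gt_mem_nhds one_pos))
  set f : ℕ → ℝ := fun m => |(a m).coeff q| * ((m : ℝ) + 1) ^ B with hf
  have hf0 : ∀ m, 0 ≤ f m := fun m => by positivity
  refine ⟨1 + ∑ m ∈ Finset.range (max N (2 * B)), f m, fun m => ?_⟩
  by_cases hm : m < max N (2 * B)
  · have := Finset.single_le_sum (fun i _ => hf0 i) (Finset.mem_range.2 hm)
    linarith
  · have hs : 0 ≤ ∑ m ∈ Finset.range (max N (2 * B)), f m := Finset.sum_nonneg fun i _ => hf0 i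
    push Not at hm
    have hm1 := hN m ((le_max_left _ _).trans hm)
    have hm2 : 2 * B ≤ m := (le_max_right _ _).trans hm
    have h2 : (((m + 1 - B : ℕ) : ℝ)) ^ B ≤ B.factorial * (m.choose B : ℝ) := by
      have := Nat.pow_le_choose (α := ℝ) B m
      rwa [div_le_iff₀' (by positivity)] at this
    have h3 : ((m : ℝ) + 1) ≤ 2 * ((m + 1 - B : ℕ) : ℝ) := by
      have : m + 1 ≤ 2 * (m + 1 - B) := by omega
      exact_mod_cast this
    have h4 : ((m : ℝ) + 1) ^ B ≤ 2 ^ B * (B.factorial * (m.choose B : ℝ)) := by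
      calc _ ≤ (2 * ((m + 1 - B : ℕ) : ℝ)) ^ B := pow_le_pow_left₀ (by positivity) h3 B
        _ = 2 ^ B * ((m + 1 - B : ℕ) : ℝ) ^ B := mul_pow _ _ _
        _ ≤ _ := mul_le_mul_of_nonneg_left h2 (by positivity)
    have h5 := mul_le_mul_of_nonneg_left h4 (abs_nonneg ((a m).coeff q))
    rw [abs_mul, Nat.abs_cast] at hm1
    have h6 : |(a m).coeff q| * (2 ^ B * (B.factorial * (m.choose B : ℝ))) =
      2 ^ B * B.factorial * ((m.choose B : ℝ) * |(a m).coeff q|) := by ring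
    simp only [hf] at hs ⊢
    linarith

/-! ## Calculus of derivatives -/

lemma HasDeriv.unique {f : LC → LC} {l m x : LC} (hl : HasDeriv f l x) (hm : HasDeriv f m x) :
    l = m := by
  by_contra hne
  have h0 : 0 < |l - m| := abs_pos.2 (sub_ne_zero.2 hne)
  obtain ⟨η₁, h₁, H₁⟩ := hl (|l - m| / 3) (by positivity)
  obtain ⟨η₂, h₂, H₂⟩ := hm (|l - m| / 3) (by positivity)
  set t := min η₁ η₂ / 2 with ht
  have ht0 : 0 < t := half_pos (lt_min h₁ h₂)
  have hlt : t < min η₁ η₂ := half_lt_self (lt_min h₁ h₂)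
  have e : |x + t - x| = t := by rw [add_sub_cancel_left, abs_of_pos ht0]
  have a1 := H₁ (x + t) (by rw [e]; exact hlt.trans_le (min_le_left _ _))
  have a2 := H₂ (x + t) (by rw [e]; exact hlt.trans_le (min_le_right _ _))
  rw [e, add_sub_cancel_left] at a1 a2
  have a3 : |l - m| * t ≤ |l - m| / 3 * t + |l - m| / 3 * t := by
    calc |l - m| * t = |(l - m) * t| := by rw [abs_mul, abs_of_pos ht0]
      _ = |(f (x + t) - f x - m * t) - (f (x + t) - f x - l * t)| := by congr 1; ring
      _ ≤ _ := (abs_sub _ _).trans (by linarith)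
  nlinarith [mul_pos h0 ht0]

lemma hasDeriv_deriv {f : LC → LC} {x : LC} (h : ∃ l, HasDeriv f l x) : HasDeriv f (deriv f x) x := by
  rw [deriv, dif_pos h]
  exact h.choose_spec

lemma hasDeriv_const (c x : LC) : HasDeriv (fun _ => c) 0 x := fun ε hε =>
  ⟨1, one_pos, fun y _ => by simpa using mul_nonneg hε.le (abs_nonneg _)⟩

lemma HasDeriv.congr {f g : LC → LC} {l x η : LC} (hf : HasDeriv f l x) (hη : 0 < η)
    (h : ∀ y, |y - x| < η → f y = g y) : HasDeriv g l x := by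
  intro ε hε
  obtain ⟨η', hη', H⟩ := hf ε hε
  refine ⟨min η η', lt_min hη hη', fun y hy => ?_⟩
  rw [← h y (hy.trans_le (min_le_left _ _)), ← h x (by simpa using hη)]
  exact H y (hy.trans_le (min_le_right _ _))

lemma HasDeriv.add {f g : LC → LC} {l m x : LC} (hf : HasDeriv f l x) (hg : HasDeriv g m x) :
    HasDeriv (fun y => f y + g y) (l + m) x := by
  intro ε hε
  obtain ⟨η₁, h₁, H₁⟩ := hf (ε / 2) (half_pos hε)
  obtain ⟨η₂, h₂, H₂⟩ := hg (ε / 2) (half_pos hε)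
  refine ⟨min η₁ η₂, lt_min h₁ h₂, fun y hy => ?_⟩
  have a1 := H₁ y (hy.trans_le (min_le_left _ _))
  have a2 := H₂ y (hy.trans_le (min_le_right _ _))
  calc _ = |(f y - f x - l * (y - x)) + (g y - g x - m * (y - x))| := by congr 1; ring
    _ ≤ _ := (abs_add_le _ _).trans (add_le_add a1 a2)
    _ = _ := by ring

/-- A differentiable function is locally Lipschitz at the point. -/
lemma HasDeriv.lipschitzAt {f : LC → LC} {l x : LC} (hf : HasDeriv f l x) {C : LC} (hC : |l| < C) :
    ∃ η, 0 < η ∧ ∀ y, |y - x| < η → |f y - f x| ≤ C * |y - x| := by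
  obtain ⟨η, h, H⟩ := hf (C - |l|) (sub_pos.2 hC)
  refine ⟨η, h, fun y hy => ?_⟩
  calc |f y - f x| = |(f y - f x - l * (y - x)) + l * (y - x)| := by congr 1; ring
    _ ≤ (C - |l|) * |y - x| + |l| * |y - x| :=
      (abs_add_le _ _).trans (add_le_add (H y hy) (abs_mul _ _).le)
    _ = _ := by ring

lemma HasDeriv.mul {f g : LC → LC} {l m x : LC} (hf : HasDeriv f l x) (hg : HasDeriv g m x) :
    HasDeriv (fun y => f y * g y) (l * g x + f x * m) x := by
  intro ε hε
  obtain ⟨η₀, h₀, H₀⟩ := hg.lipschitzAt (lt_add_one |m|)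
  set C := |m| + 1 with hC
  have hC0 : 0 < C := by positivity
  obtain ⟨η₁, h₁, H₁⟩ := hf (ε / (3 * (|g x| + 1))) (by positivity)
  obtain ⟨η₂, h₂, H₂⟩ := hg (ε / (3 * (|f x| + 1))) (by positivity)
  set η₃ := ε / (3 * (|l| + 1) * C) with hη₃
  have h₃ : 0 < η₃ := by positivity
  refine ⟨min (min η₀ η₁) (min (min η₂ η₃) (1 / C)), by positivity, fun y hy => ?_⟩
  simp only [lt_min_iff] at hy
  obtain ⟨⟨y0, y1⟩, ⟨y2, y3⟩, y4⟩ := hy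
  have a0 := H₀ y y0
  have a1 := H₁ y y1
  have a2 := H₂ y y2
  set d := |y - x| with hd
  have d0 : 0 ≤ d := abs_nonneg _
  have b0 : |g y - g x| ≤ 1 := a0.trans (by
    rw [lt_div_iff₀ hC0] at y4; linarith)
  have b1 : |g y| ≤ |g x| + 1 := by
    have := abs_add_le (g y - g x) (g x)
    rw [sub_add_cancel] at this
    linarith
  have c1 : |(f y - f x - l * (y - x)) * g y| ≤ ε / 3 * d := by
    rw [abs_mul]
    calc _ ≤ ε / (3 * (|g x| + 1)) * d * (|g x| + 1) :=
          mul_le_mul a1 b1 (abs_nonneg _) (by positivity)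
      _ = _ := by field_simp
  have c2 : |l * (y - x) * (g y - g x)| ≤ ε / 3 * d := by
    rw [abs_mul, abs_mul]
    calc |l| * d * |g y - g x| ≤ (|l| + 1) * d * (C * η₃) := by
          refine mul_le_mul (mul_le_mul_of_nonneg_right (by linarith) d0) (a0.trans ?_)
            (abs_nonneg _) (by positivity)
          exact mul_le_mul_of_nonneg_left y3.le hC0.le
      _ = _ := by rw [hη₃]; field_simp
  have c3 : |f x * (g y - g x - m * (y - x))| ≤ ε / 3 * d := by
    rw [abs_mul]
    calc _ ≤ (|f x| + 1) * (ε / (3 * (|f x| + 1)) * d) :=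
          mul_le_mul (by linarith) a2 (abs_nonneg _) (by positivity)
      _ = _ := by field_simp
  calc _ = |(f y - f x - l * (y - x)) * g y + l * (y - x) * (g y - g x) +
        f x * (g y - g x - m * (y - x))| := by congr 1; ring
    _ ≤ _ := (abs_add_le _ _).trans (add_le_add ((abs_add_le _ _).trans (add_le_add c1 c2)) c3)
    _ = _ := by ring

lemma HasDeriv.const_mul {f : LC → LC} {l x : LC} (hf : HasDeriv f l x) (c : LC) :
    HasDeriv (fun y => c * f y) (c * l) x := by
  simpa using (hasDeriv_const c x).mul hf

lemma HasDeriv.sub {f g : LC → LC} {l m x : LC} (hf : HasDeriv f l x) (hg : HasDeriv g m x) :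
    HasDeriv (fun y => f y - g y) (l - m) x := by
  simpa [sub_eq_add_neg] using hf.add (hg.const_mul (-1))

lemma hasDeriv_id (x : LC) : HasDeriv (fun y => y) 1 x := fun ε hε =>
  ⟨1, one_pos, fun y _ => by simpa using mul_nonneg hε.le (abs_nonneg _)⟩

lemma HasDeriv.sum {ι : Type*} (s : Finset ι) {f : ι → LC → LC} {l : ι → LC} {x : LC}
    (h : ∀ i ∈ s, HasDeriv (f i) (l i) x) :
    HasDeriv (fun y => ∑ i ∈ s, f i y) (∑ i ∈ s, l i) x := by
  classical
  induction s using Finset.induction_on with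
  | empty => simpa using hasDeriv_const 0 x
  | insert i s hi ih =>
    simp only [Finset.sum_insert hi]
    exact (h i (Finset.mem_insert_self i s)).add
      (ih fun j hj => h j (Finset.mem_insert_of_mem hj))

/-! ## Functions given by one power series on a closed interval -/

/-- The affine map of `[p, q]` onto `[-1, 1]`. -/
def nm (p q x : LC) : LC := (x - (p + q) / 2) / ((q - p) / 2)

lemma abs_nm_le {p q x : LC} (hx : x ∈ Set.Icc p q) : |nm p q x| ≤ 1 := by
  rcases (hx.1.trans hx.2).eq_or_lt with rfl | h
  · simp [nm]
  · have : 0 < (q - p) / 2 := half_pos (sub_pos.2 h)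
    rw [nm, abs_div, abs_of_pos this, div_le_one this, abs_le]
    constructor <;> linarith [hx.1, hx.2]

lemma disc_nm {p q x : LC} (hx : x ∈ Set.Icc p q) : Disc (nm p q x) := disc_of_abs_le (abs_nm_le hx)

/-- On `[p, q]` the function is the sum of a rapidly decreasing power series centred at the
midpoint. -/
def AnIcc (f : LC → LC) (p q : LC) : Prop := ∃ a, Nice a ∧ ∀ x ∈ Set.Icc p q, f x = ev a (nm p q x)

lemma AnIcc.congr {f g : LC → LC} {p q : LC} (hf : AnIcc f p q) (h : ∀ x ∈ Set.Icc p q, f x = g x) :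
    AnIcc g p q := by
  obtain ⟨a, ha, hfa⟩ := hf
  exact ⟨a, ha, fun x hx => by rw [← h x hx, hfa x hx]⟩

lemma AnIcc.add {f g : LC → LC} {p q : LC} (hf : AnIcc f p q) (hg : AnIcc g p q) :
    AnIcc (fun x => f x + g x) p q := by
  obtain ⟨a, ha, hfa⟩ := hf
  obtain ⟨b, hb, hgb⟩ := hg
  exact ⟨_, ha.add hb, fun x hx => by
    simp only [ev_add ha hb (disc_nm hx), hfa x hx, hgb x hx]⟩

lemma AnIcc.mul {f g : LC → LC} {p q : LC} (hf : AnIcc f p q) (hg : AnIcc g p q) :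
    AnIcc (fun x => f x * g x) p q := by
  obtain ⟨a, ha, hfa⟩ := hf
  obtain ⟨b, hb, hgb⟩ := hg
  exact ⟨_, ha.cauchyProd hb, fun x hx => by
    simp only [ev_cauchyProd ha hb (disc_nm hx), hfa x hx, hgb x hx]⟩

lemma anIcc_const (c p q : LC) : AnIcc (fun _ => c) p q := by
  refine ⟨fun n => if n = 0 then c else 0, nice_of_finite 1 fun n hn => if_neg (by omega),
    fun x _ => Eq.symm (HasWSum.ev_eq ?_)⟩
  have := hasWSum_of_finset (t := fun n => (if n = 0 then c else 0) * nm p q x ^ n) {0}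
    fun n hn => by rw [if_neg (by simpa using hn), zero_mul]
  simpa using this

lemma anIcc_id {p q : LC} (hpq : p ≤ q) : AnIcc (fun x => x) p q := by
  refine ⟨fun n => if n = 0 then (p + q) / 2 else if n = 1 then (q - p) / 2 else 0,
    nice_of_finite 2 fun n hn => by rw [if_neg (by omega), if_neg (by omega)],
    fun x hx => Eq.symm (HasWSum.ev_eq ?_)⟩
  have := hasWSum_of_finset (t := fun n => (if n = 0 then (p + q) / 2 else if n = 1 then
    (q - p) / 2 else 0) * nm p q x ^ n) (Finset.range 2)
    fun n hn => by
      rw [Finset.mem_range] at hn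
      rw [if_neg (by omega), if_neg (by omega), zero_mul]
  convert this using 1
  rw [Finset.sum_range_succ, Finset.sum_range_one]
  rcases hpq.eq_or_lt with rfl | h
  · have : x = p := le_antisymm hx.2 hx.1
    simp [nm, this]
  · have : (q - p) / 2 ≠ 0 := (half_pos (sub_pos.2 h)).ne'
    simp only [if_true, pow_zero, mul_one, one_ne_zero, if_false, pow_one, nm]
    field_simp
    ring

lemma AnIcc.const_mul {f : LC → LC} {p q : LC} (hf : AnIcc f p q) (c : LC) :
    AnIcc (fun x => c * f x) p q := (anIcc_const c p q).mul hf

lemma AnIcc.neg {f : LC → LC} {p q : LC} (hf : AnIcc f p q) : AnIcc (fun x => -f x) p q := by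
  simpa using hf.const_mul (-1)

lemma AnIcc.sub {f g : LC → LC} {p q : LC} (hf : AnIcc f p q) (hg : AnIcc g p q) :
    AnIcc (fun x => f x - g x) p q := by
  simpa [sub_eq_add_neg] using hf.add hg.neg

lemma AnIcc.sum {ι : Type*} (s : Finset ι) {f : ι → LC → LC} {p q : LC}
    (h : ∀ i ∈ s, AnIcc (f i) p q) : AnIcc (fun x => ∑ i ∈ s, f i x) p q := by
  classical
  induction s using Finset.induction_on with
  | empty => simpa using anIcc_const 0 p q
  | insert i s hi ih =>
    simp only [Finset.sum_insert hi]
    exact (h i (Finset.mem_insert_self i s)).add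
      (ih fun j hj => h j (Finset.mem_insert_of_mem hj))

/-- Each of the four combinations `±y ± w` is at most `1`, and so is its coefficient at exponent
zero. The right sign choice gives the sum of absolute values. -/
lemma abs_coeff_add_le {y w : LC} (h : |y| + |w| ≤ 1) :
    OrdGE y 0 ∧ OrdGE w 0 ∧ |y.coeff 0| + |w.coeff 0| ≤ 1 := by
  have hy : OrdGE y 0 := OrdGE.one.of_le (by linarith [abs_nonneg w])
  have hw : OrdGE w 0 := OrdGE.one.of_le (by linarith [abs_nonneg y])
  refine ⟨hy, hw, ?_⟩
  have key : ∀ x : LC, OrdGE x 0 → x ≤ 1 → x.coeff 0 ≤ 1 := by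
    intro x hx hx1
    have := coeff_nonneg_of_nonneg (sub_nonneg.2 hx1) (OrdGE.one.sub hx)
    rw [coeff_sub, coeff_one_zero] at this
    linarith
  have h1 := key _ (hy.add hw) (by linarith [le_abs_self y, le_abs_self w])
  have h2 := key _ (hy.sub hw) (by linarith [le_abs_self y, neg_abs_le w])
  have h3 := key _ (hw.sub hy) (by linarith [neg_abs_le y, le_abs_self w])
  have h4 := key _ (hy.neg.sub hw) (by linarith [neg_abs_le y, neg_abs_le w])
  simp only [coeff_add, coeff_sub, coeff_neg] at h1 h2 h3 h4
  rcases abs_choice (y.coeff 0) with e | e <;> rcases abs_choice (w.coeff 0) with e' | e' <;>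
    rw [e, e'] <;> linarith

/-- A power series centred anywhere, rapidly decreasing at a scale `R`, restricts to every interval
inside its disc. -/
lemma anIcc_of_disc {f : LC → LC} {p q x₀ R : LC} {a : ℕ → LC} (ha : Nice a) (hR : R ≠ 0)
    (hpq : p ≤ q) (hp : x₀ - |R| ≤ p) (hq : q ≤ x₀ + |R|)
    (h : ∀ x ∈ Set.Icc p q, f x = ev a ((x - x₀) / R)) : AnIcc f p q := by
  have hR0 : 0 < |R| := abs_pos.2 hR
  -- The interval lies in the disc of radius `|R|` exactly when the offset of its midpoint plus its
  -- half-length is at most `|R|`, which is the hypothesis of `Nice.recentre` after scaling.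
  have h1 : |((p + q) / 2 - x₀) / R| + |((q - p) / 2) / R| ≤ 1 := by
    have h2 : 0 ≤ (q - p) / 2 := by linarith
    rw [abs_div, abs_div, ← add_div, div_le_one hR0, abs_of_nonneg h2]
    rcases abs_choice ((p + q) / 2 - x₀) with e | e <;> rw [e] <;> linarith
  obtain ⟨hy, hw, hc⟩ := abs_coeff_add_le h1
  obtain ⟨b, hb, hbe⟩ := ha.recentre hy hw hc
  refine ⟨b, hb, fun x hx => ?_⟩
  rw [hbe _ (disc_nm hx), h x hx]
  congr 1
  rcases hpq.eq_or_lt with rfl | hlt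
  · have : x = p := le_antisymm hx.2 hx.1
    simp [nm, this]
  · have : q - p ≠ 0 := (sub_pos.2 hlt).ne'
    rw [nm]
    field_simp
    ring

lemma AnIcc.restrict {f : LC → LC} {p q p' q' : LC} (hf : AnIcc f p q) (hp : p ≤ p')
    (hpq : p' ≤ q') (hq : q' ≤ q) : AnIcc f p' q' := by
  rcases (hp.trans (hpq.trans hq)).eq_or_lt with rfl | hlt
  · have e1 : p' = p := le_antisymm (hpq.trans hq) hp
    have e2 : q' = p := le_antisymm hq (hp.trans hpq)
    rwa [e1, e2]
  · obtain ⟨a, ha, hfa⟩ := hf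
    have hw : 0 < (q - p) / 2 := half_pos (sub_pos.2 hlt)
    refine anIcc_of_disc (x₀ := (p + q) / 2) ha hw.ne' hpq ?_ ?_ fun x hx =>
      hfa x ⟨hp.trans hx.1, hx.2.trans hq⟩
    · rw [abs_of_pos hw]; linarith
    · rw [abs_of_pos hw]; linarith

lemma AnIcc.bounded {f : LC → LC} {p q : LC} (hf : AnIcc f p q) :
    ∃ K, 0 < K ∧ ∀ x ∈ Set.Icc p q, |f x| ≤ K := by
  obtain ⟨a, ha, hfa⟩ := hf
  obtain ⟨K, hK, h⟩ := ha.ev_bounded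
  exact ⟨K, hK, fun x hx => by rw [hfa x hx]; exact h _ (disc_nm hx)⟩

/-- `f` is the derivative of `F` on `[p, q]`, with a quadratic bound of the error. -/
def QuadDeriv (F f : LC → LC) (p q : LC) : Prop :=
  ∃ K, 0 < K ∧ ∀ x ∈ Set.Icc p q, ∀ y ∈ Set.Icc p q, |F y - F x - f x * (y - x)| ≤ K * |y - x| ^ 2

lemma QuadDeriv.hasDeriv {F f : LC → LC} {p q x : LC} (h : QuadDeriv F f p q)
    (hx : x ∈ Set.Ioo p q) : HasDeriv F (f x) x := by
  obtain ⟨K, hK, H⟩ := h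
  intro ε hε
  refine ⟨min (min (x - p) (q - x)) (ε / K), ?_, fun y hy => ?_⟩
  · exact lt_min (lt_min (sub_pos.2 hx.1) (sub_pos.2 hx.2)) (by positivity)
  simp only [lt_min_iff] at hy
  have h1 := abs_lt.1 hy.1.1
  have h2 := abs_lt.1 hy.1.2
  refine (H x (Set.Ioo_subset_Icc_self hx) y ⟨by linarith, by linarith⟩).trans ?_
  rw [pow_two, ← mul_assoc]
  refine mul_le_mul_of_nonneg_right ?_ (abs_nonneg _)
  have := hy.2.le
  rw [le_div_iff₀ hK] at this
  linarith

lemma AnIcc.exists_deriv {F : LC → LC} {p q : LC} (hF : AnIcc F p q) (hpq : p < q) :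
    ∃ f, AnIcc f p q ∧ QuadDeriv F f p q := by
  obtain ⟨a, ha, hFa⟩ := hF
  obtain ⟨K, hK, H⟩ := ha.ev_quad
  have hw : 0 < (q - p) / 2 := half_pos (sub_pos.2 hpq)
  refine ⟨fun x => ((q - p) / 2)⁻¹ * ev (dseq a) (nm p q x), ?_, K * (((q - p) / 2)⁻¹) ^ 2,
    by positivity, fun x hx y hy => ?_⟩
  · exact (AnIcc.const_mul ⟨dseq a, ha.dseq, fun x _ => rfl⟩ _)
  · have e : nm p q y - nm p q x = ((q - p) / 2)⁻¹ * (y - x) := by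
      rw [nm, nm]; field_simp; ring
    have := H _ _ (disc_nm hx) (disc_nm hy)
    rw [hFa x hx, hFa y hy]
    rw [e, abs_mul, abs_of_pos (inv_pos.2 hw), mul_pow, ← mul_assoc K] at this
    refine le_trans (le_of_eq ?_) this
    congr 1
    ring

lemma AnIcc.exists_antideriv {f : LC → LC} {p q : LC} (hf : AnIcc f p q) (hpq : p < q) :
    ∃ F, AnIcc F p q ∧ QuadDeriv F f p q := by
  obtain ⟨a, ha, hfa⟩ := hf
  have hw : 0 < (q - p) / 2 := half_pos (sub_pos.2 hpq)
  set b : ℕ → LC := fun n => match n with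
    | 0 => 0
    | n + 1 => ofReal ((n + 1 : ℝ)⁻¹) * a n with hb
  have hbn : Nice b := by
    refine ⟨ha.reg.subset ?_, fun q B => ?_⟩
    · rintro p ⟨i, hi⟩
      rcases i with _ | i
      · exact absurd rfl hi
      · refine ⟨i, fun h => hi ?_⟩
        rw [hb]
        simp only
        rw [coeff_ofReal_mul, h, MulZeroClass.mul_zero]
    · obtain ⟨C, hC⟩ := ha.rapid q B
      refine ⟨2 ^ B * C, fun m => ?_⟩
      rcases m with _ | m
      · have h0 : (0 : ℝ) ≤ C := le_trans (by positivity) (hC 0)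
        simp only [hb, coeff_zero, abs_zero, zero_mul]
        positivity
      · simp only [hb]
        rw [coeff_ofReal_mul, abs_mul]
        have h1 : |(m + 1 : ℝ)⁻¹| ≤ 1 := by
          rw [abs_of_pos (by positivity)]
          exact inv_le_one_of_one_le₀ (by linarith [Nat.cast_nonneg (α := ℝ) m])
        have h2 : (((m + 1 : ℕ) : ℝ) + 1) ^ B ≤ 2 ^ B * ((m : ℝ) + 1) ^ B := by
          rw [← mul_pow]
          refine pow_le_pow_left₀ (by positivity) ?_ B
          push_cast
          linarith [Nat.cast_nonneg (α := ℝ) m]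
        calc _ ≤ 1 * |(a m).coeff q| * (2 ^ B * ((m : ℝ) + 1) ^ B) := by
              refine mul_le_mul (mul_le_mul_of_nonneg_right h1 (abs_nonneg _)) h2
                (by positivity) (by positivity)
          _ = 2 ^ B * (|(a m).coeff q| * ((m : ℝ) + 1) ^ B) := by ring
          _ ≤ _ := mul_le_mul_of_nonneg_left (hC m) (by positivity)
  have hd : dseq b = a := by
    funext n
    rw [dseq, hb]
    simp only
    rw [← ofReal_natCast, ← mul_assoc, ← ofReal_mul]
    push_cast
    rw [mul_inv_cancel₀ (by positivity), ofReal_one, one_mul]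
  obtain ⟨K, hK, H⟩ := hbn.ev_quad
  rw [hd] at H
  refine ⟨fun x => (q - p) / 2 * ev b (nm p q x), ?_, K * ((q - p) / 2)⁻¹,
    by positivity, fun x hx y hy => ?_⟩
  · exact (AnIcc.const_mul ⟨b, hbn, fun x _ => rfl⟩ _)
  · have e : nm p q y - nm p q x = ((q - p) / 2)⁻¹ * (y - x) := by
      rw [nm, nm]; field_simp; ring
    have h1 := H _ _ (disc_nm hx) (disc_nm hy)
    rw [hfa x hx]
    rw [e] at h1
    generalize (q - p) / 2 = W at hw h1 ⊢
    have hW : W * W⁻¹ = 1 := mul_inv_cancel₀ hw.ne'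
    rw [abs_mul, abs_of_pos (inv_pos.2 hw)] at h1
    have h2 : W * ev b (nm p q y) - W * ev b (nm p q x) - ev a (nm p q x) * (y - x) =
        W * (ev b (nm p q y) - ev b (nm p q x) - ev a (nm p q x) * (W⁻¹ * (y - x))) := by
      linear_combination (ev a (nm p q x) * (y - x)) * hW
    rw [h2, abs_mul, abs_of_pos hw]
    refine (mul_le_mul_of_nonneg_left h1 hw.le).trans (le_of_eq ?_)
    linear_combination (K * W⁻¹ * |y - x| ^ 2) * hW

lemma QuadDeriv.exists_lipschitz {F f : LC → LC} {p q : LC} (h : QuadDeriv F f p q)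
    (hf : AnIcc f p q) :
    ∃ L, 0 < L ∧ ∀ x ∈ Set.Icc p q, ∀ y ∈ Set.Icc p q, |F y - F x| ≤ L * |y - x| := by
  obtain ⟨K, hK, H⟩ := h
  obtain ⟨M, hM, HM⟩ := hf.bounded
  by_cases hpq : p ≤ q
  · refine ⟨K * (q - p) + M, by nlinarith [sub_nonneg.2 hpq], fun x hx y hy => ?_⟩
    have h1 : |y - x| ≤ q - p := abs_le.2 ⟨by linarith [hx.2, hy.1], by linarith [hx.1, hy.2]⟩
    calc |F y - F x| = |(F y - F x - f x * (y - x)) + f x * (y - x)| := by congr 1; ring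
      _ ≤ K * |y - x| ^ 2 + M * |y - x| := by
          refine (abs_add_le _ _).trans (add_le_add (H x hx y hy) ?_)
          rw [abs_mul]
          exact mul_le_mul_of_nonneg_right (HM x hx) (abs_nonneg _)
      _ = (K * |y - x| + M) * |y - x| := by ring
      _ ≤ _ := by
          refine mul_le_mul_of_nonneg_right ?_ (abs_nonneg _)
          have := mul_le_mul_of_nonneg_left h1 hK.le
          linarith
  · exact ⟨1, one_pos, fun x hx => absurd (hx.1.trans hx.2) hpq⟩

/-- A function given by a power series and with nonnegative derivative is nondecreasing. -/
lemma AnIcc.le_of_deriv_nonneg {F f : LC → LC} {p q : LC} (hF : AnIcc F p q) (hpq : p ≤ q)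
    (hd : ∀ x ∈ Set.Ioo p q, HasDeriv F (f x) x) (hf : ∀ x ∈ Set.Ioo p q, 0 ≤ f x) :
    F p ≤ F q := by
  rcases hpq.eq_or_lt with rfl | hlt
  · exact le_rfl
  obtain ⟨a, ha, hFa⟩ := hF
  have hw : 0 < (q - p) / 2 := half_pos (sub_pos.2 hlt)
  have e1 : nm p q p = ofReal (-1) := by
    rw [nm, ofReal_neg, ofReal_one, div_eq_iff hw.ne']; ring
  have e2 : nm p q q = ofReal 1 := by
    rw [nm, ofReal_one, div_eq_iff hw.ne']; ring
  rw [hFa p (Set.left_mem_Icc.2 hpq), hFa q (Set.right_mem_Icc.2 hpq), e1, e2]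
  -- The sign of the formal derivative is needed at real points only. There, by uniqueness of
  -- derivatives, `f` is a positive multiple of it.
  refine ha.ev_le fun s hs => ?_
  obtain ⟨K, hK, H⟩ := ha.ev_quad
  set x := (p + q) / 2 + (q - p) / 2 * ofReal s with hx
  have hs1 : ofReal s < 1 := by rw [← ofReal_one]; exact ofReal_lt_ofReal.2 hs.2
  have hs2 : -1 < ofReal s := by rw [← ofReal_one, ← ofReal_neg]; exact ofReal_lt_ofReal.2 hs.1
  have hxI : x ∈ Set.Ioo p q := by constructor <;> nlinarith
  have hnx : nm p q x = ofReal s := by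
    rw [nm, div_eq_iff hw.ne', hx]; ring
  have hder : HasDeriv F (((q - p) / 2)⁻¹ * ev (dseq a) (nm p q x)) x := by
    refine QuadDeriv.hasDeriv (f := fun x => ((q - p) / 2)⁻¹ * ev (dseq a) (nm p q x))
      ⟨K * (((q - p) / 2)⁻¹) ^ 2, by positivity, fun x hx y hy => ?_⟩ hxI
    have e : nm p q y - nm p q x = ((q - p) / 2)⁻¹ * (y - x) := by
      rw [nm, nm]; field_simp; ring
    have := H _ _ (disc_nm hx) (disc_nm hy)
    rw [hFa x hx, hFa y hy]
    rw [e, abs_mul, abs_of_pos (inv_pos.2 hw), mul_pow, ← mul_assoc K] at this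
    refine le_trans (le_of_eq ?_) this
    congr 1
    ring
  have h1 := hf x hxI
  rw [(hd x hxI).unique hder, hnx] at h1
  exact nonneg_of_mul_nonneg_right h1 (inv_pos.2 hw)

/-! ## Simple functions -/

/-- On the open interval `f` agrees with a function given by a power series on `[p, q]`. -/
def AnOn (f : LC → LC) (p q : LC) : Prop := ∃ g, AnIcc g p q ∧ ∀ x ∈ Set.Ioo p q, f x = g x

lemma AnIcc.anOn {f : LC → LC} {p q : LC} (hf : AnIcc f p q) : AnOn f p q := ⟨f, hf, fun _ _ => rfl⟩

lemma AnOn.congr {f g : LC → LC} {p q : LC} (hf : AnOn f p q) (h : ∀ x ∈ Set.Ioo p q, f x = g x) :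
    AnOn g p q := by
  obtain ⟨f', hf', e⟩ := hf
  exact ⟨f', hf', fun x hx => by rw [← h x hx, e x hx]⟩

lemma AnOn.restrict {f : LC → LC} {p q p' q' : LC} (hf : AnOn f p q) (hp : p ≤ p')
    (hpq : p' ≤ q') (hq : q' ≤ q) : AnOn f p' q' := by
  obtain ⟨f', hf', e⟩ := hf
  exact ⟨f', hf'.restrict hp hpq hq, fun x hx => e x ⟨hp.trans_lt hx.1, hx.2.trans_le hq⟩⟩

lemma AnOn.mul {f g : LC → LC} {p q : LC} (hf : AnOn f p q) (hg : AnOn g p q) :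
    AnOn (fun x => f x * g x) p q := by
  obtain ⟨f', hf', e⟩ := hf
  obtain ⟨g', hg', e'⟩ := hg
  exact ⟨_, hf'.mul hg', fun x hx => by simp only [e x hx, e' x hx]⟩

lemma AnOn.const_mul {f : LC → LC} {p q : LC} (hf : AnOn f p q) (c : LC) :
    AnOn (fun x => c * f x) p q := (anIcc_const c p q).anOn.mul hf

lemma weakLim_congr {s t : ℕ → LC} {l : LC} (h : WeakLim s l) (e : ∀ n, s n = t n) :
    WeakLim t l := by
  rwa [← show s = t from funext e]

/-- A simple function extends to the closed interval by a rapidly decreasing power series. -/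
lemma IsSimpleOn.exists_anIcc {f : LC → LC} {I : Interval} (h : IsSimpleOn f I) :
    ∃ g, AnIcc g I.left I.right ∧ ∀ x ∈ I.carrier, f x = g x := by
  obtain ⟨x₀, hx₀, c, hc⟩ := h
  have hb := I.subset_Icc hx₀
  have hlt := I.lt
  -- `R` is the signed distance from the centre to the farther endpoint. The points `x₀ + R y` with
  -- `0 < y < 1` then stay inside the interval, which is all that `nice_of_weakLim` asks, while the
  -- disc of radius `|R|` covers the whole interval.
  obtain ⟨R, hR, hR1, hR2, hRI⟩ : ∃ R : LC, R ≠ 0 ∧ x₀ - |R| ≤ I.left ∧ I.right ≤ x₀ + |R| ∧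
      ∀ y, 0 < y → y < 1 → x₀ + R * y ∈ Set.Ioo I.left I.right := by
    rcases le_total (x₀ - I.left) (I.right - x₀) with h | h
    · have hR : 0 < I.right - x₀ := by linarith
      refine ⟨I.right - x₀, hR.ne', ?_, ?_, fun y h0 h1 => ⟨?_, ?_⟩⟩
      · rw [abs_of_pos hR]; linarith
      · rw [abs_of_pos hR]; linarith
      · nlinarith [hb.1, mul_pos hR h0]
      · nlinarith [mul_lt_mul_of_pos_left h1 hR]
    · have hR : 0 < x₀ - I.left := by linarith
      refine ⟨-(x₀ - I.left), (neg_neg_of_pos hR).ne, ?_, ?_, fun y h0 h1 => ⟨?_, ?_⟩⟩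
      · rw [abs_neg, abs_of_pos hR]; linarith
      · rw [abs_neg, abs_of_pos hR]; linarith
      · nlinarith [mul_lt_mul_of_pos_left h1 hR]
      · nlinarith [hb.2, mul_pos hR h0]
  set a : ℕ → LC := fun n => c n * R ^ n with ha
  have hN : Nice a := nice_of_weakLim fun y h0 h1 => by
    refine ⟨_, weakLim_congr (hc _ (I.Ioo_subset (hRI y h0 h1))) fun N => ?_⟩
    refine Finset.sum_congr rfl fun n _ => ?_
    rw [ha, add_sub_cancel_left, mul_pow, ← mul_assoc]
  refine ⟨fun x => ev a ((x - x₀) / R), anIcc_of_disc hN hR hlt.le hR1 hR2 fun _ _ => rfl,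
    fun x hx => ?_⟩
  have hx' := I.subset_Icc hx
  have hdisc : Disc ((x - x₀) / R) := by
    refine disc_of_abs_le ?_
    rw [abs_div, div_le_one (abs_pos.2 hR), abs_le]
    constructor <;> linarith [hx'.1, hx'.2]
  refine (hc x hx).unique (weakLim_congr (hN.hasWSum hdisc).weakLim fun N => ?_)
  refine Finset.sum_congr rfl fun n _ => ?_
  rw [ha, mul_assoc, ← mul_pow, mul_div_cancel₀ _ hR]

lemma IsSimpleOn.anOn {f : LC → LC} {I : Interval} (h : IsSimpleOn f I) :
    AnOn f I.left I.right := by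
  obtain ⟨g, hg, e⟩ := h.exists_anIcc
  exact ⟨g, hg, fun x hx => e x (I.Ioo_subset hx)⟩

lemma isSimpleOn_of_anIcc {f g : LC → LC} {I : Interval} (hg : AnIcc g I.left I.right)
    (e : ∀ x ∈ I.carrier, f x = g x) : IsSimpleOn f I := by
  obtain ⟨a, ha, hga⟩ := hg
  have hlt := I.lt
  have hw : (I.right - I.left) / 2 ≠ 0 := (half_pos (sub_pos.2 hlt)).ne'
  refine ⟨(I.left + I.right) / 2, I.Ioo_subset ⟨by linarith, by linarith⟩,
    fun n => a n * (((I.right - I.left) / 2)⁻¹) ^ n, fun x hx => ?_⟩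
  have hx' := I.subset_Icc hx
  rw [e x hx, hga x hx']
  refine weakLim_congr (ha.hasWSum (disc_nm hx')).weakLim fun N => ?_
  refine Finset.sum_congr rfl fun n _ => ?_
  rw [nm, div_eq_mul_inv _ ((I.right - I.left) / 2), mul_pow]
  ring

/-- The open interval `(p, q)`. -/
def Interval.ioo (p q : LC) (h : p < q) : Interval where
  left := p
  right := q
  lt := h
  carrier := Set.Ioo p q
  Ioo_subset := subset_rfl
  subset_Icc := Set.Ioo_subset_Icc_self

/-! ## Strong limits -/

/-- The infinitesimal `d`. -/
def dd : LC := mono 1 1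

lemma dd_pos : 0 < dd := mono_pos one_pos 1

lemma ordGE_dd_pow (m : ℕ) : OrdGE (dd ^ m) m := by
  simpa [dd] using (OrdGE.mono_self 1 1).pow m

lemma dd_pow_lt_one {m : ℕ} (hm : m ≠ 0) : dd ^ m < 1 := by
  have h : OrdGE (dd ^ m) 1 := (ordGE_dd_pow m).mono (by exact_mod_cast Nat.one_le_iff_ne_zero.2 hm)
  have := h.abs_lt zero_lt_one
  rw [← ofReal_eq_mono, ofReal_one] at this
  exact (le_abs_self _).trans_lt this

lemma exists_dd_pow_lt {ε : LC} (hε : 0 < ε) : ∃ N : ℕ, ∀ m ≥ N, dd ^ m < ε := by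
  obtain ⟨l, hl⟩ := exists_mono_lt hε
  obtain ⟨N, hN⟩ := exists_nat_gt l
  refine ⟨N, fun m hm => (le_abs_self _).trans_lt (hl _ ((ordGE_dd_pow m).mono ?_))⟩
  have : (N : ℚ) ≤ m := by exact_mod_cast hm
  linarith

lemma strongLim_of_ordGE {s : ℕ → LC} {x : LC} (h : ∀ l : ℚ, ∃ N, ∀ m ≥ N, OrdGE (x - s m) l) :
    StrongLim s x := by
  intro ε hε
  obtain ⟨l, hl⟩ := exists_mono_lt hε
  obtain ⟨N, hN⟩ := h l
  refine ⟨N, fun m hm => ?_⟩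
  rw [abs_sub_comm]
  exact hl _ (hN m hm)

lemma StrongLim.le_of_eventually_le {s : ℕ → LC} {x c : LC} (hx : StrongLim s x) {N : ℕ}
    (h : ∀ m ≥ N, s m ≤ c) : x ≤ c := by
  by_contra hlt
  push Not at hlt
  obtain ⟨N', hN'⟩ := hx (x - c) (sub_pos.2 hlt)
  have h1 := hN' (max N N') (le_max_right _ _)
  have h2 := h (max N N') (le_max_left _ _)
  linarith [(abs_lt.1 h1).1]

lemma StrongLim.neg {s : ℕ → LC} {x : LC} (hx : StrongLim s x) :
    StrongLim (fun m => -s m) (-x) := by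
  intro ε hε
  obtain ⟨N, hN⟩ := hx ε hε
  refine ⟨N, fun m hm => ?_⟩
  rw [← abs_neg]
  convert hN m hm using 2
  ring

lemma StrongLim.ge_of_eventually_ge {s : ℕ → LC} {x c : LC} (hx : StrongLim s x) {N : ℕ}
    (h : ∀ m ≥ N, c ≤ s m) : c ≤ x := by
  have := hx.neg.le_of_eventually_le (c := -c) (N := N) fun m hm => neg_le_neg (h m hm)
  linarith

lemma exists_strongSum {u : ℕ → LC} (h : ∀ l : ℚ, ∃ N, ∀ m ≥ N, OrdGE (u m) l) :
    ∃ w, StrongSum u w := by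
  obtain ⟨w, hw⟩ := complete (s := fun N => ∑ n ∈ Finset.range N, u n) fun l => by
    obtain ⟨N, hN⟩ := h l
    refine ⟨N, fun m hm => ?_⟩
    rw [Finset.sum_range_succ, add_sub_cancel_left]
    exact hN m hm
  exact ⟨w, strongLim_of_ordGE hw⟩

lemma StrongSum.ordGE {u : ℕ → LC} {w : LC} (h : StrongSum u w) (l : ℚ) :
    ∃ N, ∀ m ≥ N, OrdGE (u m) l := by
  obtain ⟨N, hN⟩ := h (mono 1 l / 2) (half_pos (mono_pos one_pos l))
  refine ⟨N, fun m hm => (OrdGE.mono_self 1 l).of_le ?_⟩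
  have h1 : |∑ n ∈ Finset.range m, u n - w| < mono 1 l / 2 := hN m hm
  have h2 : |∑ n ∈ Finset.range (m + 1), u n - w| < mono 1 l / 2 := hN (m + 1) (by omega)
  rw [Finset.sum_range_succ] at h2
  calc |u m| = |(∑ n ∈ Finset.range m, u n + u m - w) - (∑ n ∈ Finset.range m, u n - w)| := by
        congr 1; ring
    _ ≤ _ := (abs_sub _ _).trans (by linarith)

/-! ## Finite families of non-overlapping intervals -/

/-- The intervals `[c i, e i]`, `i ∈ S`, are contained in `[a, b]` and do not overlap. -/
structure IsFam {ι : Type*} (S : Finset ι) (c e : ι → LC) (a b : LC) : Prop where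
  le : ∀ i ∈ S, c i ≤ e i
  left : ∀ i ∈ S, a ≤ c i
  right : ∀ i ∈ S, e i ≤ b
  sep : ∀ i ∈ S, ∀ j ∈ S, i ≠ j → e i ≤ c j ∨ e j ≤ c i

section Families

variable {ι κ : Type*} {S : Finset ι} {c e : ι → LC} {a b : LC}

lemma IsFam.filter_left [DecidableEq ι] (h : IsFam S c e a b) (i : ι) :
    IsFam ((S.erase i).filter fun j => e j ≤ c i) c e a (c i) where
  le j hj := h.le j (by simp at hj; tauto)
  left j hj := h.left j (by simp at hj; tauto)
  right j hj := (Finset.mem_filter.1 hj).2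
  sep j hj k hk := h.sep j (by simp at hj; tauto) k (by simp at hk; tauto)

lemma IsFam.filter_right [DecidableEq ι] (h : IsFam S c e a b) {i : ι} (hi : i ∈ S) :
    IsFam ((S.erase i).filter fun j => ¬ e j ≤ c i) c e (e i) b where
  le j hj := h.le j (by simp at hj; tauto)
  left j hj := by
    rw [Finset.mem_filter, Finset.mem_erase] at hj
    exact (h.sep i hi j hj.1.2 hj.1.1.symm).resolve_right hj.2
  right j hj := h.right j (by simp at hj; tauto)
  sep j hj k hk := h.sep j (by simp at hj; tauto) k (by simp at hk; tauto)

/-- Taking out one interval separates the others into those on its left and those on its right.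
Induction on the number of intervals then needs no enumeration in increasing order. -/
lemma IsFam.sum_le (h : IsFam S c e a b) (hab : a ≤ b) {H : LC → LC}
    (hH : MonotoneOn H (Set.Icc a b)) : ∑ i ∈ S, (H (e i) - H (c i)) ≤ H b - H a := by
  classical
  induction hn : S.card using Nat.strong_induction_on generalizing S a b with
  | _ n ih =>
    rcases S.eq_empty_or_nonempty with rfl | ⟨i, hi⟩
    · simpa using hH (Set.left_mem_Icc.2 hab) (Set.right_mem_Icc.2 hab) hab
    · have hcard : (S.erase i).card < n := hn ▸ Finset.card_erase_lt_of_mem hi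
      have h1 := h.left i hi
      have h2 := h.le i hi
      have h3 := h.right i hi
      have a1 := ih _ ((Finset.card_filter_le _ _).trans_lt hcard) (h.filter_left i) h1
        (hH.mono (Set.Icc_subset_Icc_right (h2.trans h3))) rfl
      have a2 := ih _ ((Finset.card_filter_le _ _).trans_lt hcard) (h.filter_right hi) h3
        (hH.mono (Set.Icc_subset_Icc_left (h1.trans h2))) rfl
      rw [← Finset.add_sum_erase _ _ hi,
        ← Finset.sum_filter_add_sum_filter_not (S.erase i) (fun j => e j ≤ c i)]
      linarith

lemma IsFam.sum_length_le (h : IsFam S c e a b) (hab : a ≤ b) :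
    ∑ i ∈ S, (e i - c i) ≤ b - a :=
  h.sum_le hab (H := fun x => x) (fun _ _ _ _ hxy => hxy)

/-- If an additive property holds on the intervals of a family and fails on `[a, b]`, it fails on
one of the gaps. -/
lemma IsFam.exists_gap (h : IsFam S c e a b) (hab : a ≤ b) {T : LC → LC → Prop}
    (hT : ∀ x y z, a ≤ x → x ≤ y → y ≤ z → z ≤ b → T x y → T y z → T x z)
    (hS : ∀ i ∈ S, T (c i) (e i)) (hab' : ¬ T a b) :
    ∃ a' b', a ≤ a' ∧ a' ≤ b' ∧ b' ≤ b ∧ ¬ T a' b' ∧ b' - a' ≤ b - a - ∑ i ∈ S, (e i - c i) := by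
  classical
  induction hn : S.card using Nat.strong_induction_on generalizing S a b with
  | _ n ih =>
    rcases S.eq_empty_or_nonempty with rfl | ⟨i, hi⟩
    · exact ⟨a, b, le_rfl, hab, le_rfl, hab', by simp⟩
    · have hcard : (S.erase i).card < n := hn ▸ Finset.card_erase_lt_of_mem hi
      have h1 := h.left i hi
      have h2 := h.le i hi
      have h3 := h.right i hi
      have s1 := (h.filter_left i).sum_length_le h1
      have s2 := (h.filter_right hi).sum_length_le h3
      have hsum := Finset.sum_filter_add_sum_filter_not (S.erase i) (fun j => e j ≤ c i)
        (fun j => e j - c j)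
      have hsum' := Finset.add_sum_erase S (fun j => e j - c j) hi
      by_cases hL : T a (c i)
      · have hR : ¬ T (e i) b := fun hR =>
          hab' (hT a (e i) b le_rfl (h1.trans h2) h3 le_rfl
            (hT a (c i) (e i) le_rfl h1 h2 h3 hL (hS i hi)) hR)
        obtain ⟨a', b', q1, q2, q3, q4, q5⟩ := ih _ ((Finset.card_filter_le _ _).trans_lt hcard)
          (h.filter_right hi) h3
          (fun x y z hx hxy hyz hz => hT x y z ((h1.trans h2).trans hx) hxy hyz hz)
          (fun j hj => hS j (by simp at hj; tauto)) hR rfl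
        exact ⟨a', b', (h1.trans h2).trans q1, q2, q3, q4, by linarith⟩
      · obtain ⟨a', b', q1, q2, q3, q4, q5⟩ := ih _ ((Finset.card_filter_le _ _).trans_lt hcard)
          (h.filter_left i) h1
          (fun x y z hx hxy hyz hz => hT x y z hx hxy hyz (hz.trans (h2.trans h3)))
          (fun j hj => hS j (by simp at hj; tauto)) hL rfl
        exact ⟨a', b', q1, q2, q3.trans (h2.trans h3), q4, by linarith⟩

open Classical in
/-- The indices of the intervals of a family that overlap `[p, q]`. -/
def overlapping (S : Finset ι) (c e : ι → LC) (p q : LC) : Finset ι :=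
  S.filter fun j => max p (c j) < min q (e j)

lemma mem_overlapping {p q : LC} {j : ι} :
    j ∈ overlapping S c e p q ↔ j ∈ S ∧ max p (c j) < min q (e j) := by
  classical
  exact Finset.mem_filter

/-- The intersections of a family with an interval. -/
lemma IsFam.restrict (h : IsFam S c e a b) (p q : LC) :
    IsFam (overlapping S c e p q) (fun j => max p (c j)) (fun j => min q (e j)) p q where
  le j hj := (mem_overlapping.1 hj).2.le
  left j _ := le_max_left _ _
  right j _ := min_le_left _ _
  sep j hj k hk hjk := by
    rcases h.sep j (mem_overlapping.1 hj).1 k (mem_overlapping.1 hk).1 hjk with h' | h'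
    · exact Or.inl ((min_le_right _ _).trans (h'.trans (le_max_right _ _)))
    · exact Or.inr ((min_le_right _ _).trans (h'.trans (le_max_right _ _)))

/-- The length of `[c, e] ∩ [x, y]`. -/
lemma clamp_sub_clamp {c e x y : LC} (hce : c ≤ e) (hxy : x ≤ y) :
    max c (min e y) - max c (min e x) =
      if max x c < min y e then min y e - max x c else 0 := by
  rcases le_total e y with h1 | h1 <;> rcases le_total e x with h2 | h2 <;>
    rcases le_total c x with h3 | h3 <;> rcases le_total c y with h4 | h4 <;>
    simp only [min_eq_left, min_eq_right, max_eq_left, max_eq_right, h1, h2, h3, h4, hce] <;>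
    split_ifs <;> linarith

/-- The pairs of overlapping intervals of two families. -/
def overlapPairs (S : Finset ι) (c e : ι → LC) (S' : Finset κ) (c' e' : κ → LC) :
    Finset (Σ _ : ι, κ) :=
  S.sigma fun i => overlapping S' c' e' (c i) (e i)

variable {S' : Finset κ} {c' e' : κ → LC}

lemma mem_overlapPairs {z : Σ _ : ι, κ} : z ∈ overlapPairs S c e S' c' e' ↔
    z.1 ∈ S ∧ z.2 ∈ S' ∧ max (c z.1) (c' z.2) < min (e z.1) (e' z.2) := by
  rw [overlapPairs, Finset.mem_sigma, mem_overlapping]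

/-- The intersection of two families. -/
lemma IsFam.inter (h : IsFam S c e a b) (h' : IsFam S' c' e' a b) :
    IsFam (overlapPairs S c e S' c' e') (fun z => max (c z.1) (c' z.2))
      (fun z => min (e z.1) (e' z.2)) a b where
  le z hz := (mem_overlapPairs.1 hz).2.2.le
  left z hz := (h.left _ (mem_overlapPairs.1 hz).1).trans (le_max_left _ _)
  right z hz := (min_le_left _ _).trans (h.right _ (mem_overlapPairs.1 hz).1)
  sep := by
    rintro ⟨i, j⟩ hz ⟨i', j'⟩ hz' hne
    obtain ⟨hi, hj, -⟩ := mem_overlapPairs.1 hz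
    obtain ⟨hi', hj', -⟩ := mem_overlapPairs.1 hz'
    by_cases hii : i = i'
    · subst hii
      have hjj : j ≠ j' := fun hjj => hne (by rw [hjj])
      rcases h'.sep j hj j' hj' hjj with q | q
      · exact Or.inl ((min_le_right _ _).trans (q.trans (le_max_right _ _)))
      · exact Or.inr ((min_le_right _ _).trans (q.trans (le_max_right _ _)))
    · rcases h.sep i hi i' hi' hii with q | q
      · exact Or.inl ((min_le_left _ _).trans (q.trans (le_max_left _ _)))
      · exact Or.inr ((min_le_left _ _).trans (q.trans (le_max_left _ _)))

lemma sum_overlapping (p q : LC) (hpq : p ≤ q) (h : IsFam S c e a b) :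
    ∑ j ∈ overlapping S c e p q, (min q (e j) - max p (c j)) =
      ∑ j ∈ S, (max (c j) (min (e j) q) - max (c j) (min (e j) p)) := by
  classical
  rw [overlapping, Finset.sum_filter]
  exact Finset.sum_congr rfl fun j hj => (clamp_sub_clamp (h.le j hj) hpq).symm

/-- The total length of the intersection of two families. -/
lemma IsFam.le_sum_inter (h : IsFam S c e a b) (h' : IsFam S' c' e' a b) (hab : a ≤ b) :
    ∑ i ∈ S, (e i - c i) + ∑ j ∈ S', (e' j - c' j) - (b - a) ≤
      ∑ z ∈ overlapPairs S c e S' c' e', (min (e z.1) (e' z.2) - max (c z.1) (c' z.2)) := by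
  -- Up to a constant, `H x` is the length of the part of `[a, x]` that the second family leaves
  -- uncovered. It is nondecreasing, so the intervals of the first family contain no more uncovered
  -- length than `[a, b]` does.
  set H : LC → LC := fun x => x - ∑ j ∈ S', max (c' j) (min (e' j) x) with hH
  have hmono : MonotoneOn H (Set.Icc a b) := by
    intro x _ y _ hxy
    have h1 := (h'.restrict x y).sum_length_le hxy
    rw [sum_overlapping x y hxy h', Finset.sum_sub_distrib] at h1
    simp only [hH]
    linarith
  have h2 := h.sum_le hab hmono
  have h3 : H b - H a = (b - a) - ∑ j ∈ S', (e' j - c' j) := by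
    have e1 : ∑ j ∈ S', max (c' j) (min (e' j) b) = ∑ j ∈ S', e' j :=
      Finset.sum_congr rfl fun j hj => by
        rw [min_eq_left (h'.right j hj), max_eq_right (h'.le j hj)]
    have e2 : ∑ j ∈ S', max (c' j) (min (e' j) a) = ∑ j ∈ S', c' j :=
      Finset.sum_congr rfl fun j hj => by
        rw [min_eq_right ((h'.left j hj).trans (h'.le j hj)), max_eq_left (h'.left j hj)]
    simp only [hH, e1, e2, Finset.sum_sub_distrib]
    ring
  have h4 : ∑ i ∈ S, (H (e i) - H (c i)) = ∑ i ∈ S, (e i - c i) -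
      ∑ z ∈ overlapPairs S c e S' c' e', (min (e z.1) (e' z.2) - max (c z.1) (c' z.2)) := by
    rw [overlapPairs, Finset.sum_sigma, ← Finset.sum_sub_distrib]
    refine Finset.sum_congr rfl fun i hi => ?_
    rw [sum_overlapping _ _ (h.le i hi) h', Finset.sum_sub_distrib]
    simp only [hH]
    ring
  linarith

end Families

/-! ## Properties of intervals that hold up to small total length -/

/-- For every `ε > 0` there is a finite family of intervals with the property `P` that covers
`[a, b]` up to total length `ε`. -/
def MF (P : LC → LC → Prop) (a b : LC) : Prop :=
  ∀ ε, 0 < ε → ∃ (ι : Type) (S : Finset ι) (c e : ι → LC), IsFam S c e a b ∧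
    (∀ i ∈ S, P (c i) (e i)) ∧ b - a - ∑ i ∈ S, (e i - c i) < ε

/-- The property passes to subintervals. -/
def Hered (P : LC → LC → Prop) : Prop :=
  ∀ p q p' q', P p q → p ≤ p' → p' ≤ q' → q' ≤ q → P p' q'

lemma MF.imp {P Q : LC → LC → Prop} {a b : LC} (h : MF P a b)
    (hPQ : ∀ p q, a ≤ p → p ≤ q → q ≤ b → P p q → Q p q) : MF Q a b := by
  intro ε hε
  obtain ⟨ι, S, c, e, hF, hP, hs⟩ := h ε hε
  exact ⟨ι, S, c, e, hF, fun i hi =>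
    hPQ _ _ (hF.left i hi) (hF.le i hi) (hF.right i hi) (hP i hi), hs⟩

lemma MF.and {P Q : LC → LC → Prop} {a b : LC} (hab : a ≤ b) (hP : MF P a b) (hQ : MF Q a b)
    (hP' : Hered P) (hQ' : Hered Q) : MF (fun p q => P p q ∧ Q p q) a b := by
  intro ε hε
  obtain ⟨ι, S, c, e, hF, hFP, hs⟩ := hP (ε / 2) (half_pos hε)
  obtain ⟨κ, S', c', e', hF', hFQ, hs'⟩ := hQ (ε / 2) (half_pos hε)
  refine ⟨_, _, _, _, hF.inter hF', fun z hz => ?_, ?_⟩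
  · obtain ⟨h1, h2, h3⟩ := mem_overlapPairs.1 hz
    exact ⟨hP' _ _ _ _ (hFP _ h1) (le_max_left _ _) h3.le (min_le_left _ _),
      hQ' _ _ _ _ (hFQ _ h2) (le_max_right _ _) h3.le (min_le_right _ _)⟩
  · have := hF.le_sum_inter hF' hab
    linarith

/-- `[a, b]` can be cut at the point `x`. -/
lemma mf_split {a b : LC} (hab : a ≤ b) (x : LC) : MF (fun p q => q ≤ x ∨ x ≤ p) a b := by
  intro ε hε
  by_cases hx : x ≤ a
  · refine ⟨Unit, {()}, fun _ => a, fun _ => b, ⟨?_, ?_, ?_, ?_⟩, ?_, ?_⟩ <;> simp [hab, hx, hε]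
  by_cases hx' : b ≤ x
  · refine ⟨Unit, {()}, fun _ => a, fun _ => b, ⟨?_, ?_, ?_, ?_⟩, ?_, ?_⟩ <;> simp [hab, hx', hε]
  push Not at hx hx'
  refine ⟨Bool, Finset.univ, fun i => bif i then a else x, fun i => bif i then x else b,
    ⟨?_, ?_, ?_, ?_⟩, ?_, ?_⟩
  · simp [hx.le, hx'.le]
  · simp [hx.le]
  · simp [hx'.le]
  · simp
  · simp
  · simp; linarith

lemma hered_split (x : LC) : Hered fun p q => q ≤ x ∨ x ≤ p :=
  fun _ _ _ _ h h1 _ h3 => h.imp (fun h => h3.trans h) fun h => h.trans h1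

lemma hered_anOn (f : LC → LC) : Hered (AnOn f) := fun _ _ _ _ h h1 h2 h3 => h.restrict h1 h2 h3

/-- A local and additive property that holds, up to small total length, on all subintervals holds
on the whole interval. -/
theorem cousin {T : LC → LC → Prop} {a b : LC} (hab : a ≤ b)
    (hT : ∀ x y z, a ≤ x → x ≤ y → y ≤ z → z ≤ b → T x y → T y z → T x z)
    (hloc : ∀ p, a ≤ p → p ≤ b → ∃ η, 0 < η ∧ ∀ x y, a ≤ x → x ≤ p → p ≤ y → y ≤ b →
      y - x < η → T x y)
    (hmf : ∀ x y, a ≤ x → x < y → y ≤ b → MF T x y) : T a b := by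
  by_contra hab'
  set B := {z : LC × LC // a ≤ z.1 ∧ z.1 ≤ z.2 ∧ z.2 ≤ b ∧ ¬ T z.1 z.2} with hB
  -- A failing interval contains a failing gap of length below `d ^ m`, because a family with the
  -- property covers all but that much. The nested gaps shrink to a point by completeness, and
  -- locality at this point is violated. A degenerate interval contradicts locality at once.
  have step : ∀ (z : B) (m : ℕ), ∃ z' : B, z.1.1 ≤ z'.1.1 ∧ z'.1.2 ≤ z.1.2 ∧
      z'.1.2 - z'.1.1 < dd ^ m := by
    rintro ⟨⟨x, y⟩, h1, h2, h3, h4⟩ m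
    simp only at h1 h2 h3 h4
    rcases h2.eq_or_lt with rfl | hlt
    · obtain ⟨η, hη, H⟩ := hloc x h1 h3
      exact absurd (H x x h1 le_rfl le_rfl h3 (by simpa using hη)) h4
    · obtain ⟨ι, S, c, e, hF, hS, hs⟩ := hmf x y h1 hlt h3 (dd ^ m) (pow_pos dd_pos m)
      obtain ⟨a', b', q1, q2, q3, q4, q5⟩ := hF.exists_gap h2
        (fun u v w hu huv hvw hw => hT u v w (h1.trans hu) huv hvw (hw.trans h3)) hS h4
      exact ⟨⟨(a', b'), h1.trans q1, q2, q3.trans h3, q4⟩, q1, q3, q5.trans_lt hs⟩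
  choose nxt hn1 hn2 hn3 using step
  set z : ℕ → B := fun m => Nat.rec ⟨(a, b), le_rfl, hab, le_rfl, hab'⟩ (fun m z => nxt z m) m with hz
  have hzs : ∀ m, z (m + 1) = nxt (z m) m := fun m => rfl
  have hlo : ∀ m n, m ≤ n → (z m).1.1 ≤ (z n).1.1 := fun m n hmn => by
    induction n, hmn using Nat.le_induction with
    | base => exact le_rfl
    | succ n _ ih => rw [hzs]; exact ih.trans (hn1 _ _)
  have hhi : ∀ m n, m ≤ n → (z n).1.2 ≤ (z m).1.2 := fun m n hmn => by
    induction n, hmn using Nat.le_induction with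
    | base => exact le_rfl
    | succ n _ ih => rw [hzs]; exact (hn2 _ _).trans ih
  have hlen : ∀ m, (z (m + 1)).1.2 - (z (m + 1)).1.1 < dd ^ m := fun m => by
    rw [hzs]; exact hn3 _ _
  obtain ⟨p, hp⟩ := complete (s := fun m => (z m).1.1) fun l => by
    obtain ⟨N, hN⟩ := exists_nat_gt l
    refine ⟨N + 1, fun m hm => ?_⟩
    obtain ⟨m, rfl⟩ : ∃ m', m = m' + 1 := ⟨m - 1, by omega⟩
    have h1 : OrdGE (dd ^ m) l := (ordGE_dd_pow m).mono (by
      have : (N : ℚ) ≤ m := by exact_mod_cast (by omega : N ≤ m)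
      linarith)
    refine h1.of_le ?_
    rw [abs_of_nonneg (sub_nonneg.2 (hlo (m + 1) (m + 1 + 1) (by omega)))]
    have h2 := hlen m
    have h3 := hhi (m + 1) (m + 1 + 1) (by omega)
    have h4 := (z (m + 1 + 1)).2.2.1
    linarith
  have hp' := strongLim_of_ordGE hp
  have hpl : ∀ m, (z m).1.1 ≤ p := fun m => hp'.ge_of_eventually_ge (N := m) fun n hn => hlo m n hn
  have hpr : ∀ m, p ≤ (z m).1.2 := fun m => hp'.le_of_eventually_le (N := m) fun n hn =>
    (z n).2.2.1.trans (hhi m n hn)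
  obtain ⟨η, hη, H⟩ := hloc p ((z 0).2.1.trans (hpl 0)) ((hpr 0).trans (z 0).2.2.2.1)
  obtain ⟨N, hN⟩ := exists_dd_pow_lt hη
  exact (z (N + 1)).2.2.2.2 (H _ _ (z (N + 1)).2.1 (hpl (N + 1)) (hpr (N + 1)) (z (N + 1)).2.2.2.1
    ((hlen N).trans (hN N le_rfl)))

/-! ## Sequences of intervals -/

/-- The points `q - (q - p) d ^ k`. -/
def padPt (p q : LC) (k : ℕ) : LC := q - (q - p) * dd ^ k

lemma padPt_strictMono {p q : LC} (h : p < q) : StrictMono (padPt p q) := by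
  refine strictMono_nat_of_lt_succ fun k => ?_
  have h1 : 0 < (q - p) * dd ^ k := mul_pos (sub_pos.2 h) (pow_pos dd_pos k)
  have h2 : dd < 1 := by simpa using dd_pow_lt_one one_ne_zero
  have h3 : (q - p) * dd ^ k * dd < (q - p) * dd ^ k := mul_lt_of_lt_one_right h1 h2
  have h4 : (q - p) * dd ^ (k + 1) = (q - p) * dd ^ k * dd := by ring
  change q - (q - p) * dd ^ k < q - (q - p) * dd ^ (k + 1)
  linarith

lemma padPt_zero (p q : LC) : padPt p q 0 = p := by simp [padPt]

lemma padPt_lt {p q : LC} (h : p < q) (k : ℕ) : padPt p q k < q := by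
  have h1 : 0 < (q - p) * dd ^ k := mul_pos (sub_pos.2 h) (pow_pos dd_pos k)
  rw [padPt]; linarith

lemma le_padPt {p q : LC} (h : p < q) (k : ℕ) : p ≤ padPt p q k := by
  have h1 := (padPt_strictMono h).monotone (Nat.zero_le k)
  rwa [padPt_zero] at h1

lemma padPt_strongLim {p q : LC} (h : p < q) : StrongLim (padPt p q) q := by
  intro ε hε
  have h0 : 0 < q - p := sub_pos.2 h
  obtain ⟨N, hN⟩ := exists_dd_pow_lt (div_pos hε h0)
  refine ⟨N, fun m hm => ?_⟩
  have h1 : 0 < (q - p) * dd ^ m := mul_pos h0 (pow_pos dd_pos m)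
  rw [padPt, sub_sub_cancel_left, abs_neg, abs_of_pos h1]
  have := hN m hm
  rw [lt_div_iff₀ h0] at this
  linarith

/-- The consecutive intervals between the points `padPt`. -/
def padInt (p q : LC) (h : p < q) (k : ℕ) : Interval :=
  Interval.ioo (padPt p q k) (padPt p q (k + 1)) (padPt_strictMono h (Nat.lt_succ_self k))

/-- A finite family, followed by the consecutive intervals that fill one further interval. -/
lemma exists_seq_of_list {N : ℕ} {c e : ℕ → LC} (hce : ∀ n < N, c n < e n) {p q : LC} (hpq : p < q)
    (hsep : ∀ m < N, ∀ n < N, m ≠ n → e m ≤ c n ∨ e n ≤ c m)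
    (hsep' : ∀ m < N, e m ≤ p ∨ q ≤ c m) :
    ∃ I : ℕ → Interval, IsDisjointSeq I ∧
      (∀ n, (∃ m < N, (I n).left = c m ∧ (I n).right = e m) ∨
        (p ≤ (I n).left ∧ (I n).right ≤ q)) ∧
      (∀ n, (I n).carrier = Set.Ioo (I n).left (I n).right) ∧
      (∀ n (h : n < N), I n = Interval.ioo (c n) (e n) (hce n h)) ∧
      StrongSum (fun n => (I n).length) (∑ n ∈ Finset.range N, (e n - c n) + (q - p)) := by
  set I : ℕ → Interval := fun n =>
    if h : n < N then Interval.ioo (c n) (e n) (hce n h) else padInt p q hpq (n - N) with hI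
  have I1 : ∀ n (h : n < N), I n = Interval.ioo (c n) (e n) (hce n h) := fun n h => dif_pos h
  have I2 : ∀ n, ¬ n < N → I n = padInt p q hpq (n - N) := fun n h => dif_neg h
  have hcar : ∀ n, (I n).carrier = Set.Ioo (I n).left (I n).right := by
    intro n
    by_cases h : n < N
    · rw [I1 n h]; rfl
    · rw [I2 n h]; rfl
  have hsepI : ∀ m n, m ≠ n → (I m).right ≤ (I n).left ∨ (I n).right ≤ (I m).left := by
    intro m n hmn
    by_cases h : m < N <;> by_cases h' : n < N
    · rw [I1 m h, I1 n h']
      exact hsep m h n h' hmn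
    · rw [I1 m h, I2 n h']
      rcases hsep' m h with k | k
      · exact Or.inl (k.trans (le_padPt hpq _))
      · exact Or.inr ((padPt_lt hpq _).le.trans k)
    · rw [I2 m h, I1 n h']
      rcases hsep' n h' with k | k
      · exact Or.inr (k.trans (le_padPt hpq _))
      · exact Or.inl ((padPt_lt hpq _).le.trans k)
    · rw [I2 m h, I2 n h']
      rcases lt_or_gt_of_ne hmn with k | k
      · exact Or.inl ((padPt_strictMono hpq).monotone (by omega))
      · exact Or.inr ((padPt_strictMono hpq).monotone (by omega))
  refine ⟨I, fun m n hmn => ?_, fun n => ?_, hcar, I1, ?_⟩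
  · rw [hcar, hcar, Set.disjoint_left]
    rintro x ⟨hx1, hx2⟩ ⟨hx3, hx4⟩
    rcases hsepI m n hmn with k | k
    · exact lt_irrefl x (hx2.trans_le (k.trans hx3.le))
    · exact lt_irrefl x (hx4.trans_le (k.trans hx1.le))
  · by_cases h : n < N
    · rw [I1 n h]; exact Or.inl ⟨n, h, rfl, rfl⟩
    · rw [I2 n h]; exact Or.inr ⟨le_padPt hpq _, (padPt_lt hpq _).le⟩
  · have hsum : ∀ k, ∑ n ∈ Finset.range (N + k), (I n).length =
        ∑ n ∈ Finset.range N, (e n - c n) + (padPt p q k - p) := by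
      intro k
      induction k with
      | zero =>
        rw [padPt_zero, sub_self, add_zero, add_zero]
        refine Finset.sum_congr rfl fun n hn => ?_
        rw [I1 n (Finset.mem_range.1 hn)]; rfl
      | succ k ih =>
        rw [← add_assoc, Finset.sum_range_succ, ih, I2 (N + k) (by omega)]
        have : (padInt p q hpq (N + k - N)).length = padPt p q (k + 1) - padPt p q k := by
          rw [Nat.add_sub_cancel_left]; rfl
        rw [this]
        ring
    intro ε hε
    obtain ⟨M, hM⟩ := padPt_strongLim hpq ε hε
    refine ⟨N + M, fun m hm => ?_⟩
    obtain ⟨k, rfl⟩ : ∃ k, m = N + k := ⟨m - N, by omega⟩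
    change |∑ n ∈ Finset.range (N + k), (I n).length - _| < ε
    rw [hsum k]
    convert hM k (by omega) using 2
    ring

/-- A finite family with positive total length gives a sequence of open intervals with the same
total length. -/
lemma IsFam.exists_seq {ι : Type*} {S : Finset ι} {c e : ι → LC} {a b : LC} (h : IsFam S c e a b)
    (hpos : 0 < ∑ i ∈ S, (e i - c i)) :
    ∃ I : ℕ → Interval, IsDisjointSeq I ∧
      (∀ n, ∃ i ∈ S, c i ≤ (I n).left ∧ (I n).right ≤ e i) ∧
      (∀ n, (I n).carrier = Set.Ioo (I n).left (I n).right) ∧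
      StrongSum (fun n => (I n).length) (∑ i ∈ S, (e i - c i)) := by
  classical
  set S₁ := S.filter fun i => c i < e i with hS₁
  have hmem : ∀ i ∈ S₁, i ∈ S ∧ c i < e i := fun i hi => Finset.mem_filter.1 hi
  have hsum1 : ∑ i ∈ S₁, (e i - c i) = ∑ i ∈ S, (e i - c i) := by
    refine Finset.sum_subset (Finset.filter_subset _ _) fun i hi hi' => ?_
    have : ¬ c i < e i := fun hlt => hi' (Finset.mem_filter.2 ⟨hi, hlt⟩)
    rw [le_antisymm (not_lt.1 this) (h.le i hi), sub_self]
  -- Sequences of intervals are infinite and nondegenerate. One interval of positive length is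
  -- therefore set aside, to be cut into infinitely many pieces.
  obtain ⟨i₀, hi₀⟩ : S₁.Nonempty := by
    by_contra hemp
    rw [Finset.not_nonempty_iff_eq_empty] at hemp
    rw [← hsum1, hemp, Finset.sum_empty] at hpos
    exact lt_irrefl _ hpos
  set S₂ := S₁.erase i₀ with hS₂
  set N := S₂.card with hN
  set φ : ℕ → ι := fun n => if h : n < N then (S₂.equivFin.symm ⟨n, h⟩ : ι) else i₀ with hφ
  have hφ1 : ∀ n (h : n < N), φ n = (S₂.equivFin.symm ⟨n, h⟩ : ι) := fun n h => dif_pos h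
  have hφ2 : ∀ n < N, φ n ∈ S₂ := fun n h => by rw [hφ1 n h]; exact (S₂.equivFin.symm ⟨n, h⟩).2
  have hφ3 : ∀ m < N, ∀ n < N, m ≠ n → φ m ≠ φ n := by
    intro m hm n hn hmn heq
    rw [hφ1 m hm, hφ1 n hn] at heq
    have := S₂.equivFin.symm.injective (Subtype.ext heq)
    exact hmn (by simpa using this)
  have hφS : ∀ n < N, φ n ∈ S ∧ c (φ n) < e (φ n) ∧ φ n ≠ i₀ := fun n hn => by
    have := hφ2 n hn
    rw [hS₂, Finset.mem_erase] at this
    exact ⟨(hmem _ this.2).1, (hmem _ this.2).2, this.1⟩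
  obtain ⟨I, hd, hI, hcar, -, hs⟩ := exists_seq_of_list (N := N) (c := fun n => c (φ n))
    (e := fun n => e (φ n)) (fun n hn => (hφS n hn).2.1) (hmem i₀ hi₀).2
    (fun m hm n hn hmn => h.sep _ (hφS m hm).1 _ (hφS n hn).1 (hφ3 m hm n hn hmn))
    (fun m hm => h.sep _ (hφS m hm).1 _ (hmem i₀ hi₀).1 (hφS m hm).2.2)
  refine ⟨I, hd, fun n => ?_, hcar, ?_⟩
  · rcases hI n with ⟨m, hm, h1, h2⟩ | ⟨h1, h2⟩
    · exact ⟨φ m, (hφS m hm).1, h1.ge, h2.le⟩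
    · exact ⟨i₀, (hmem i₀ hi₀).1, h1, h2⟩
  · convert hs using 1
    rw [← hsum1, ← Finset.add_sum_erase _ _ hi₀, add_comm]
    congr 1
    rw [← Finset.sum_coe_sort, Finset.sum_range]
    refine (Fintype.sum_equiv S₂.equivFin.symm _ _ fun n => ?_).symm
    rw [hφ1 n n.2]

lemma Interval.bounds {I : Interval} {a b : LC} (h : I.carrier ⊆ Set.Icc a b) :
    a ≤ I.left ∧ I.right ≤ b := by
  have hlt := I.lt
  constructor
  · by_contra hc
    push Not at hc
    have h1 : I.left < min a I.right := lt_min hc hlt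
    set x := (I.left + min a I.right) / 2 with hx
    have hxI : x ∈ I.carrier := I.Ioo_subset ⟨by linarith, by linarith [min_le_right a I.right]⟩
    have := (h hxI).1
    linarith [min_le_left a I.right]
  · by_contra hc
    push Not at hc
    have h1 : max b I.left < I.right := max_lt hc hlt
    set x := (max b I.left + I.right) / 2 with hx
    have hxI : x ∈ I.carrier := I.Ioo_subset ⟨by linarith [le_max_right b I.left], by linarith⟩
    have := (h hxI).2
    linarith [le_max_left b I.left]

lemma Interval.sep_of_disjoint {I J : Interval} (h : Disjoint I.carrier J.carrier) :
    I.right ≤ J.left ∨ J.right ≤ I.left := by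
  by_contra hc
  push Not at hc
  have hI := I.lt
  have hJ := J.lt
  have h1 : max I.left J.left < min I.right J.right :=
    max_lt (lt_min hI hc.2) (lt_min hc.1 hJ)
  set x := (max I.left J.left + min I.right J.right) / 2 with hx
  have hlo : max I.left J.left < x := by linarith
  have hhi : x < min I.right J.right := by linarith
  exact Set.disjoint_left.1 h
    (I.Ioo_subset ⟨(le_max_left _ _).trans_lt hlo, hhi.trans_le (min_le_left _ _)⟩)
    (J.Ioo_subset ⟨(le_max_right _ _).trans_lt hlo, hhi.trans_le (min_le_right _ _)⟩)

/-- The first intervals of a sequence of disjoint intervals in `[a, b]`. -/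
lemma IsDisjointSeq.isFam {I : ℕ → Interval} (hd : IsDisjointSeq I) {a b : LC}
    (h : (⋃ n, (I n).carrier) ⊆ Set.Icc a b) (N : ℕ) :
    IsFam (Finset.range N) (fun n => (I n).left) (fun n => (I n).right) a b where
  le n _ := (I n).lt.le
  left n _ := (Interval.bounds ((Set.subset_iUnion _ n).trans h)).1
  right n _ := (Interval.bounds ((Set.subset_iUnion _ n).trans h)).2
  sep m _ n _ hmn := Interval.sep_of_disjoint (hd m n hmn)

lemma hasMeasure_Icc {a b : LC} (hab : a < b) : HasMeasure (Set.Icc a b) (b - a) := by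
  obtain ⟨I, hId, hI, hIc, -, hIs⟩ := exists_seq_of_list (N := 0) (c := fun _ => a) (e := fun _ => b)
    (fun n hn => absurd hn (Nat.not_lt_zero n)) hab (fun n hn => absurd hn (Nat.not_lt_zero n))
    (fun n hn => absurd hn (Nat.not_lt_zero n))
  have hIsub : (⋃ n, (I n).carrier) ⊆ Set.Icc a b := by
    refine Set.iUnion_subset fun n x hx => ?_
    rw [hIc n] at hx
    rcases hI n with ⟨m, hm, -⟩ | ⟨h1, h2⟩
    · exact absurd hm (Nat.not_lt_zero m)
    · exact ⟨h1.trans hx.1.le, hx.2.le.trans h2⟩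
  simp only [Finset.range_zero, Finset.sum_empty, zero_add] at hIs
  refine ⟨fun ε hε => ?_, ⟨?_, fun x hx => hx ⟨I, hId, hIsub, hIs⟩⟩⟩
  · have hbε : b < b + ε := by linarith
    -- The closed interval alone would be an optimal cover, but a sequence needs infinitely many
    -- further disjoint intervals. They are placed in `(b, b + ε)`, at the price of the allowed
    -- excess `ε`.
    set J : ℕ → Interval := fun n => match n with
      | 0 => ⟨a, b, hab, Set.Icc a b, Set.Ioo_subset_Icc_self, subset_rfl⟩
      | n + 1 => padInt b (b + ε) hbε n with hJ
    have hJb : ∀ n, ∀ x ∈ (J (n + 1)).carrier, b < x := fun n x hx =>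
      (le_padPt hbε n).trans_lt hx.1
    refine ⟨I, J, b - a, b - a + ε, hId, ?_, hIsub, ?_, hIs, ?_, by simp⟩
    · intro m n hmn
      rw [Set.disjoint_left]
      intro x hx hx'
      rcases m with _ | m <;> rcases n with _ | n
      · exact hmn rfl
      · exact absurd (hJb n x hx') (not_lt.2 hx.2)
      · exact absurd (hJb m x hx) (not_lt.2 hx'.2)
      · rcases lt_or_gt_of_ne hmn with k | k
        · have : padPt b (b + ε) (m + 1) ≤ padPt b (b + ε) n :=
            (padPt_strictMono hbε).monotone (by omega)
          exact lt_irrefl x (hx.2.trans_le (this.trans hx'.1.le))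
        · have : padPt b (b + ε) (n + 1) ≤ padPt b (b + ε) m :=
            (padPt_strictMono hbε).monotone (by omega)
          exact lt_irrefl x (hx'.2.trans_le (this.trans hx.1.le))
    · exact fun x hx => Set.mem_iUnion.2 ⟨0, hx⟩
    · have hsum : ∀ k, ∑ n ∈ Finset.range (k + 1), (J n).length =
          (b - a) + (padPt b (b + ε) k - b) := by
        intro k
        induction k with
        | zero => rw [padPt_zero, sub_self, add_zero, zero_add, Finset.sum_range_one]; rfl
        | succ k ih =>
          rw [Finset.sum_range_succ, ih]
          have : (J (k + 1)).length = padPt b (b + ε) (k + 1) - padPt b (b + ε) k := rfl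
          rw [this]
          ring
      intro η hη
      obtain ⟨M, hM⟩ := padPt_strongLim hbε η hη
      refine ⟨M + 1, fun m hm => ?_⟩
      obtain ⟨k, rfl⟩ : ∃ k, m = k + 1 := ⟨m - 1, by omega⟩
      change |∑ n ∈ Finset.range (k + 1), (J n).length - _| < η
      rw [hsum k]
      convert hM k (by omega) using 2
      ring
  · rintro s ⟨I', hd, hsub, hs⟩
    exact StrongLim.le_of_eventually_le hs (N := 0) fun N _ =>
      (hd.isFam hsub N).sum_length_le hab.le

lemma HasMeasure.eq {a b μ : LC} (hab : a < b) (h : HasMeasure (Set.Icc a b) μ) : μ = b - a :=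
  h.2.unique (hasMeasure_Icc hab).2

/-- The first intervals of an admissible sequence of nearly full total length. -/
lemma Admissible.exists_fam {f : LC → LC} {a b s ε : LC} {I : ℕ → Interval}
    (hI : Admissible f (Set.Icc a b) I) (hs : StrongSum (fun n => (I n).length) s)
    (hε : b - a - s < ε) : ∃ N₀, ∀ N ≥ N₀,
      IsFam (Finset.range N) (fun n => (I n).left) (fun n => (I n).right) a b ∧
      (∀ n, AnOn f (I n).left (I n).right) ∧
      b - a - ∑ n ∈ Finset.range N, ((I n).right - (I n).left) < ε := by
  obtain ⟨N₀, hN₀⟩ := hs (ε - (b - a - s)) (sub_pos.2 hε)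
  refine ⟨N₀, fun N hN => ⟨hI.1.isFam hI.2.1 N, fun n => (hI.2.2 n).anOn, ?_⟩⟩
  have := (abs_lt.1 (hN₀ N hN)).1
  simp only [Interval.length] at this
  linarith

/-- Strong convergence makes the tail of the lengths arbitrarily small, so finitely many intervals
suffice and combinatorial arguments can be made with finite families. -/
lemma IsMeasurableOn.mf {f : LC → LC} {a b : LC} (hab : a < b)
    (h : IsMeasurableOn f (Set.Icc a b)) : MF (AnOn f) a b := by
  obtain ⟨μ, hμ, H⟩ := h
  obtain rfl := hμ.eq hab
  intro ε hε
  obtain ⟨I, s, hI, hs, hlt⟩ := H ε hε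
  obtain ⟨N, hN⟩ := hI.exists_fam hs hlt
  obtain ⟨h1, h2, h3⟩ := hN N le_rfl
  exact ⟨ℕ, _, _, _, h1, fun i _ => h2 i, h3⟩

/-- Admissible sequences for several functions at once. -/
lemma MF.exists_admissible {P : LC → LC → Prop} {a b ε : LC} (hab : a < b) (hP : Hered P)
    (h : MF P a b) (hε : 0 < ε) : ∃ (I : ℕ → Interval) (s : LC), IsDisjointSeq I ∧
      (⋃ n, (I n).carrier) ⊆ Set.Icc a b ∧ (∀ n, P (I n).left (I n).right) ∧
      (∀ n, (I n).carrier = Set.Ioo (I n).left (I n).right) ∧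
      StrongSum (fun n => (I n).length) s ∧ b - a - s < ε := by
  -- A defect below `b - a` guarantees positive total length, which `IsFam.exists_seq` requires.
  obtain ⟨ι, S, c, e, hF, hS, hlt⟩ := h (min ε (b - a)) (lt_min hε (sub_pos.2 hab))
  obtain ⟨I, hd, hI, hcar, hs⟩ := hF.exists_seq (by
    linarith [hlt.trans_le (min_le_right ε (b - a))])
  refine ⟨I, _, hd, Set.iUnion_subset fun n x hx => ?_, fun n => ?_, hcar, hs,
    hlt.trans_le (min_le_left _ _)⟩
  · obtain ⟨i, hi, h1, h2⟩ := hI n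
    have := (I n).subset_Icc hx
    exact ⟨(hF.left i hi).trans (h1.trans this.1), this.2.trans (h2.trans (hF.right i hi))⟩
  · obtain ⟨i, hi, h1, h2⟩ := hI n
    exact hP _ _ _ _ (hS i hi) h1 (I n).lt.le h2

lemma AnOn.isSimpleOn_of_carrier {f : LC → LC} {I : Interval} (h : AnOn f I.left I.right)
    (hc : I.carrier = Set.Ioo I.left I.right) : IsSimpleOn f I := by
  obtain ⟨g, hg, e⟩ := h
  exact isSimpleOn_of_anIcc hg fun x hx => e x (hc ▸ hx)

lemma MF.isMeasurableOn {f : LC → LC} {a b : LC} (hab : a < b) (h : MF (AnOn f) a b) :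
    IsMeasurableOn f (Set.Icc a b) := by
  refine ⟨b - a, hasMeasure_Icc hab, fun ε hε => ?_⟩
  obtain ⟨I, s, hd, hsub, hP, hc, hs, hlt⟩ := h.exists_admissible hab (hered_anOn f) hε
  exact ⟨I, s, ⟨hd, hsub, fun n => (hP n).isSimpleOn_of_carrier (hc n)⟩, hs, hlt⟩

/-! ## Limits at the endpoints -/

lemma exists_near {p q x η : LC} (hpq : p < q) (hx : x ∈ Set.Icc p q) (hη : 0 < η) :
    ∃ y ∈ Set.Ioo p q, 0 < |y - x| ∧ |y - x| < η := by
  rcases hx.2.eq_or_lt with rfl | hlt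
  · have h1 : 0 < min (η / 2) ((x - p) / 2) :=
      lt_min (half_pos hη) (half_pos (sub_pos.2 hpq))
    have h2 := min_le_left (η / 2) ((x - p) / 2)
    have h3 := min_le_right (η / 2) ((x - p) / 2)
    refine ⟨x - min (η / 2) ((x - p) / 2), ⟨by linarith, by linarith⟩, ?_, ?_⟩ <;>
      rw [sub_sub_cancel_left, abs_neg, abs_of_pos h1] <;> linarith
  · have h1 : 0 < min (η / 2) ((q - x) / 2) :=
      lt_min (half_pos hη) (half_pos (sub_pos.2 hlt))
    have h2 := min_le_left (η / 2) ((q - x) / 2)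
    have h3 := min_le_right (η / 2) ((q - x) / 2)
    have h4 := hx.1
    refine ⟨x + min (η / 2) ((q - x) / 2), ⟨by linarith, by linarith⟩, ?_, ?_⟩ <;>
      rw [add_sub_cancel_left, abs_of_pos h1] <;> linarith

lemma LimAt.unique {F G : LC → LC} {p q x L L' : LC} {S : Set LC} (hpq : p < q)
    (hS : Set.Ioo p q ⊆ S) (hx : x ∈ Set.Icc p q) (hF : LimAt F S x L) (hG : LimAt G S x L')
    (h : ∀ y ∈ Set.Ioo p q, F y = G y) : L = L' := by
  by_contra hne
  have hpos : 0 < |L - L'| / 2 := half_pos (abs_pos.2 (sub_ne_zero.2 hne))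
  obtain ⟨η, hη, H⟩ := hF _ hpos
  obtain ⟨η', hη', H'⟩ := hG _ hpos
  obtain ⟨y, hy, h1, h2⟩ := exists_near hpq hx (lt_min hη hη')
  have h3 := H y (hS hy) h1 (h2.trans_le (min_le_left _ _))
  have h4 := H' y (hS hy) h1 (h2.trans_le (min_le_right _ _))
  rw [← h y hy] at h4
  have h5 : |L - L'| ≤ |F y - L'| + |F y - L| := by
    have := abs_sub (F y - L') (F y - L)
    rwa [sub_sub_sub_cancel_left] at this
  linarith

lemma AnIcc.limAt {F : LC → LC} {p q x : LC} {S : Set LC} (hF : AnIcc F p q) (hpq : p < q)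
    (hS : S ⊆ Set.Icc p q) (hx : x ∈ Set.Icc p q) : LimAt F S x (F x) := by
  obtain ⟨f, hf, hq⟩ := hF.exists_deriv hpq
  obtain ⟨L, hL, H⟩ := hq.exists_lipschitz hf
  intro ε hε
  refine ⟨ε / L, div_pos hε hL, fun y hy _ h => ?_⟩
  rw [lt_div_iff₀ hL] at h
  linarith [H x hx y (hS hy)]

lemma ContAt.limAt {f : LC → LC} {x : LC} (h : ContAt f x) (S : Set LC) : LimAt f S x (f x) :=
  fun ε hε => (h ε hε).imp fun _ h => ⟨h.1, fun y _ _ hy => h.2 y hy⟩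

lemma AnIcc.eq_of_contAt {f g : LC → LC} {p q x : LC} (hg : AnIcc g p q) (hpq : p < q)
    (h : ∀ y ∈ Set.Ioo p q, f y = g y) (hx : x ∈ Set.Icc p q) (hf : ContAt f x) : f x = g x :=
  LimAt.unique hpq le_rfl hx (hf.limAt _) (hg.limAt hpq Set.Ioo_subset_Icc_self hx) h

/-! ## The integral of a simple function -/

/-- `F` is a primitive of `f` on `[p, q]`. -/
def Prim (F f : LC → LC) (p q : LC) : Prop :=
  AnIcc F p q ∧ ∀ x ∈ Set.Ioo p q, HasDeriv F (f x) x

/-- The difference of the primitives is one power series with nonnegative derivative, so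
`AnIcc.le_of_deriv_nonneg` applies; differentiability alone would not suffice in this field. With
equal integrands it shows that the integral does not depend on the primitive. -/
lemma Prim.mono {F f G g : LC → LC} {p q : LC} (hF : Prim F f p q) (hG : Prim G g p q)
    (hpq : p ≤ q) (h : ∀ x ∈ Set.Ioo p q, f x ≤ g x) : F q - F p ≤ G q - G p := by
  have := (hG.1.sub hF.1).le_of_deriv_nonneg hpq (f := fun x => g x - f x)
    (fun x hx => (hG.2 x hx).sub (hF.2 x hx)) (fun x hx => sub_nonneg.2 (h x hx))
  linarith

lemma Prim.restrict {F f : LC → LC} {p q p' q' : LC} (h : Prim F f p q) (hp : p ≤ p')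
    (hpq : p' ≤ q') (hq : q' ≤ q) : Prim F f p' q' :=
  ⟨h.1.restrict hp hpq hq, fun x hx => h.2 x (Set.Ioo_subset_Ioo hp hq hx)⟩

lemma prim_const (M : LC) {p q : LC} (hpq : p ≤ q) : Prim (fun x => M * x) (fun _ => M) p q :=
  ⟨(anIcc_id hpq).const_mul M, fun x _ => by simpa using (hasDeriv_id x).const_mul M⟩

lemma AnOn.exists_prim {f : LC → LC} {p q : LC} (hf : AnOn f p q) (hpq : p ≤ q) :
    ∃ F, Prim F f p q := by
  rcases hpq.eq_or_lt with rfl | hlt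
  · exact ⟨_, anIcc_const 0 p p, fun x hx => absurd (hx.1.trans hx.2) (lt_irrefl p)⟩
  · obtain ⟨g, hg, e⟩ := hf
    obtain ⟨F, hF, hq⟩ := hg.exists_antideriv hlt
    exact ⟨F, hF, fun x hx => e x hx ▸ hq.hasDeriv hx⟩

open Classical in
/-- The integral over `[p, q]` of a function that has a primitive there. -/
def sint (f : LC → LC) (p q : LC) : LC :=
  if h : ∃ F, Prim F f p q then h.choose q - h.choose p else 0

lemma Prim.sint_eq {F f : LC → LC} {p q : LC} (h : Prim F f p q) (hpq : p ≤ q) :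
    sint f p q = F q - F p := by
  have hex : ∃ F, Prim F f p q := ⟨F, h⟩
  rw [sint, dif_pos hex]
  exact le_antisymm (hex.choose_spec.mono h hpq fun _ _ => le_rfl)
    (h.mono hex.choose_spec hpq fun _ _ => le_rfl)

lemma sint_mono {f g : LC → LC} {p q : LC} (hf : AnOn f p q) (hg : AnOn g p q) (hpq : p ≤ q)
    (h : ∀ x ∈ Set.Ioo p q, f x ≤ g x) : sint f p q ≤ sint g p q := by
  obtain ⟨F, hF⟩ := hf.exists_prim hpq
  obtain ⟨G, hG⟩ := hg.exists_prim hpq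
  rw [hF.sint_eq hpq, hG.sint_eq hpq]
  exact hF.mono hG hpq h

lemma Prim.sub {F f G g : LC → LC} {p q : LC} (hF : Prim F f p q) (hG : Prim G g p q) :
    Prim (fun x => F x - G x) (fun x => f x - g x) p q :=
  ⟨hF.1.sub hG.1, fun x hx => (hF.2 x hx).sub (hG.2 x hx)⟩

lemma Prim.const_mul {F f : LC → LC} {p q : LC} (hF : Prim F f p q) (c : LC) :
    Prim (fun x => c * F x) (fun x => c * f x) p q :=
  ⟨hF.1.const_mul c, fun x hx => (hF.2 x hx).const_mul c⟩

lemma sint_sub {f g : LC → LC} {p q : LC} (hf : AnOn f p q) (hg : AnOn g p q) (hpq : p ≤ q) :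
    sint (fun x => f x - g x) p q = sint f p q - sint g p q := by
  obtain ⟨F, hF⟩ := hf.exists_prim hpq
  obtain ⟨G, hG⟩ := hg.exists_prim hpq
  rw [hF.sint_eq hpq, hG.sint_eq hpq, (hF.sub hG).sint_eq hpq]
  ring

lemma sint_const_mul {f : LC → LC} {p q : LC} (hf : AnOn f p q) (c : LC) (hpq : p ≤ q) :
    sint (fun x => c * f x) p q = c * sint f p q := by
  obtain ⟨F, hF⟩ := hf.exists_prim hpq
  rw [hF.sint_eq hpq, (hF.const_mul c).sint_eq hpq, mul_sub]

lemma Prim.abs_increment_le {F f : LC → LC} {p q M : LC} (h : Prim F f p q) (hpq : p ≤ q)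
    (hM : ∀ x ∈ Set.Ioo p q, |f x| ≤ M) : |F q - F p| ≤ M * (q - p) := by
  rw [abs_le]
  have h1 := (prim_const (-M) hpq).mono h hpq fun x hx => (abs_le.1 (hM x hx)).1
  have h2 := h.mono (prim_const M hpq) hpq fun x hx => (abs_le.1 (hM x hx)).2
  constructor <;> linarith

lemma AnOn.abs_sint_le {f : LC → LC} {p q M : LC} (hf : AnOn f p q) (hpq : p ≤ q)
    (hM : ∀ x ∈ Set.Ioo p q, |f x| ≤ M) : |sint f p q| ≤ M * (q - p) := by
  obtain ⟨F, hF⟩ := hf.exists_prim hpq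
  rw [hF.sint_eq hpq]
  exact hF.abs_increment_le hpq hM

lemma HasSimpleIntegral.eq_sint {f : LC → LC} {I : Interval} {v : LC}
    (h : HasSimpleIntegral f I v) : v = sint f I.left I.right := by
  obtain ⟨-, F, hF, hd, L, R, hL, hR, rfl⟩ := h
  obtain ⟨G, hG, e⟩ := hF.exists_anIcc
  have hP : Prim G f I.left I.right := by
    refine ⟨hG, fun x hx => (hd x hx).congr (lt_min (sub_pos.2 hx.1) (sub_pos.2 hx.2))
      fun y hy => e y (I.Ioo_subset ?_)⟩
    have h1 := abs_lt.1 (hy.trans_le (min_le_left _ _))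
    have h2 := abs_lt.1 (hy.trans_le (min_le_right _ _))
    constructor <;> linarith
  have e' : ∀ y ∈ Set.Ioo I.left I.right, F y = G y := fun y hy => e y (I.Ioo_subset hy)
  rw [hP.sint_eq I.lt.le,
    LimAt.unique I.lt I.Ioo_subset (Set.left_mem_Icc.2 I.lt.le) hL
      (hG.limAt I.lt I.subset_Icc (Set.left_mem_Icc.2 I.lt.le)) e',
    LimAt.unique I.lt I.Ioo_subset (Set.right_mem_Icc.2 I.lt.le) hR
      (hG.limAt I.lt I.subset_Icc (Set.right_mem_Icc.2 I.lt.le)) e']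

lemma IsSimpleOn.hasSimpleIntegral {f : LC → LC} {I : Interval} (h : IsSimpleOn f I) :
    HasSimpleIntegral f I (sint f I.left I.right) := by
  obtain ⟨F, hF⟩ := h.anOn.exists_prim I.lt.le
  exact ⟨h, F, isSimpleOn_of_anIcc hF.1 fun _ _ => rfl, hF.2, _, _,
    hF.1.limAt I.lt I.subset_Icc (Set.left_mem_Icc.2 I.lt.le),
    hF.1.limAt I.lt I.subset_Icc (Set.right_mem_Icc.2 I.lt.le), hF.sint_eq I.lt.le⟩

/-! ## Sums over families -/

section Families

variable {ι κ : Type*} {S : Finset ι} {c e : ι → LC} {S' : Finset κ} {c' e' : κ → LC}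
  {f : LC → LC} {a b M : LC}

/-- Both `M x + G x` and `M x - G x` are nondecreasing. Applying `IsFam.sum_le` to each of them
bounds the increment of `G` over the gaps by `M` times their total length. -/
lemma IsFam.abs_sub_sum_le (h : IsFam S c e a b) (hab : a ≤ b) {G : LC → LC}
    (hG : ∀ x y, a ≤ x → x ≤ y → y ≤ b → |G y - G x| ≤ M * (y - x)) :
    |G b - G a - ∑ i ∈ S, (G (e i) - G (c i))| ≤ M * (b - a - ∑ i ∈ S, (e i - c i)) := by
  have h1 := h.sum_le hab (H := fun x => M * x + G x) fun x hx y hy hxy => by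
    have := (abs_le.1 (hG x y hx.1 hxy hy.2)).1
    simp only
    linarith
  have h2 := h.sum_le hab (H := fun x => M * x - G x) fun x hx y hy hxy => by
    have := (abs_le.1 (hG x y hx.1 hxy hy.2)).2
    simp only
    linarith
  have e1 : ∑ i ∈ S, (M * e i + G (e i) - (M * c i + G (c i))) =
      M * ∑ i ∈ S, (e i - c i) + ∑ i ∈ S, (G (e i) - G (c i)) := by
    rw [Finset.mul_sum, ← Finset.sum_add_distrib]
    exact Finset.sum_congr rfl fun i _ => by ring
  have e2 : ∑ i ∈ S, (M * e i - G (e i) - (M * c i - G (c i))) =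
      M * ∑ i ∈ S, (e i - c i) - ∑ i ∈ S, (G (e i) - G (c i)) := by
    rw [Finset.mul_sum, ← Finset.sum_sub_distrib]
    exact Finset.sum_congr rfl fun i _ => by ring
  rw [e1] at h1
  rw [e2] at h2
  rw [abs_le]
  constructor <;> linarith

lemma IsFam.abs_sint_sub_sum_le (h : IsFam S c e a b) (hab : a ≤ b) (hf : AnOn f a b)
    (hM : ∀ x ∈ Set.Ioo a b, |f x| ≤ M) :
    |sint f a b - ∑ i ∈ S, sint f (c i) (e i)| ≤ M * (b - a - ∑ i ∈ S, (e i - c i)) := by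
  obtain ⟨F, hF⟩ := hf.exists_prim hab
  have h1 := h.abs_sub_sum_le hab (M := M) (G := F) fun x y hx hxy hy =>
    (hF.restrict hx hxy hy).abs_increment_le hxy fun z hz => hM z (Set.Ioo_subset_Ioo hx hy hz)
  rw [hF.sint_eq hab, Finset.sum_congr rfl fun i hi =>
    (hF.restrict (h.left i hi) (h.le i hi) (h.right i hi)).sint_eq (h.le i hi)]
  exact h1

lemma IsFam.abs_sum_sub_sum_overlapPairs_le (h : IsFam S c e a b) (h' : IsFam S' c' e' a b)
    (hf : ∀ i ∈ S, AnOn f (c i) (e i)) (hM : ∀ x ∈ Set.Icc a b, |f x| ≤ M) :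
    |∑ i ∈ S, sint f (c i) (e i) -
        ∑ i ∈ S, ∑ j ∈ overlapping S' c' e' (c i) (e i),
          sint f (max (c i) (c' j)) (min (e i) (e' j))| ≤
      M * (∑ i ∈ S, (e i - c i) - ∑ i ∈ S, ∑ j ∈ overlapping S' c' e' (c i) (e i),
        (min (e i) (e' j) - max (c i) (c' j))) := by
  rw [← Finset.sum_sub_distrib, ← Finset.sum_sub_distrib, Finset.mul_sum]
  refine (Finset.abs_sum_le_sum_abs _ _).trans (Finset.sum_le_sum fun i hi => ?_)
  exact (h'.restrict (c i) (e i)).abs_sint_sub_sum_le (h.le i hi) (hf i hi) fun x hx =>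
    hM x ⟨(h.left i hi).trans hx.1.le, hx.2.le.trans (h.right i hi)⟩

/-- Both sums are compared with the sum over the pairwise intersections. What is lost lies in one
family but not in the other, and its length is bounded by the two defects. -/
lemma IsFam.abs_sum_sub_sum_le (h : IsFam S c e a b) (h' : IsFam S' c' e' a b) (hab : a ≤ b)
    (hf : ∀ i ∈ S, AnOn f (c i) (e i)) (hf' : ∀ i ∈ S', AnOn f (c' i) (e' i)) (hM0 : 0 ≤ M)
    (hM : ∀ x ∈ Set.Icc a b, |f x| ≤ M) :
    |∑ i ∈ S, sint f (c i) (e i) - ∑ i ∈ S', sint f (c' i) (e' i)| ≤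
      M * ((b - a - ∑ i ∈ S, (e i - c i)) + (b - a - ∑ i ∈ S', (e' i - c' i))) := by
  have h1 := h.abs_sum_sub_sum_overlapPairs_le h' hf hM
  have h2 := h'.abs_sum_sub_sum_overlapPairs_le h hf' hM
  have swap : ∀ g : LC → LC → LC, ∑ j ∈ S', ∑ i ∈ overlapping S c e (c' j) (e' j),
      g (max (c' j) (c i)) (min (e' j) (e i)) =
      ∑ i ∈ S, ∑ j ∈ overlapping S' c' e' (c i) (e i),
        g (max (c i) (c' j)) (min (e i) (e' j)) := fun g => by
    rw [Finset.sum_comm' (t' := S) (s' := fun i => overlapping S' c' e' (c i) (e i))]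
    · exact Finset.sum_congr rfl fun i _ => Finset.sum_congr rfl fun j _ => by
        rw [max_comm, min_comm]
    · intro j i
      rw [mem_overlapping, mem_overlapping, max_comm (c i), min_comm (e i)]
      tauto
  rw [swap (sint f), swap fun x y => y - x] at h2
  have h3 := h.le_sum_inter h' hab
  rw [overlapPairs, Finset.sum_sigma] at h3
  set X := ∑ i ∈ S, ∑ j ∈ overlapping S' c' e' (c i) (e i),
    (min (e i) (e' j) - max (c i) (c' j))
  set Y := ∑ i ∈ S, ∑ j ∈ overlapping S' c' e' (c i) (e i),
    sint f (max (c i) (c' j)) (min (e i) (e' j))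
  set A := ∑ i ∈ S, (e i - c i)
  set B := ∑ j ∈ S', (e' j - c' j)
  have h4 : M * (A - X) + M * (B - X) ≤ M * ((b - a - A) + (b - a - B)) := by
    rw [← mul_add]
    exact mul_le_mul_of_nonneg_left (by linarith) hM0
  refine (abs_sub_le _ Y _).trans ?_
  rw [abs_sub_comm Y]
  linarith

end Families

/-! ## Existence and monotonicity of integrals -/

/-- A bounded measurable function on `[a, b]` has an integral, which is approximated by the sums
over finite families. -/
theorem exists_hasIntegral {f : LC → LC} {a b M : LC} (hab : a < b) (hf : MF (AnOn f) a b)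
    (hM : ∀ x ∈ Set.Icc a b, |f x| ≤ M) : ∃ v, HasIntegral f (Set.Icc a b) v ∧
      ∀ ε, 0 < ε → ∃ η, 0 < η ∧ ∀ (ι : Type) (S : Finset ι) (c e : ι → LC), IsFam S c e a b →
        (∀ i ∈ S, AnOn f (c i) (e i)) → b - a - ∑ i ∈ S, (e i - c i) < η →
          |∑ i ∈ S, sint f (c i) (e i) - v| < ε := by
  obtain ⟨K, hK, hKM⟩ : ∃ K, 0 < K ∧ ∀ x ∈ Set.Icc a b, |f x| ≤ K :=
    ⟨max M 1, lt_max_of_lt_right one_pos, fun x hx => (hM x hx).trans (le_max_left _ _)⟩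
  -- Families with defects below `d ^ m` have Cauchy sums, since two of them differ by at most `K`
  -- times the sum of their defects. The same comparison later shows that every family of small
  -- defect has a sum near the limit.
  choose ι S c e hF hA hs using fun m : ℕ => hf (dd ^ m) (pow_pos dd_pos m)
  have hcmp : ∀ m n, m ≤ n → |∑ i ∈ S n, sint f (c n i) (e n i) -
      ∑ i ∈ S m, sint f (c m i) (e m i)| ≤ K * (2 * dd ^ m) := fun m n hmn => by
    refine ((hF n).abs_sum_sub_sum_le (hF m) hab.le (hA n) (hA m) hK.le hKM).trans ?_
    have h1 : dd ^ n ≤ dd ^ m := by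
      rcases Nat.eq_zero_or_pos (n - m) with h | h
      · rw [show n = m by omega]
      · obtain ⟨l, rfl⟩ := Nat.exists_eq_add_of_le hmn
        rw [pow_add]
        exact mul_le_of_le_one_right (pow_pos dd_pos m).le (dd_pow_lt_one (by omega)).le
    exact mul_le_mul_of_nonneg_left (by linarith [hs m, hs n]) hK.le
  obtain ⟨l₀, hl₀⟩ := exists_ordGE K
  obtain ⟨v, hv⟩ := complete (s := fun m => ∑ i ∈ S m, sint f (c m i) (e m i)) fun l => by
    obtain ⟨N, hN⟩ := exists_nat_gt (l - l₀)
    refine ⟨N, fun m hm => ?_⟩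
    refine OrdGE.of_le ?_ (hcmp m (m + 1) (by omega))
    have h2 : OrdGE (2 : LC) 0 := by exact_mod_cast OrdGE.natCast 2
    refine (hl₀.mul (h2.mul (ordGE_dd_pow m))).mono ?_
    have : (N : ℚ) ≤ m := by exact_mod_cast hm
    linarith
  have hv' := strongLim_of_ordGE hv
  have key : ∀ ε, 0 < ε → ∃ η, 0 < η ∧ ∀ (ι : Type) (S : Finset ι) (c e : ι → LC),
      IsFam S c e a b → (∀ i ∈ S, AnOn f (c i) (e i)) → b - a - ∑ i ∈ S, (e i - c i) < η →
        |∑ i ∈ S, sint f (c i) (e i) - v| < ε := by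
    intro ε hε
    have h4K : 0 < 4 * K := mul_pos (by norm_num) hK
    have hη : 0 < ε / (4 * K) := div_pos hε h4K
    refine ⟨ε / (4 * K), hη, fun ι' T c' e' hT hAT hTs => ?_⟩
    obtain ⟨N₁, hN₁⟩ := exists_dd_pow_lt hη
    obtain ⟨N₂, hN₂⟩ := hv' (ε / 2) (half_pos hε)
    have h1 := hN₁ (max N₁ N₂) (le_max_left _ _)
    have h2 := hN₂ (max N₁ N₂) (le_max_right _ _)
    have h3 := hT.abs_sum_sub_sum_le (hF (max N₁ N₂)) hab.le hAT (hA _) hK.le hKM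
    have h5 : K * (ε / (4 * K) + ε / (4 * K)) = ε / 2 := by field_simp; ring
    have h6 := mul_le_mul_of_nonneg_left (add_le_add hTs.le ((hs (max N₁ N₂)).trans h1).le) hK.le
    refine (abs_sub_le _ (∑ i ∈ S (max N₁ N₂), sint f (c (max N₁ N₂) i) (e (max N₁ N₂) i)) _).trans_lt
      ?_
    linarith
  refine ⟨v, ⟨hf.isMeasurableOn hab, b - a, hasMeasure_Icc hab, fun ε hε => ?_⟩, key⟩
  obtain ⟨η, hη, H⟩ := key (ε / 2) (half_pos hε)
  refine ⟨η, hη, fun I s hI hIs hlt => ?_⟩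
  obtain ⟨N₀, hN₀⟩ := hI.exists_fam hIs hlt
  have hAI := (hN₀ N₀ le_rfl).2.1
  obtain ⟨w, hw⟩ := exists_strongSum (u := fun n => sint f (I n).left (I n).right) fun l => by
    obtain ⟨N, hN⟩ := hIs.ordGE (l - l₀)
    refine ⟨N, fun m hm => ?_⟩
    have hb := Interval.bounds ((Set.subset_iUnion _ m).trans hI.2.1)
    have h1 := (hAI m).abs_sint_le (I m).lt.le (M := K) fun x hx =>
      hKM x ⟨hb.1.trans hx.1.le, hx.2.le.trans hb.2⟩
    exact ((hl₀.mul (hN m hm)).of_le h1).mono (by linarith)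
  refine ⟨_, w, fun n => (hI.2.2 n).hasSimpleIntegral, hw, ?_⟩
  have hb : ∀ m ≥ N₀, |∑ n ∈ Finset.range m, sint f (I n).left (I n).right - v| < ε / 2 :=
    fun m hm => H ℕ _ _ _ (hN₀ m hm).1 (fun n _ => hAI n) (hN₀ m hm).2.2
  have h1 : w ≤ v + ε / 2 := StrongLim.le_of_eventually_le hw (N := N₀) fun m hm => by
    linarith [(abs_lt.1 (hb m hm)).2]
  have h2 : v - ε / 2 ≤ w := StrongLim.ge_of_eventually_ge hw (N := N₀) fun m hm => by
    linarith [(abs_lt.1 (hb m hm)).1]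
  rw [abs_lt]
  constructor <;> linarith

lemma StrongLim.le {s t : ℕ → LC} {x y : LC} (hs : StrongLim s x) (ht : StrongLim t y)
    (h : ∀ m, s m ≤ t m) : x ≤ y := by
  by_contra hlt
  push Not at hlt
  obtain ⟨N, hN⟩ := hs ((x - y) / 2) (half_pos (sub_pos.2 hlt))
  obtain ⟨N', hN'⟩ := ht ((x - y) / 2) (half_pos (sub_pos.2 hlt))
  have h1 := (abs_lt.1 (hN (max N N') (le_max_left _ _))).1
  have h2 := (abs_lt.1 (hN' (max N N') (le_max_right _ _))).2
  linarith [h (max N N')]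

/-- Intersecting families for `f` and for `g` yields a sequence admissible for both, on which the
comparison is made interval by interval with `sint_mono`. -/
theorem HasIntegral.mono {f g : LC → LC} {a b v w : LC} (hab : a < b)
    (hf : HasIntegral f (Set.Icc a b) v) (hg : HasIntegral g (Set.Icc a b) w)
    (h : ∀ x ∈ Set.Icc a b, f x ≤ g x) : v ≤ w := by
  refine le_of_forall_pos_le_add fun ε hε => ?_
  obtain ⟨hfm, μ, hμ, H⟩ := hf
  obtain ⟨hgm, μ', hμ', H'⟩ := hg
  obtain ⟨η, hη, H⟩ := H (ε / 2) (half_pos hε)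
  obtain ⟨η', hη', H'⟩ := H' (ε / 2) (half_pos hε)
  rw [hμ.eq hab] at H
  rw [hμ'.eq hab] at H'
  obtain ⟨I, s, hd, hsub, hP, hc, hs, hlt⟩ :=
    ((hfm.mf hab).and hab.le (hgm.mf hab) (hered_anOn f) (hered_anOn g)).exists_admissible hab
      (fun _ _ _ _ hP h1 h2 h3 => ⟨hP.1.restrict h1 h2 h3, hP.2.restrict h1 h2 h3⟩)
      (lt_min hη hη')
  obtain ⟨u, x, hu, hx, hxv⟩ := H I s
    ⟨hd, hsub, fun n => (hP n).1.isSimpleOn_of_carrier (hc n)⟩ hs (hlt.trans_le (min_le_left _ _))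
  obtain ⟨u', x', hu', hx', hxv'⟩ := H' I s
    ⟨hd, hsub, fun n => (hP n).2.isSimpleOn_of_carrier (hc n)⟩ hs (hlt.trans_le (min_le_right _ _))
  have h1 : x ≤ x' := StrongLim.le hx hx' fun m => Finset.sum_le_sum fun n _ => by
    rw [(hu n).eq_sint, (hu' n).eq_sint]
    exact sint_mono (hP n).1 (hP n).2 (I n).lt.le fun z hz =>
      h z (hsub (Set.mem_iUnion.2 ⟨n, (I n).Ioo_subset hz⟩))
  have h2 := (abs_lt.1 hxv).1
  have h3 := (abs_lt.1 hxv').2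
  linarith

/-! ## Global consequences of local properties -/

/-- Continuity gives only local bounds here. Analyticity up to small total length supplies what
`cousin` needs to make them global. -/
lemma bounded_of_contAt {f : LC → LC} {a b : LC} (hab : a ≤ b)
    (hf : ∀ x ∈ Set.Icc a b, ContAt f x) (hmf : ∀ x y, a ≤ x → x < y → y ≤ b → MF (AnOn f) x y) :
    ∃ K, ∀ x ∈ Set.Icc a b, |f x| ≤ K := by
  refine cousin (T := fun x y => ∃ K, ∀ z ∈ Set.Icc x y, |f z| ≤ K) hab ?_ ?_ ?_
  · rintro x y z - - - - ⟨K, hK⟩ ⟨K', hK'⟩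
    refine ⟨max K K', fun t ht => ?_⟩
    rcases le_total t y with h | h
    · exact (hK t ⟨ht.1, h⟩).trans (le_max_left _ _)
    · exact (hK' t ⟨h, ht.2⟩).trans (le_max_right _ _)
  · intro p hp hp'
    obtain ⟨η, hη, H⟩ := hf p ⟨hp, hp'⟩ 1 one_pos
    refine ⟨η, hη, fun x y _ hxp hpy _ hxy => ⟨|f p| + 1, fun z hz => ?_⟩⟩
    have h1 := H z (abs_lt.2 ⟨by linarith [hz.1], by linarith [hz.2]⟩)
    have h2 := abs_sub_abs_le_abs_sub (f z) (f p)
    linarith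
  · refine fun x y hx hxy hy => (hmf x y hx hxy hy).imp fun p q _ hpq _ hA => ?_
    obtain ⟨g, hg, e⟩ := hA
    obtain ⟨K, -, hK⟩ := hg.bounded
    -- Analyticity on the piece concerns its interior only, so the endpoint values enter the bound
    -- separately.
    refine ⟨max K (max |f p| |f q|), fun z hz => ?_⟩
    rcases hz.1.eq_or_lt with rfl | h1
    · exact (le_max_left _ _).trans (le_max_right _ _)
    rcases hz.2.eq_or_lt with rfl | h2
    · exact (le_max_right _ _).trans (le_max_right _ _)
    · rw [e z ⟨h1, h2⟩]
      exact (hK z hz).trans (le_max_left _ _)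

/-- The mean value inequality fails in general over this field, so it is assumed on pieces that
cover every subinterval up to small length and globalised by `cousin`. The strict inequality `M < C`
leaves room for the local Lipschitz bound at each point. -/
lemma abs_sub_le_of_hasDeriv {G g : LC → LC} {a b M C : LC} (hab : a ≤ b) (hMC : M < C)
    (hd : ∀ x ∈ Set.Icc a b, HasDeriv G (g x) x) (hM : ∀ x ∈ Set.Icc a b, |g x| ≤ M)
    (hmf : ∀ x y, a ≤ x → x < y → y ≤ b → MF (fun p q => |G q - G p| ≤ C * (q - p)) x y) :
    |G b - G a| ≤ C * (b - a) := by
  refine cousin (T := fun x y => |G y - G x| ≤ C * (y - x)) hab ?_ ?_ hmf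
  · intro x y z _ _ _ _ h1 h2
    have := abs_sub_le (G z) (G y) (G x)
    linarith
  · intro p hp hp'
    obtain ⟨η, hη, H⟩ := (hd p ⟨hp, hp'⟩).lipschitzAt ((hM p ⟨hp, hp'⟩).trans_lt hMC)
    refine ⟨η, hη, fun x y _ hxp hpy _ hxy => ?_⟩
    have h1 := H y (abs_lt.2 ⟨by linarith, by linarith⟩)
    have h2 := H x (abs_lt.2 ⟨by linarith, by linarith⟩)
    rw [abs_of_nonneg (sub_nonneg.2 hpy)] at h1
    rw [abs_sub_comm, abs_sub_comm x, abs_of_nonneg (sub_nonneg.2 hxp)] at h2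
    have := abs_sub_le (G y) (G p) (G x)
    linarith

/-! ## Real power series at infinitesimal scale -/

/-- The powers of `R` have orders growing linearly, so at any given exponent only finitely many
terms are nonzero. The real coefficients may therefore grow arbitrarily fast, as Taylor coefficients
of a smooth function can. -/
lemma nice_ofReal_mul_pow {R : LC} (hR : IsInfinitesimal R) (p : ℕ → ℝ) :
    Nice fun n => ofReal (p n) * R ^ n := by
  obtain ⟨h0, hc⟩ := isInfinitesimal_iff.1 hR
  obtain ⟨κ, hκ, hRκ⟩ := OrdGE.of_infinitesimal h0 hc
  obtain ⟨S, hS, -, hSR, -⟩ := exists_suppIn h0 h0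
  refine ⟨hS.subset ?_, fun q B => ?_⟩
  · rintro x ⟨i, hi⟩
    exact ((SuppIn.ofReal S (p i)).mul (hSR.pow i)) x hi
  · obtain ⟨N, hN⟩ := exists_nat_gt (q / κ)
    rw [div_lt_iff₀ hκ] at hN
    refine ⟨∑ m ∈ Finset.range N, |(ofReal (p m) * R ^ m).coeff q| * ((m : ℝ) + 1) ^ B,
      fun m => ?_⟩
    by_cases hm : m < N
    · exact Finset.single_le_sum
        (f := fun m : ℕ => |(ofReal (p m) * R ^ m).coeff q| * ((m : ℝ) + 1) ^ B)
        (fun i _ => by positivity) (Finset.mem_range.2 hm)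
    · have h1 : (N : ℚ) * κ ≤ m * κ :=
        mul_le_mul_of_nonneg_right (by exact_mod_cast not_lt.1 hm) hκ.le
      rw [coeff_ofReal_mul, hRκ.pow m q (hN.trans_le h1), MulZeroClass.mul_zero, abs_zero, zero_mul]
      exact Finset.sum_nonneg fun i _ => by positivity

/-- The sum at `x` of the power series with real coefficients `p` centred at `x₀`, for
`|x - x₀| ≤ R`. -/
def rser (R x₀ : LC) (p : ℕ → ℝ) (x : LC) : LC := ev (fun n => ofReal (p n) * R ^ n) ((x - x₀) / R)

lemma HasWSum.cons {t : ℕ → LC} {l : LC} (h : HasWSum (fun n => t (n + 1)) l) :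
    HasWSum t (t 0 + l) := by
  have h1 : HasWSum (fun n => if n = 0 then 0 else t n) l :=
    HasWSum.of_succ (if_pos rfl) (h.congr fun n => (if_neg (Nat.succ_ne_zero n)).symm)
  have h2 : HasWSum (fun n => if n = 0 then t 0 else 0) (t 0) := by
    have := hasWSum_of_finset (t := fun n => if n = 0 then t 0 else 0) {0} fun i hi =>
      if_neg (by simpa using hi)
    simpa using this
  refine (h2.add h1).congr fun n => ?_
  rcases Nat.eq_zero_or_pos n with rfl | hn
  · simp
  · simp [hn.ne']

section RealSeries

variable {R x₀ : LC}

lemma disc_div (hR0 : 0 < R) {x : LC} (hx : x ∈ Set.Icc (x₀ - R) (x₀ + R)) : Disc ((x - x₀) / R) := by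
  refine disc_of_abs_le ?_
  rw [abs_div, abs_of_pos hR0, div_le_one hR0, abs_le]
  constructor <;> linarith [hx.1, hx.2]

lemma rser_hasWSum (hR0 : 0 < R) (hR : IsInfinitesimal R) (p : ℕ → ℝ)
    {x : LC} (hx : x ∈ Set.Icc (x₀ - R) (x₀ + R)) :
    HasWSum (fun n => ofReal (p n) * (x - x₀) ^ n) (rser R x₀ p x) := by
  refine ((nice_ofReal_mul_pow hR p).hasWSum (disc_div hR0 hx)).congr fun n => ?_
  rw [mul_assoc, ← mul_pow, mul_div_cancel₀ _ hR0.ne']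

lemma anIcc_rser (hR0 : 0 < R) (hR : IsInfinitesimal R) (p : ℕ → ℝ) :
    AnIcc (rser R x₀ p) (x₀ - R) (x₀ + R) :=
  anIcc_of_disc (nice_ofReal_mul_pow hR p) hR0.ne' (by linarith) (by rw [abs_of_pos hR0])
    (by rw [abs_of_pos hR0]) fun _ _ => rfl

lemma hasDeriv_rser (hR0 : 0 < R) (hR : IsInfinitesimal R) (p : ℕ → ℝ)
    {p' : ℕ → ℝ} (hp : ∀ n, p' n = (n + 1) * p (n + 1)) {x : LC}
    (hx : x ∈ Set.Ioo (x₀ - R) (x₀ + R)) : HasDeriv (rser R x₀ p) (rser R x₀ p' x) x := by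
  have hN := nice_ofReal_mul_pow hR p
  have hN' := nice_ofReal_mul_pow hR p'
  obtain ⟨K, hK, H⟩ := hN.ev_quad
  refine QuadDeriv.hasDeriv (f := rser R x₀ p') ⟨K / R ^ 2, div_pos hK (pow_pos hR0 2), ?_⟩ hx
  intro y hy z hz
  have h1 := H _ _ (disc_div hR0 hy) (disc_div hR0 hz)
  have h2 : dseq (fun n => ofReal (p n) * R ^ n) = fun n => R * (ofReal (p' n) * R ^ n) := by
    funext n
    rw [dseq, hp n, ofReal_mul, pow_succ]
    have : (((n + 1 : ℕ) : LC)) = ofReal ((n : ℝ) + 1) := by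
      rw [← ofReal_natCast]; push_cast; rfl
    rw [this]
    ring
  have h3 : (z - x₀) / R - (y - x₀) / R = (z - y) / R := by rw [← sub_div]; ring
  rw [h2, ev_mul_left hN' R (disc_div hR0 hy), h3] at h1
  have h4 : R * ev (fun n => ofReal (p' n) * R ^ n) ((y - x₀) / R) * ((z - y) / R) =
      rser R x₀ p' y * (z - y) := by
    rw [rser]; field_simp
  rw [h4, abs_div, abs_of_pos hR0, div_pow] at h1
  refine h1.trans_eq ?_
  ring

lemma rser_eq (hR0 : 0 < R) (hR : IsInfinitesimal R) (p : ℕ → ℝ)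
    {x : LC} (hx : x ∈ Set.Icc (x₀ - R) (x₀ + R)) :
    rser R x₀ p x = ofReal (p 0) + (x - x₀) * rser R x₀ (fun n => p (n + 1)) x := by
  refine (rser_hasWSum hR0 hR p hx).unique ?_
  have h := ((rser_hasWSum hR0 hR (fun n => p (n + 1)) hx).mul_left (x - x₀)).congr
    (t' := fun n => ofReal (p (n + 1)) * (x - x₀) ^ (n + 1)) fun n => by rw [pow_succ]; ring
  simpa using HasWSum.cons (t := fun n => ofReal (p n) * (x - x₀) ^ n) h

lemma sub_infinitesimal (hR : IsInfinitesimal R) {x : LC} (hx : x ∈ Set.Icc (x₀ - R) (x₀ + R)) :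
    IsInfinitesimal (x - x₀) := fun y hy =>
  (abs_le.2 ⟨by linarith [hx.1], by linarith [hx.2]⟩ : |x - x₀| ≤ R).trans
    ((le_abs_self R).trans (hR y hy))

lemma rser_ordGE (hR0 : 0 < R) (hR : IsInfinitesimal R) (p : ℕ → ℝ)
    {x : LC} (hx : x ∈ Set.Icc (x₀ - R) (x₀ + R)) : OrdGE (rser R x₀ p x) 0 :=
  (rser_hasWSum hR0 hR p hx).ordGE fun n => (OrdGE.ofReal _).mul_zero
    ((isInfinitesimal_iff.1 (sub_infinitesimal hR hx)).1.pow_zero n)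

/-- Every point of the ball has an offset of order at least that of `R`, which makes the
infinitesimal bound uniform. Halving the exponent turns an order estimate into an inequality. -/
lemma exists_rser_sub_le (hR0 : 0 < R) (hR : IsInfinitesimal R) (p : ℕ → ℝ) :
    ∃ κ > 0, ∀ x ∈ Set.Icc (x₀ - R) (x₀ + R),
    |rser R x₀ p x - ofReal (p 0)| ≤ mono 1 κ := by
  obtain ⟨h0, hc⟩ := isInfinitesimal_iff.1 hR
  obtain ⟨κ, hκ, hRκ⟩ := OrdGE.of_infinitesimal h0 hc
  refine ⟨κ / 2, half_pos hκ, fun x hx => ?_⟩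
  rw [rser_eq hR0 hR p hx, add_sub_cancel_left]
  have h1 : OrdGE (x - x₀) κ :=
    hRκ.of_le (abs_le.2 ⟨by linarith [hx.1], by linarith [hx.2]⟩)
  refine ((h1.mul (rser_ordGE hR0 hR _ hx)).abs_lt (m := κ / 2) ?_).le
  linarith

lemma rser_pos (hR0 : 0 < R) (hR : IsInfinitesimal R) (p : ℕ → ℝ)
    (hp : 0 < p 0) {x : LC} (hx : x ∈ Set.Icc (x₀ - R) (x₀ + R)) :
    0 < rser R x₀ p x := by
  refine pos_of_leading (rser_ordGE hR0 hR p hx) ?_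
  obtain ⟨κ, hκ, h⟩ := exists_rser_sub_le hR0 hR p (x₀ := x₀)
  have h1 := ((OrdGE.mono_self 1 κ).of_le (h x hx)) 0 hκ
  rw [coeff_sub, coeff_ofReal_zero, sub_eq_zero] at h1
  rwa [h1]

lemma rser_neg (hR0 : 0 < R) (hR : IsInfinitesimal R) (p : ℕ → ℝ)
    {x : LC} (hx : x ∈ Set.Icc (x₀ - R) (x₀ + R)) :
    rser R x₀ (fun n => -p n) x = -rser R x₀ p x :=
  (rser_hasWSum hR0 hR (fun n => -p n) hx).unique
    ((rser_hasWSum hR0 hR p hx).neg.congr fun n => by rw [ofReal_neg, neg_mul])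

lemma rser_eq_pow_mul (hR0 : 0 < R) (hR : IsInfinitesimal R) (p : ℕ → ℝ)
    {m : ℕ} (hm : ∀ i < m, p i = 0) {x : LC}
    (hx : x ∈ Set.Icc (x₀ - R) (x₀ + R)) :
    rser R x₀ p x = (x - x₀) ^ m * rser R x₀ (fun n => p (n + m)) x := by
  induction m generalizing p with
  | zero => simp
  | succ m ih =>
    rw [rser_eq hR0 hR p hx, hm 0 (Nat.succ_pos m), ofReal_zero, zero_add,
      ih (fun n => p (n + 1)) fun i hi => hm (i + 1) (by omega), pow_succ', mul_assoc]
    congr 4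

/-- `g` does not change sign on `S`. -/
def ConstSign (g : LC → LC) (S : Set LC) : Prop := (∀ x ∈ S, 0 ≤ g x) ∨ ∀ x ∈ S, g x ≤ 0

/-- A power series with real coefficients does not change sign on each side of its centre. -/
lemma constSign_rser (hR0 : 0 < R) (hR : IsInfinitesimal R) (p : ℕ → ℝ) :
    ConstSign (rser R x₀ p) (Set.Icc x₀ (x₀ + R)) ∧
    ConstSign (rser R x₀ p) (Set.Icc (x₀ - R) x₀) := by
  by_cases h0 : ∀ i, p i = 0
  · have : ∀ x ∈ Set.Icc (x₀ - R) (x₀ + R), rser R x₀ p x = 0 := fun x hx =>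
      ordGE_eq_zero fun l => (rser_hasWSum hR0 hR p hx).ordGE fun i => by
        rw [h0 i, ofReal_zero, zero_mul]; exact OrdGE.zero l
    exact ⟨Or.inl fun x hx => (this x ⟨by linarith [hx.1], hx.2⟩).ge,
      Or.inl fun x hx => (this x ⟨hx.1, by linarith [hx.2]⟩).ge⟩
  · push Not at h0
    classical
    have hmin : ∀ i < Nat.find h0, p i = 0 := fun i hi => not_not.1 (Nat.find_min h0 hi)
    have hne := Nat.find_spec h0
    set m := Nat.find h0
    -- After the factor `(x - x₀) ^ m` belonging to the first nonzero coefficient is removed, the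
    -- remaining series has a nonzero real constant term and hence one sign on the whole ball. Only
    -- the parity of `m` distinguishes the two sides.
    have key : ConstSign (rser R x₀ fun n => p (n + m)) (Set.Icc (x₀ - R) (x₀ + R)) := by
      rcases lt_or_gt_of_ne hne with h | h
      · refine Or.inr fun x hx => ?_
        have h1 := rser_pos hR0 hR (fun n => -p (n + m)) (by simpa using h) hx
        rw [rser_neg hR0 hR (fun n => p (n + m)) hx] at h1
        linarith
      · exact Or.inl fun x hx => (rser_pos hR0 hR (fun n => p (n + m)) (by simpa using h) hx).le
    have comb : ∀ T ⊆ Set.Icc (x₀ - R) (x₀ + R), ConstSign (fun x => (x - x₀) ^ m) T →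
        ConstSign (rser R x₀ p) T := by
      intro T hT hs
      have e : ∀ x ∈ T, rser R x₀ p x = _ := fun x hx => rser_eq_pow_mul hR0 hR p hmin (hT hx)
      rcases key with h | h <;> rcases hs with h' | h'
      · exact Or.inl fun x hx => e x hx ▸ mul_nonneg (h' x hx) (h x (hT hx))
      · exact Or.inr fun x hx => e x hx ▸ mul_nonpos_of_nonpos_of_nonneg (h' x hx) (h x (hT hx))
      · exact Or.inr fun x hx => e x hx ▸ mul_nonpos_of_nonneg_of_nonpos (h' x hx) (h x (hT hx))
      · exact Or.inl fun x hx => e x hx ▸ mul_nonneg_of_nonpos_of_nonpos (h' x hx) (h x (hT hx))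
    refine ⟨comb _ (Set.Icc_subset_Icc_left (by linarith))
      (Or.inl fun x hx => pow_nonneg (sub_nonneg.2 hx.1) m),
      comb _ (Set.Icc_subset_Icc_right (by linarith)) ?_⟩
    rcases m.even_or_odd with he | ho
    · exact Or.inl fun x _ => he.pow_nonneg _
    · exact Or.inr fun x hx => ho.pow_nonpos (sub_nonpos.2 hx.2)

end RealSeries

/-! ## Standard parts -/

lemma st_eq_coe_iff {x : LC} {s : ℝ} : st x = s ↔ IsInfinitesimal (x - ofReal s) := by
  constructor
  · intro h y hy
    rw [abs_le]
    constructor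
    · by_contra hlt
      push Not at hlt
      have h1 : st x ≤ ((s - y : ℝ) : EReal) := sInf_le ⟨s - y, by
        rw [ofReal_sub]; linarith, rfl⟩
      rw [h, EReal.coe_le_coe_iff] at h1
      linarith
    · have h1 : st x < ((s + y : ℝ) : EReal) := by rw [h, EReal.coe_lt_coe_iff]; linarith
      obtain ⟨e, ⟨z, hz, rfl⟩, hlt⟩ := sInf_lt_iff.1 h1
      have h2 := ofReal_lt_ofReal.2 (EReal.coe_lt_coe_iff.1 hlt)
      rw [ofReal_add] at h2
      linarith
  · intro h
    refine le_antisymm ?_ (le_sInf ?_)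
    · refine le_of_forall_gt fun c hc => ?_
      obtain ⟨z, h1, h2⟩ := EReal.lt_iff_exists_real_btwn.1 hc
      have h3 := EReal.coe_lt_coe_iff.1 h1
      refine lt_of_le_of_lt (sInf_le ⟨z, ?_, rfl⟩) h2
      have h4 := (abs_le.1 (h (z - s) (sub_pos.2 h3))).2
      rw [ofReal_sub] at h4
      linarith
    · rintro e ⟨z, hz, rfl⟩
      rw [EReal.coe_le_coe_iff]
      by_contra hlt
      push Not at hlt
      have h1 := (abs_le.1 (h ((s - z) / 2) (by linarith))).1
      have h2 : ofReal z < ofReal (s - (s - z) / 2) := ofReal_lt_ofReal.2 (by linarith)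
      rw [ofReal_sub] at h2
      linarith

lemma st_eq_coe_iff_coeff {x : LC} {s : ℝ} : st x = s ↔ OrdGE x 0 ∧ x.coeff 0 = s := by
  rw [st_eq_coe_iff, isInfinitesimal_iff, coeff_sub, coeff_ofReal_zero, sub_eq_zero]
  refine and_congr_left fun _ => ⟨fun h => ?_, fun h => h.sub (OrdGE.ofReal s)⟩
  simpa using h.add (OrdGE.ofReal s)

lemma st_mono {x y : LC} (h : x ≤ y) : st x ≤ st y :=
  sInf_le_sInf fun _ ⟨z, hz, e⟩ => ⟨z, h.trans hz, e⟩

/-- `f` is itself a competitor, and monotonicity of the integral and of the standard part shows that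
no other competitor exceeds it. -/
lemma lowerM_eq {f : LC → LC} {a b v : LC} (hab : a < b) (hf : IsL1 f (Set.Icc a b))
    (hv : HasIntegral f (Set.Icc a b) v) : lowerM f (Set.Icc a b) = st v :=
  le_antisymm (sSup_le fun _ ⟨_, _, _, hw, hg, e⟩ => e ▸ st_mono (hw.mono hab hv hg))
    (le_sSup ⟨f, v, hf, hv, fun _ _ => le_rfl, rfl⟩)

lemma upperM_eq {f : LC → LC} {a b v : LC} (hab : a < b) (hf : IsL1 f (Set.Icc a b))
    (hv : HasIntegral f (Set.Icc a b) v) : upperM f (Set.Icc a b) = st v :=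
  le_antisymm (sInf_le ⟨f, v, hf, hv, fun _ _ => le_rfl, rfl⟩)
    (le_sInf fun _ ⟨_, _, _, hw, hg, e⟩ => e ▸ st_mono (hv.mono hab hw hg))

lemma HasMInt.eq_st {f : LC → LC} {a b v : LC} {u : EReal} (hab : a < b)
    (hf : IsL1 f (Set.Icc a b)) (hv : HasIntegral f (Set.Icc a b) v)
    (hb : IsBoundedOn f (Set.Icc a b)) (h : HasMInt f (Set.Icc a b) u) : u = st v := by
  rcases h.2 with h | h
  · exact h.2.1.symm.trans (lowerM_eq hab hf hv)
  · exact absurd hb h.1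

lemma hasMInt_st {f : LC → LC} {a b v : LC} (hab : a < b) (hf : IsL1 f (Set.Icc a b))
    (hv : HasIntegral f (Set.Icc a b) v) (hb : IsBoundedOn f (Set.Icc a b)) :
    HasMInt f (Set.Icc a b) (st v) :=
  ⟨⟨_, hasMeasure_Icc hab⟩, Or.inl ⟨hb, lowerM_eq hab hf hv, upperM_eq hab hf hv⟩⟩

/-! ## Comparison of integrals through finite families -/

/-- `v` is the limit of the sums of the integrals of `f` over finite families of intervals whose
total length tends to `b - a`. -/
def FamInt (f : LC → LC) (a b v : LC) : Prop :=
  ∀ ε, 0 < ε → ∃ η, 0 < η ∧ ∀ (ι : Type) (S : Finset ι) (c e : ι → LC), IsFam S c e a b →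
    (∀ i ∈ S, AnOn f (c i) (e i)) → b - a - ∑ i ∈ S, (e i - c i) < η →
      |∑ i ∈ S, sint f (c i) (e i) - v| < ε

/-- A pointwise comparison of integrals on good pieces, with the increments of `G` as correction,
survives the passage to the limit: the two sums approximate the integrals, and the Lipschitz bound
makes the increments of `G` over the gaps negligible. With constant `G` it compares two integrals
directly. -/
lemma FamInt.le {f g G : LC → LC} {Q : LC → LC → Prop} {a b v w s₁ s₂ C : LC} (hab : a ≤ b)
    (hf : FamInt f a b v) (hg : FamInt g a b w) (hQ : MF Q a b)
    (hQ' : ∀ p q, a ≤ p → p ≤ q → q ≤ b → Q p q → AnOn f p q ∧ AnOn g p q ∧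
      s₁ * sint f p q ≤ s₂ * sint g p q + (G q - G p))
    (hG : ∀ x y, a ≤ x → x ≤ y → y ≤ b → |G y - G x| ≤ C * (y - x)) :
    s₁ * v ≤ s₂ * w + (G b - G a) := by
  refine le_of_forall_pos_le_add fun ε hε => ?_
  have hK : 0 < |s₁| + |s₂| + |C| + 1 := by positivity
  set e := ε / (|s₁| + |s₂| + |C| + 1) with he
  have he0 : 0 < e := div_pos hε hK
  have heε : (|s₁| + |s₂| + |C| + 1) * e = ε := mul_div_cancel₀ _ hK.ne'
  obtain ⟨η₁, h1, H1⟩ := hf e he0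
  obtain ⟨η₂, h2, H2⟩ := hg e he0
  obtain ⟨ι, S, c, d, hF, hFQ, hs⟩ := hQ (min e (min η₁ η₂)) (lt_min he0 (lt_min h1 h2))
  have hP := fun i hi => hQ' _ _ (hF.left i hi) (hF.le i hi) (hF.right i hi) (hFQ i hi)
  have a1 := H1 ι S c d hF (fun i hi => (hP i hi).1)
    (hs.trans_le ((min_le_right _ _).trans (min_le_left _ _)))
  have a2 := H2 ι S c d hF (fun i hi => (hP i hi).2.1)
    (hs.trans_le ((min_le_right _ _).trans (min_le_right _ _)))
  have a3 := hF.abs_sub_sum_le hab hG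
  have a4 : s₁ * ∑ i ∈ S, sint f (c i) (d i) ≤
      s₂ * ∑ i ∈ S, sint g (c i) (d i) + ∑ i ∈ S, (G (d i) - G (c i)) := by
    rw [Finset.mul_sum, Finset.mul_sum, ← Finset.sum_add_distrib]
    exact Finset.sum_le_sum fun i hi => (hP i hi).2.2
  have hdef : 0 ≤ b - a - ∑ i ∈ S, (d i - c i) := sub_nonneg.2 (hF.sum_length_le hab)
  have a5 : C * (b - a - ∑ i ∈ S, (d i - c i)) ≤ |C| * e :=
    mul_le_mul (le_abs_self C) (hs.le.trans (min_le_left _ _)) hdef (abs_nonneg C)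
  have b1 : |s₁ * (∑ i ∈ S, sint f (c i) (d i) - v)| ≤ |s₁| * e := by
    rw [abs_mul]; exact mul_le_mul_of_nonneg_left a1.le (abs_nonneg _)
  have b2 : |s₂ * (∑ i ∈ S, sint g (c i) (d i) - w)| ≤ |s₂| * e := by
    rw [abs_mul]; exact mul_le_mul_of_nonneg_left a2.le (abs_nonneg _)
  have c1 := (abs_le.1 b1).1
  have c2 := (abs_le.1 b2).2
  have c3 := (abs_le.1 (a3.trans a5)).1
  rw [mul_sub] at c1 c2
  have c4 : |s₁| * e + |s₂| * e + |C| * e + e = ε := by rw [← heε]; ring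
  linarith

/-! ## Integration by parts -/

/-- `δ` is `k` times differentiable on the finite elements, vanishes at a distance greater than `h`
from `x₀`, and is analytic up to small total length on all finite intervals. -/
structure Bump (δ : LC → LC) (k : ℕ) (x₀ h : LC) : Prop where
  deriv : ∀ i < k, ∀ x, IsFinite x → HasDeriv (iterDeriv i δ) (iterDeriv (i + 1) δ x) x
  cont : ∀ i ≤ k, ∀ x, IsFinite x → ContAt (iterDeriv i δ) x
  zero : ∀ x, IsFinite x → h < |x - x₀| → δ x = 0
  mf : ∀ x y, IsFinite x → IsFinite y → x < y → MF (AnOn δ) x y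

lemma IsFinite.of_mem_Icc {a b x : LC} (ha : IsFinite a) (hb : IsFinite b)
    (hx : x ∈ Set.Icc a b) : IsFinite x := by
  rw [isFinite_iff] at *
  have h1 : OrdGE (x - a) 0 :=
    (hb.sub ha).of_le (by rw [abs_of_nonneg (sub_nonneg.2 hx.1)]; linarith [hx.2])
  simpa using h1.add ha

lemma exists_nhds_far {x x₀ h : LC} (hx : IsFinite x) (hh : h < |x - x₀|) :
    ∃ η, 0 < η ∧ ∀ y, |y - x| < η → IsFinite y ∧ h < |y - x₀| := by
  refine ⟨min 1 (|x - x₀| - h), lt_min one_pos (sub_pos.2 hh), fun y hy => ⟨?_, ?_⟩⟩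
  · rw [isFinite_iff] at *
    have h1 : OrdGE (y - x) 0 := OrdGE.one.of_le (hy.le.trans (min_le_left _ _))
    simpa using h1.add hx
  · have h1 := hy.trans_le (min_le_right _ _)
    have h2 := abs_sub_le x y x₀
    rw [abs_sub_comm x y] at h2
    linarith

/-- The value at `x` of the `i`-th derivative of the Taylor series with coefficients `c`. -/
def tser (R x₀ : LC) (c : ℕ → ℝ) (i : ℕ) (x : LC) : LC :=
  rser R x₀ (fun n => c (n + i) / (n.factorial : ℝ)) x

lemma hasDeriv_tser {R x₀ : LC} (hR0 : 0 < R) (hR : IsInfinitesimal R) (c : ℕ → ℝ) (i : ℕ) {x : LC}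
    (hx : x ∈ Set.Ioo (x₀ - R) (x₀ + R)) : HasDeriv (tser R x₀ c i) (tser R x₀ c (i + 1) x) x := by
  refine hasDeriv_rser hR0 hR _ (fun n => ?_) hx
  rw [Nat.factorial_succ, add_right_comm, add_assoc n]
  push_cast
  field_simp

section ByParts

variable {δ : LC → LC} {k : ℕ} {x₀ h R a b : LC} {c : ℕ → ℝ}

lemma Bump.iterDeriv_zero (hδ : Bump δ k x₀ h) {i : ℕ} (hi : i ≤ k) {x : LC} (hx : IsFinite x)
    (hh : h < |x - x₀|) : iterDeriv i δ x = 0 := by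
  induction i generalizing x with
  | zero => exact hδ.zero x hx hh
  | succ i ih =>
    obtain ⟨η, hη, H⟩ := exists_nhds_far hx hh
    exact (hδ.deriv i (by omega) x hx).unique ((hasDeriv_const 0 x).congr hη fun y hy =>
      (ih (by omega) (H y hy).1 (H y hy).2).symm)

/-- The intervals on which all the functions below are analytic. -/
def Good (δ : LC → LC) (x₀ R p q : LC) : Prop :=
  AnOn δ p q ∧ (q ≤ x₀ - R ∨ x₀ - R ≤ p) ∧ (q ≤ x₀ + R ∨ x₀ + R ≤ p) ∧ (q ≤ x₀ ∨ x₀ ≤ p)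

lemma hered_and {P Q : LC → LC → Prop} (hP : Hered P) (hQ : Hered Q) :
    Hered fun p q => P p q ∧ Q p q :=
  fun _ _ _ _ h h1 h2 h3 => ⟨hP _ _ _ _ h.1 h1 h2 h3, hQ _ _ _ _ h.2 h1 h2 h3⟩

lemma hered_good (δ : LC → LC) (x₀ R : LC) : Hered (Good δ x₀ R) :=
  hered_and (hered_anOn δ) (hered_and (hered_split _) (hered_and (hered_split _) (hered_split _)))

lemma Bump.mf_good (hδ : Bump δ k x₀ h) (R : LC) {x y : LC} (hx : IsFinite x) (hy : IsFinite y)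
    (hxy : x < y) : MF (Good δ x₀ R) x y :=
  (hδ.mf x y hx hy hxy).and hxy.le
    ((mf_split hxy.le _).and hxy.le
      ((mf_split hxy.le _).and hxy.le (mf_split hxy.le _) (hered_split _) (hered_split _))
      (hered_split _) (hered_and (hered_split _) (hered_split _)))
    (hered_anOn δ) (hered_and (hered_split _) (hered_and (hered_split _) (hered_split _)))

lemma AnOn.anIcc_of_contAt {f : LC → LC} {p q : LC} (hf : AnOn f p q) (hpq : p ≤ q)
    (hc : ∀ x ∈ Set.Icc p q, ContAt f x) : AnIcc f p q := by
  rcases hpq.eq_or_lt with rfl | hlt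
  · exact (anIcc_const (f p) p p).congr fun x hx => by rw [le_antisymm hx.2 hx.1]
  · obtain ⟨g, hg, e⟩ := hf
    exact hg.congr fun x hx => (hg.eq_of_contAt hlt e hx (hc x hx)).symm

lemma AnOn.of_hasDeriv {f f' : LC → LC} {p q : LC} (hf : AnOn f p q)
    (hd : ∀ x ∈ Set.Ioo p q, HasDeriv f (f' x) x) : AnOn f' p q := by
  by_cases hpq : p < q
  · obtain ⟨g, hg, e⟩ := hf
    obtain ⟨g', hg', hq⟩ := hg.exists_deriv hpq
    refine ⟨g', hg', fun x hx => (hd x hx).unique ((hq.hasDeriv hx).congr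
      (lt_min (sub_pos.2 hx.1) (sub_pos.2 hx.2)) fun y hy => (e y ?_).symm)⟩
    have h1 := abs_lt.1 (hy.trans_le (min_le_left _ _))
    have h2 := abs_lt.1 (hy.trans_le (min_le_right _ _))
    constructor <;> linarith
  · exact ⟨_, anIcc_const 0 p q, fun x hx => absurd (hx.1.trans hx.2) hpq⟩

/-- Analyticity in the interior passes to derivatives by their uniqueness. Continuity then extends
the identity with the power series to the endpoints. -/
lemma Bump.anIcc_iterDeriv (hδ : Bump δ k x₀ h) {i : ℕ} (hi : i ≤ k) {p q : LC}
    (hp : IsFinite p) (hq : IsFinite q) (hpq : p ≤ q) (hA : AnOn δ p q) :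
    AnIcc (iterDeriv i δ) p q := by
  have h1 : AnOn (iterDeriv i δ) p q := by
    induction i with
    | zero => exact hA
    | succ i ih =>
      exact (ih (by omega)).of_hasDeriv fun x hx =>
        hδ.deriv i (by omega) x (hp.of_mem_Icc hq (Set.Ioo_subset_Icc_self hx))
  exact h1.anIcc_of_contAt hpq fun x hx => hδ.cont i hi x (hp.of_mem_Icc hq hx)

/-- A good piece does not cross `x₀ ± R`. So it either avoids the strip where `δ` lives, or lies in
the disc of the Taylor series. -/
lemma Good.far_or_near (hhR : h < R) {p q : LC} (hA : Good δ x₀ R p q) :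
    (∀ z ∈ Set.Icc p q, h < |z - x₀|) ∨ (x₀ - R ≤ p ∧ q ≤ x₀ + R) := by
  rcases hA.2.1 with h1 | h1
  · refine Or.inl fun z hz => lt_abs.2 (Or.inr ?_)
    linarith [hz.2]
  rcases hA.2.2.1 with h2 | h2
  · exact Or.inr ⟨h1, h2⟩
  · refine Or.inl fun z hz => lt_abs.2 (Or.inl ?_)
    linarith [hz.1]

lemma Bump.anIcc_mul (hδ : Bump δ k x₀ h) (hR0 : 0 < R) (hR : IsInfinitesimal R) (hhR : h < R)
    {i : ℕ} (hi : i ≤ k) (m : ℕ) {p q : LC} (hp : IsFinite p) (hq : IsFinite q) (hpq : p ≤ q)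
    (hA : Good δ x₀ R p q) : AnIcc (fun x => iterDeriv i δ x * tser R x₀ c m x) p q := by
  rcases hA.far_or_near hhR with h1 | h1
  · refine (anIcc_const 0 p q).congr fun x hx => ?_
    rw [hδ.iterDeriv_zero hi (hp.of_mem_Icc hq hx) (h1 x hx), zero_mul]
  · exact (hδ.anIcc_iterDeriv hi hp hq hpq hA.1).mul ((anIcc_rser hR0 hR _).restrict h1.1 hpq h1.2)

/-- Off the strip the product vanishes in a neighbourhood, whatever value the series takes there. On
the strip `h < R` puts the point in the interior of the disc, where the product rule applies. -/
lemma Bump.hasDeriv_mul (hδ : Bump δ k x₀ h) (hR0 : 0 < R) (hR : IsInfinitesimal R) (hhR : h < R)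
    {i : ℕ} (hi : i < k) (m : ℕ) {x : LC} (hx : IsFinite x) :
    HasDeriv (fun x => iterDeriv i δ x * tser R x₀ c m x)
      (iterDeriv (i + 1) δ x * tser R x₀ c m x + iterDeriv i δ x * tser R x₀ c (m + 1) x) x := by
  by_cases hh : h < |x - x₀|
  · obtain ⟨η, hη, H⟩ := exists_nhds_far hx hh
    rw [hδ.iterDeriv_zero (show i + 1 ≤ k by omega) hx hh, hδ.iterDeriv_zero hi.le hx hh, zero_mul,
      zero_mul, add_zero]
    exact (hasDeriv_const 0 x).congr hη fun y hy => by
      rw [hδ.iterDeriv_zero hi.le (H y hy).1 (H y hy).2, zero_mul]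
  · have h1 := abs_le.1 (not_lt.1 hh)
    exact (hδ.deriv i hi x hx).mul
      (hasDeriv_tser hR0 hR c m ⟨by linarith [h1.1], by linarith [h1.2]⟩)

lemma Bump.bounded (hδ : Bump δ k x₀ h) (ha : IsFinite a) (hb : IsFinite b) (hab : a ≤ b)
    {i : ℕ} (hi : i ≤ k) : ∃ K, ∀ x ∈ Set.Icc a b, |iterDeriv i δ x| ≤ K := by
  refine bounded_of_contAt hab (fun x hx => hδ.cont i hi x (ha.of_mem_Icc hb hx))
    fun x y hx hxy hy => ?_
  have hx' := ha.of_mem_Icc hb ⟨hx, hxy.le.trans hy⟩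
  have hy' := ha.of_mem_Icc hb ⟨hx.trans hxy.le, hy⟩
  exact (hδ.mf x y hx' hy' hxy).imp fun p q hp hpq hq hA =>
    (hδ.anIcc_iterDeriv hi (hx'.of_mem_Icc hy' ⟨hp, hpq.trans hq⟩)
      (hx'.of_mem_Icc hy' ⟨hp.trans hpq, hq⟩) hpq hA).anOn

lemma Bump.bounded_mul (hδ : Bump δ k x₀ h) (hR0 : 0 < R) (hR : IsInfinitesimal R) (hhR : h < R)
    (ha : IsFinite a) (hb : IsFinite b) (hab : a ≤ b) {i : ℕ} (hi : i ≤ k) (m : ℕ) :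
    ∃ K, ∀ x ∈ Set.Icc a b, |iterDeriv i δ x * tser R x₀ c m x| ≤ K := by
  obtain ⟨K, hK⟩ := hδ.bounded ha hb hab hi
  obtain ⟨L, hL0, hL⟩ := (anIcc_rser hR0 hR (x₀ := x₀)
    (fun n => c (n + m) / (n.factorial : ℝ))).bounded
  have hK0 : 0 ≤ K := (abs_nonneg _).trans (hK a (Set.left_mem_Icc.2 hab))
  refine ⟨K * L, fun x hx => ?_⟩
  by_cases hh : h < |x - x₀|
  · rw [hδ.iterDeriv_zero hi (ha.of_mem_Icc hb hx) hh, zero_mul, abs_zero]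
    exact mul_nonneg hK0 hL0.le
  · have h1 := abs_le.1 (not_lt.1 hh)
    rw [abs_mul]
    exact mul_le_mul (hK x hx) (hL x ⟨by linarith [h1.1], by linarith [h1.2]⟩) (abs_nonneg _) hK0

/-- The function `∑ i < k, (-1) ^ i δ⁽ᵏ⁻¹⁻ⁱ⁾ T⁽ⁱ⁾` of repeated integration by parts. -/
def partsFn (δ : LC → LC) (k : ℕ) (R x₀ : LC) (c : ℕ → ℝ) (x : LC) : LC :=
  ∑ i ∈ Finset.range k, (-1) ^ i * (iterDeriv (k - (i + 1)) δ x * tser R x₀ c i x)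

/-- By the product rule the `i`-th summand has as derivative the difference of consecutive terms
`(-1)ⁱ δ⁽ᵏ⁻ⁱ⁾ T⁽ⁱ⁾`, and the sum telescopes. -/
lemma Bump.hasDeriv_partsFn (hδ : Bump δ k x₀ h) (hR0 : 0 < R) (hR : IsInfinitesimal R)
    (hhR : h < R) {x : LC} (hx : IsFinite x) : HasDeriv (partsFn δ k R x₀ c)
      (iterDeriv k δ x * tser R x₀ c 0 x - (-1) ^ k * (δ x * tser R x₀ c k x)) x := by
  have h1 := HasDeriv.sum (Finset.range k) (x := x)
    (f := fun i x => (-1) ^ i * (iterDeriv (k - (i + 1)) δ x * tser R x₀ c i x))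
    fun i hi => (hδ.hasDeriv_mul hR0 hR hhR (c := c)
      (show k - (i + 1) < k by have := Finset.mem_range.1 hi; omega) i hx).const_mul ((-1) ^ i)
  have h2 := Finset.sum_range_sub'
    (fun i => (-1) ^ i * (iterDeriv (k - i) δ x * tser R x₀ c i x)) k
  simp only [pow_zero, one_mul, Nat.sub_zero, Nat.sub_self] at h2
  change HasDeriv _ (_ - (-1) ^ k * (iterDeriv 0 δ x * _)) x
  rw [← h2]
  refine (congrArg (fun l => HasDeriv (partsFn δ k R x₀ c) l x) ?_).mp h1
  refine Finset.sum_congr rfl fun i hi => ?_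
  rw [show k - (i + 1) + 1 = k - i by have := Finset.mem_range.1 hi; omega, pow_succ]
  ring

/-- Repeated integration by parts. -/
theorem Bump.integral_eq (hδ : Bump δ k x₀ h) (hR0 : 0 < R) (hR : IsInfinitesimal R)
    (hhR : h < R) (ha : IsFinite a) (hb : IsFinite b) (hab : a < b) (hfa : h < |a - x₀|)
    (hfb : h < |b - x₀|) {v w : LC}
    (hv : FamInt (fun x => iterDeriv k δ x * tser R x₀ c 0 x) a b v)
    (hw : FamInt (fun x => δ x * tser R x₀ c k x) a b w) : v = (-1) ^ k * w := by
  set f : LC → LC := fun x => iterDeriv k δ x * tser R x₀ c 0 x with hf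
  set g : LC → LC := fun x => δ x * tser R x₀ c k x with hg
  set G := partsFn δ k R x₀ c with hG
  have hfin : ∀ {x}, x ∈ Set.Icc a b → IsFinite x := fun hx => ha.of_mem_Icc hb hx
  have hd : ∀ x ∈ Set.Icc a b, HasDeriv G (f x - (-1) ^ k * g x) x := fun x hx =>
    hδ.hasDeriv_partsFn hR0 hR hhR (hfin hx)
  obtain ⟨K, hK⟩ := hδ.bounded_mul hR0 hR hhR ha hb hab.le le_rfl 0 (c := c)
  obtain ⟨L, hL⟩ := hδ.bounded_mul hR0 hR hhR ha hb hab.le (Nat.zero_le k) k (c := c)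
  have hM : ∀ x ∈ Set.Icc a b, |f x - (-1) ^ k * g x| ≤ K + L := fun x hx => by
    refine (abs_sub _ _).trans (add_le_add (hK x hx) ?_)
    rw [abs_mul, abs_pow, abs_neg, abs_one, one_pow, one_mul]
    exact hL x hx
  have hpiece : ∀ p q, a ≤ p → p ≤ q → q ≤ b → Good δ x₀ R p q → AnOn f p q ∧ AnOn g p q ∧
      Prim G (fun x => f x - (-1) ^ k * g x) p q := by
    intro p q hp hpq hq hA
    have hp' := hfin ⟨hp, hpq.trans hq⟩
    have hq' := hfin ⟨hp.trans hpq, hq⟩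
    refine ⟨(hδ.anIcc_mul hR0 hR hhR le_rfl 0 hp' hq' hpq hA).anOn,
      (hδ.anIcc_mul hR0 hR hhR (Nat.zero_le k) k hp' hq' hpq hA).anOn, ?_,
      fun x hx => hd x ⟨hp.trans hx.1.le, hx.2.le.trans hq⟩⟩
    exact AnIcc.sum _ fun i hi =>
      (hδ.anIcc_mul hR0 hR hhR (Nat.sub_le _ _) i hp' hq' hpq hA).const_mul _
  -- This is where differentiability at every point enters. It controls `G` across the gaps between
  -- good pieces, where no power series is available.
  have hlip : ∀ x y, a ≤ x → x ≤ y → y ≤ b → |G y - G x| ≤ (K + L + 1) * (y - x) := by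
    intro x y hx hxy hy
    refine abs_sub_le_of_hasDeriv hxy (lt_add_one (K + L))
      (fun z hz => hd z (Set.Icc_subset_Icc hx hy hz))
      (fun z hz => hM z (Set.Icc_subset_Icc hx hy hz)) fun x' y' hx' hxy' hy' => ?_
    have hxa := hx.trans hx'
    have hyb := hy'.trans hy
    refine (hδ.mf_good R (hfin ⟨hxa, hxy'.le.trans hyb⟩) (hfin ⟨hxa.trans hxy'.le, hyb⟩) hxy').imp
      fun p q hp hpq hq hA => ?_
    refine ((hpiece p q (hxa.trans hp) hpq (hq.trans hyb) hA).2.2.abs_increment_le hpq fun z hz =>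
      hM z ⟨(hxa.trans hp).trans hz.1.le, hz.2.le.trans (hq.trans hyb)⟩).trans ?_
    exact mul_le_mul_of_nonneg_right (lt_add_one (K + L)).le (sub_nonneg.2 hpq)
  -- Every summand contains a derivative of `δ`, so there are no boundary terms at `a` and `b`.
  have hG0 : ∀ x, IsFinite x → h < |x - x₀| → G x = 0 := fun x hx hh =>
    Finset.sum_eq_zero fun i _ => by
      rw [hδ.iterDeriv_zero (Nat.sub_le _ _) hx hh, zero_mul, MulZeroClass.mul_zero]
  have hsint : ∀ p q, a ≤ p → p ≤ q → q ≤ b → Good δ x₀ R p q →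
      sint f p q = (-1) ^ k * sint g p q + (G q - G p) := by
    intro p q hp hpq hq hA
    obtain ⟨h1, h2, h3⟩ := hpiece p q hp hpq hq hA
    have h4 := h3.sint_eq hpq
    rw [sint_sub h1 (h2.const_mul _) hpq, sint_const_mul h2 _ hpq] at h4
    rw [← h4]
    ring
  have hmf := hδ.mf_good R ha hb hab
  -- The equality on good pieces is used as two inequalities, with `G` and with `-G`.
  have e1 : 1 * v ≤ (-1) ^ k * w + (G b - G a) := hv.le hab.le hw hmf
    (fun p q hp hpq hq hA => ⟨(hpiece p q hp hpq hq hA).1, (hpiece p q hp hpq hq hA).2.1,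
      by rw [one_mul, hsint p q hp hpq hq hA]⟩) hlip
  have e2 : (-1) ^ k * w ≤ 1 * v + (-G b - -G a) := hw.le (G := fun x => -G x) hab.le hv hmf
    (fun p q hp hpq hq hA => ⟨(hpiece p q hp hpq hq hA).2.1, (hpiece p q hp hpq hq hA).1,
      by rw [hsint p q hp hpq hq hA]; linarith⟩)
    fun x y hx hxy hy => by
      rw [neg_sub_neg, abs_sub_comm]
      exact hlip x y hx hxy hy
  rw [hG0 a ha hfa, hG0 b hb hfb] at e1 e2
  linarith

end ByParts

/-! ### M-integral of a derivative of a Dirac-like function times a Taylor series -/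

section Main

variable {δ : LC → LC} {k : ℕ} {x₀ h R a b : LC} {c : ℕ → ℝ}

lemma AnOn.abs_mul_of_constSign {f g : LC → LC} {p q : LC} (hf : AnOn (fun x => |f x|) p q)
    (hg : AnOn g p q) (hs : ConstSign g (Set.Icc p q)) : AnOn (fun x => |f x * g x|) p q := by
  rcases hs with hs | hs
  · exact (hf.mul hg).congr fun x hx => by
      rw [abs_mul, abs_of_nonneg (hs x (Set.Ioo_subset_Icc_self hx))]
  · exact (hf.mul (hg.const_mul (-1))).congr fun x hx => by
      rw [abs_mul, abs_of_nonpos (hs x (Set.Ioo_subset_Icc_self hx)), neg_one_mul]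

lemma ConstSign.mono {g : LC → LC} {S T : Set LC} (hg : ConstSign g T) (h : S ⊆ T) :
    ConstSign g S :=
  hg.imp (fun H x hx => H x (h hx)) fun H x hx => H x (h hx)

/-- On each side of `x₀` the series has one sign, so the absolute value of the product is `|δ⁽ᵏ⁾|`
times plus or minus the series. This is why good pieces do not cross `x₀` and why the measurability
of `|δ⁽ᵏ⁾|` is needed. -/
lemma Bump.mf_abs_mul (hδ : Bump δ k x₀ h) (hR0 : 0 < R) (hR : IsInfinitesimal R) (hhR : h < R)
    (ha : IsFinite a) (hb : IsFinite b) (hab : a < b)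
    (habs : MF (AnOn fun x => |iterDeriv k δ x|) a b) :
    MF (AnOn fun x => |iterDeriv k δ x * tser R x₀ c 0 x|) a b := by
  refine (habs.and hab.le (hδ.mf_good R ha hb hab) (hered_anOn _) (hered_good δ x₀ R)).imp
    fun p q hp hpq hq hA => ?_
  rcases hA.2.far_or_near hhR with h1 | h1
  · refine (anIcc_const 0 p q).anOn.congr fun x hx => ?_
    rw [hδ.iterDeriv_zero le_rfl (ha.of_mem_Icc hb ⟨hp.trans hx.1.le, hx.2.le.trans hq⟩)
      (h1 x (Set.Ioo_subset_Icc_self hx)), zero_mul, abs_zero]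
  · have hT := constSign_rser hR0 hR (x₀ := x₀) fun n => c (n + 0) / (n.factorial : ℝ)
    refine hA.1.abs_mul_of_constSign ((anIcc_rser hR0 hR _).restrict h1.1 hpq h1.2).anOn ?_
    rcases hA.2.2.2.2 with h2 | h2
    · exact hT.2.mono (Set.Icc_subset_Icc h1.1 h2)
    · exact hT.1.mono (Set.Icc_subset_Icc h2 h1.2)

/-- The integral of `δ T⁽ᵏ⁾` is close to `T⁽ᵏ⁾(x₀)` times the integral of `δ`. -/
lemma Bump.exists_abs_sub_le (hδ : Bump δ k x₀ h) (hR0 : 0 < R) (hR : IsInfinitesimal R)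
    (hhR : h < R) (ha : IsFinite a) (hb : IsFinite b) (hab : a < b)
    (hpos : ∀ x, IsFinite x → 0 ≤ δ x) {w v : LC}
    (hw : FamInt (fun x => δ x * tser R x₀ c k x) a b w) (hv : FamInt δ a b v) :
    ∃ κ > 0, |w - ofReal (c k) * v| ≤ mono 1 κ * v := by
  obtain ⟨κ, hκ, H⟩ := exists_rser_sub_le hR0 hR (fun n => c (n + k) / (n.factorial : ℝ)) (x₀ := x₀)
  simp only [zero_add, Nat.factorial_zero, Nat.cast_one, div_one] at H
  refine ⟨κ, hκ, ?_⟩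
  have hμ := (mono_pos one_pos κ).le
  -- Nonnegativity of `δ` lets the uniform infinitesimal bound on the series be integrated against
  -- `δ`. Off the strip both sides vanish.
  have hbd : ∀ x ∈ Set.Icc a b, |δ x * tser R x₀ c k x - ofReal (c k) * δ x| ≤ mono 1 κ * δ x := by
    intro x hx
    have hx' := ha.of_mem_Icc hb hx
    rw [show δ x * tser R x₀ c k x - ofReal (c k) * δ x =
      (tser R x₀ c k x - ofReal (c k)) * δ x by ring, abs_mul, abs_of_nonneg (hpos x hx')]
    by_cases hh : h < |x - x₀|
    · rw [hδ.zero x hx' hh, MulZeroClass.mul_zero, MulZeroClass.mul_zero]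
    · have h1 := abs_le.1 (not_lt.1 hh)
      exact mul_le_mul_of_nonneg_right (H x ⟨by linarith [h1.1], by linarith [h1.2]⟩) (hpos x hx')
  have hp : ∀ p q, a ≤ p → p ≤ q → q ≤ b → Good δ x₀ R p q →
      AnOn (fun x => δ x * tser R x₀ c k x) p q := fun p q hp hpq hq hA =>
    (hδ.anIcc_mul hR0 hR hhR (Nat.zero_le k) k (ha.of_mem_Icc hb ⟨hp, hpq.trans hq⟩)
      (ha.of_mem_Icc hb ⟨hp.trans hpq, hq⟩) hpq hA).anOn
  have h0 : ∀ x y : LC, a ≤ x → x ≤ y → y ≤ b →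
      |(fun _ => (0 : LC)) y - (fun _ => (0 : LC)) x| ≤ 0 * (y - x) := by simp
  have hmf := hδ.mf_good R ha hb hab
  have e1 := hw.le (s₁ := 1) (s₂ := ofReal (c k) + mono 1 κ) hab.le hv hmf
    (fun p q h1 hpq h2 hA => ⟨hp p q h1 hpq h2 hA, hA.1, by
      rw [← sint_const_mul hA.1 _ hpq, one_mul, sub_zero, add_zero]
      exact sint_mono (hp p q h1 hpq h2 hA) (hA.1.const_mul _) hpq fun x hx => by
        have := (abs_le.1 (hbd x ⟨h1.trans hx.1.le, hx.2.le.trans h2⟩)).2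
        linarith⟩) h0
  have e2 := hv.le (s₂ := 1) (s₁ := ofReal (c k) - mono 1 κ) hab.le hw hmf
    (fun p q h1 hpq h2 hA => ⟨hA.1, hp p q h1 hpq h2 hA, by
      rw [← sint_const_mul hA.1 _ hpq, one_mul, sub_zero, add_zero]
      exact sint_mono (hA.1.const_mul _) (hp p q h1 hpq h2 hA) hpq fun x hx => by
        have := (abs_le.1 (hbd x ⟨h1.trans hx.1.le, hx.2.le.trans h2⟩)).1
        linarith⟩) h0
  rw [abs_le]
  constructor <;> linarith

/-- The M-integral over `[a, b]` of the `k`-th derivative of a Dirac-like function times a power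
series. -/
theorem Bump.hasMInt (hδ : Bump δ k x₀ h) (hR0 : 0 < R) (hR : IsInfinitesimal R)
    (hhR : h < R) (ha : IsFinite a) (hb : IsFinite b) (hab : a < b) (hfa : h < |a - x₀|)
    (hfb : h < |b - x₀|) (hpos : ∀ x, IsFinite x → 0 ≤ δ x) (hL1 : IsL1 δ (Set.Icc a b))
    (hL1k : IsL1 (iterDeriv k δ) (Set.Icc a b)) {s : ℝ} (hs : HasMInt δ (Set.Icc a b) (s : EReal))
    {E : LC → LC} (hE : ∀ x ∈ Set.Icc a b, E x = iterDeriv k δ x * tser R x₀ c 0 x) :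
    HasMInt E (Set.Icc a b) (((-1) ^ k * (c k * s) : ℝ) : EReal) := by
  have hfin : ∀ {x}, x ∈ Set.Icc a b → IsFinite x := fun hx => ha.of_mem_Icc hb hx
  have hEo : ∀ p q, a ≤ p → q ≤ b → ∀ x ∈ Set.Ioo p q,
      iterDeriv k δ x * tser R x₀ c 0 x = E x := fun p q hp hq x hx =>
    (hE x ⟨hp.trans hx.1.le, hx.2.le.trans hq⟩).symm
  have hmf := hδ.mf_good R ha hb hab
  obtain ⟨K, hK⟩ := hδ.bounded_mul hR0 hR hhR ha hb hab.le le_rfl 0 (c := c)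
  obtain ⟨L, hL⟩ := hδ.bounded_mul hR0 hR hhR ha hb hab.le (Nat.zero_le k) k (c := c)
  obtain ⟨B, hB⟩ := hδ.bounded ha hb hab.le (Nat.zero_le k)
  obtain ⟨v, hv, hv'⟩ := exists_hasIntegral hab (hδ.mf a b ha hb hab) hB
  obtain ⟨w, -, hw'⟩ := exists_hasIntegral (f := fun x => δ x * tser R x₀ c k x) hab
    (hmf.imp fun p q hp hpq hq hA => (hδ.anIcc_mul hR0 hR hhR (Nat.zero_le k) k
      (hfin ⟨hp, hpq.trans hq⟩) (hfin ⟨hp.trans hpq, hq⟩) hpq hA).anOn) hL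
  have hmfE₀ : MF (AnOn fun x => iterDeriv k δ x * tser R x₀ c 0 x) a b :=
    hmf.imp fun p q hp hpq hq hA => (hδ.anIcc_mul hR0 hR hhR le_rfl 0
      (hfin ⟨hp, hpq.trans hq⟩) (hfin ⟨hp.trans hpq, hq⟩) hpq hA).anOn
  have hmfE : MF (AnOn E) a b := hmfE₀.imp fun p q hp _ hq hA => hA.congr (hEo p q hp hq)
  have hKE : ∀ x ∈ Set.Icc a b, |E x| ≤ K := fun x hx => hE x hx ▸ hK x hx
  obtain ⟨v₀, hv₀, hv₀'⟩ := exists_hasIntegral hab hmfE hKE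
  obtain ⟨v₁, -, hv₁'⟩ := exists_hasIntegral hab hmfE₀ hK
  -- The function `E` is prescribed on `[a, b]` only, so its integral is identified with that of the
  -- explicit product piece by piece.
  have hv₀₁ : v₀ = v₁ := by
    have hc : ∀ p q, a ≤ p → p ≤ q → q ≤ b →
        AnOn (fun x => iterDeriv k δ x * tser R x₀ c 0 x) p q → AnOn E p q ∧ sint E p q =
          sint (fun x => iterDeriv k δ x * tser R x₀ c 0 x) p q := fun p q hp hpq hq hA => by
      have h1 := hA.congr (hEo p q hp hq)
      exact ⟨h1, le_antisymm (sint_mono h1 hA hpq fun x hx => (hEo p q hp hq x hx).ge)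
        (sint_mono hA h1 hpq fun x hx => (hEo p q hp hq x hx).le)⟩
    have h0 : ∀ x y : LC, a ≤ x → x ≤ y → y ≤ b →
      |(fun _ => (0 : LC)) y - (fun _ => (0 : LC)) x| ≤ 0 * (y - x) := by simp
    have e1 := FamInt.le (s₁ := 1) (s₂ := 1) hab.le hv₀' hv₁' hmfE₀
      (fun p q hp hpq hq hA => ⟨(hc p q hp hpq hq hA).1, hA, by
        rw [(hc p q hp hpq hq hA).2, sub_zero, add_zero]⟩) h0
    have e2 := FamInt.le (s₁ := 1) (s₂ := 1) hab.le hv₁' hv₀' hmfE₀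
      (fun p q hp hpq hq hA => ⟨hA, (hc p q hp hpq hq hA).1, by
        rw [(hc p q hp hpq hq hA).2, sub_zero, add_zero]⟩) h0
    linarith
  obtain ⟨vk, hvk⟩ := hL1k.2
  have habsE : MF (AnOn fun x => |E x|) a b :=
    (hδ.mf_abs_mul hR0 hR hhR ha hb hab (hvk.1.mf hab) (c := c)).imp fun p q hp _ hq hA =>
      hA.congr fun x hx => by rw [hEo p q hp hq x hx]
  have hEL1 : IsL1 E (Set.Icc a b) := by
    obtain ⟨z, hz, -⟩ := exists_hasIntegral hab habsE (M := K) fun x hx => by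
      rw [abs_abs]; exact hKE x hx
    exact ⟨hv₀.1, z, hz⟩
  have hst := st_eq_coe_iff_coeff.1 (hs.eq_st hab hL1 hv ⟨B, hB⟩).symm
  obtain ⟨κ, hκ, hwv⟩ := hδ.exists_abs_sub_le hR0 hR hhR ha hb hab hpos hw' hv'
  have hv₁ : v₁ = (-1) ^ k * w := hδ.integral_eq hR0 hR hhR ha hb hab hfa hfb hv₁' hw'
  -- Since the integral of `δ` is finite, the error has order at least `κ > 0` and does not affect
  -- the standard part.
  have hκ' : OrdGE (w - ofReal (c k) * v) κ := by
    have h1 := (OrdGE.mono_self 1 κ).mul hst.1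
    rw [add_zero] at h1
    exact h1.of_le hwv
  have hwc : OrdGE w 0 ∧ w.coeff 0 = c k * s := by
    have h1 := hκ' 0 hκ
    rw [coeff_sub, coeff_ofReal_mul, hst.2, sub_eq_zero] at h1
    refine ⟨?_, h1⟩
    simpa using (hκ'.mono hκ.le).add ((OrdGE.ofReal (c k)).mul_zero hst.1)
  have hres : st v₀ = (((-1) ^ k * (c k * s) : ℝ) : EReal) := by
    rw [st_eq_coe_iff_coeff, hv₀₁, hv₁, show (-1 : LC) ^ k = ofReal ((-1) ^ k) by simp, coeff_ofReal_mul, hwc.2]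
    exact ⟨(OrdGE.ofReal _).mul_zero hwc.1, rfl⟩
  rw [← hres]
  exact hasMInt_st hab hEL1 hv₀ ⟨K, hKE⟩

end Main

/-! ### Taylor series of the extension and passage to all finite elements -/

/-- Near `r` the extension of a function is the sum of its Taylor series. -/
lemma ext_eq_tser {R : LC} (hR0 : 0 < R) (hR : IsInfinitesimal R) (j : ℕ∞) (f : ℝ → ℝ) {r : ℝ}
    {c : ℕ → ℝ} (hc : ∀ i : ℕ, c i = if (i : ℕ∞) ≤ j then iteratedDeriv i f r else 0) {x : LC}
    (hx : x ∈ Set.Icc (ofReal r - R) (ofReal r + R)) :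
    ext j f x = tser R (ofReal r) c 0 x := by
  have hst : (st x).toReal = r := by
    rw [st_eq_coe_iff.2 (sub_infinitesimal hR hx), EReal.toReal_coe]
  refine WeakLim.wlim_eq ?_
  rw [hst]
  refine weakLim_congr (rser_hasWSum hR0 hR _ hx).weakLim fun N => ?_
  rw [Finset.sum_filter]
  refine Finset.sum_congr rfl fun i _ => ?_
  rw [add_zero, hc i]
  split_ifs
  · rfl
  · rw [zero_div, ofReal_zero, zero_mul]

lemma IsDiracLike.exists_bump {δ : LC → LC} {r : ℝ} (hδ : IsDiracLike δ r) {k : ℕ}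
    (hL1 : IsL1Fin δ) (hCk : IsCk k δ {x | IsFinite x}) :
    ∃ h, 0 < h ∧ IsInfinitesimal h ∧ Bump δ k (ofReal r) h := by
  obtain ⟨-, ⟨h, h0, hh, hz⟩, -⟩ := hδ
  refine ⟨h, h0, hh, fun i hi x hx => ?_, fun i hi x hx => hCk.2 i hi x hx, fun x hx hlt => ?_,
    fun x y hx hy hxy => (hL1 x y hx hy hxy).1.mf hxy⟩
  · rw [iterDeriv, iterDeriv, Function.iterate_succ_apply']
    exact hasDeriv_deriv (hCk.1 i hi x hx)
  · by_contra hne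
    have h1 := hz x hx hne
    exact hlt.not_ge (abs_le.2 ⟨by linarith [h1.1], by linarith [h1.2]⟩)

end LC

end

theorem mainTheorem11 (r : ℝ) (δ : LC → LC) (k : ℕ)
    (hδ : LC.IsDiracLike δ r)
    (hL1 : LC.IsL1Fin δ)
    (hCk : LC.IsCk k δ {x | LC.IsFinite x})
    (hL1k : LC.IsL1Fin (LC.iterDeriv k δ))
    (n j : ℕ∞) (hkj : (k : ℕ∞) ≤ j) (hjn : j ≤ n)
    (f : ℝ → ℝ) (hf : ContDiff ℝ n f) :
    LC.HasMIntFin (fun x => LC.iterDeriv k δ x * LC.ext j f x)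
      ((-1) ^ k * iteratedDeriv k f r) := by
  classical
  obtain ⟨h, h0, hh, hB⟩ := hδ.exists_bump hL1 hCk
  obtain ⟨hpos, -, u, hu, hlim⟩ := hδ
  -- The radius `2 h` keeps the strip where `δ` lives strictly inside the disc of the Taylor series.
  have hR0 : 0 < h + h := add_pos h0 h0
  have hR : LC.IsInfinitesimal (h + h) := by
    rw [LC.isInfinitesimal_iff] at hh ⊢
    exact ⟨hh.1.add hh.1, by rw [LC.coeff_add, hh.2, add_zero]⟩
  have hhR : h < h + h := by linarith
  -- Cutting the coefficients off beyond `j` treats finite and infinite orders alike. The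
  -- coefficient of index `k` survives because `k ≤ j`.
  set c : ℕ → ℝ := fun i => if (i : ℕ∞) ≤ j then iteratedDeriv i f r else 0 with hc
  have hck : c k = iteratedDeriv k f r := if_pos hkj
  have hfin : ∀ y : ℝ, LC.IsFinite (LC.ofReal y) := fun y => LC.isFinite_iff.2 (LC.OrdGE.ofReal y)
  have hfar : ∀ y : ℝ, 1 < |y - r| → h < |LC.ofReal y - LC.ofReal r| := fun y hy => by
    rw [← LC.ofReal_sub, LC.ofReal_abs]
    exact ((le_abs_self h).trans (hh 1 one_pos)).trans_lt (LC.ofReal_lt_ofReal.2 hy)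
  -- The M-integrals over `[-t, t]` are extended reals. Their limit `1` makes them real for large
  -- `t`, as required by `Bump.hasMInt`.
  have hcoe : ∀ᶠ t in atTop, ((u t).toReal : EReal) = u t := by
    have h1 : ∀ᶠ t in atTop, u t ∈ Set.Ioo (⊥ : EReal) ⊤ :=
      hlim.eventually (Ioo_mem_nhds (EReal.bot_lt_coe 1) (EReal.coe_lt_top 1))
    filter_upwards [h1] with t ht using EReal.coe_toReal ht.2.ne ht.1.ne'
  refine ⟨fun t => (((-1) ^ k * (c k * (u t).toReal) : ℝ) : EReal), ?_, ?_⟩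
  -- The condition `t > |r| + 1` puts both endpoints at a real distance greater than `1` from `r`,
  -- hence outside the infinitesimal strip.
  · filter_upwards [hu, hcoe, eventually_gt_atTop (|r| + 1)] with t ht htc htr
    have hr := abs_le.1 (le_refl |r|)
    have hab : LC.ofReal (-t) < LC.ofReal t := LC.ofReal_lt_ofReal.2 (by linarith [abs_nonneg r])
    rw [← htc] at ht
    refine hB.hasMInt hR0 hR hhR (hfin _) (hfin _) hab
      (hfar _ (lt_abs.2 (Or.inr (by linarith [hr.1])))) (hfar _ (lt_abs.2 (Or.inl (by linarith [hr.2]))))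
      hpos (hL1 _ _ (hfin _) (hfin _) hab) (hL1k _ _ (hfin _) (hfin _) hab) ht fun x hx => ?_
    by_cases hx' : h < |x - LC.ofReal r|
    · rw [hB.iterDeriv_zero le_rfl ((hfin _).of_mem_Icc (hfin _) hx) hx', zero_mul, zero_mul]
    · have h1 := abs_le.1 (not_lt.1 hx')
      rw [LC.ext_eq_tser hR0 hR j f (fun i => rfl) ⟨by linarith [h1.1], by linarith [h1.2]⟩]
  · have h1 : Tendsto (fun t => (u t).toReal) atTop (𝓝 1) :=
      (EReal.tendsto_toReal (EReal.coe_ne_top 1) (EReal.coe_ne_bot 1)).comp hlim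
    have h2 : Tendsto (fun t => (-1) ^ k * (c k * (u t).toReal)) atTop
        (𝓝 ((-1) ^ k * (c k * 1))) := (h1.const_mul (c k)).const_mul ((-1) ^ k)
    rw [mul_one, hck] at h2
    rw [hck]
    exact (continuous_coe_real_ereal.tendsto _).comp h2
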